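/- Theorem 7.1. A long virtual knot is an equivalence class of long virtual knot diagrams (equivalently, long Gauss diagrams) under Reidemeister moves. A surface realization of a diagram $D$ is a realization of $D$ as a diagram of a closed based curve on a closed connected oriented surface $\Sigma_g$, the basepoint corresponding to $\pm\infty$ and the crossings being the real crossings $c_1,\dots,c_n$ of $D$, with signs $\varepsilon_i\in\{\pm1\}$. The crossing $c_i$ is of type $0$ if, starting from the basepoint, it is passed first over and then under, and of type $1$ otherwise; $I_a(D)$ is the set of $i$ with $c_i$ of type $a$, and $\omega_a(D)=\sum_{i\in I_a(D)}\varepsilon_i$. Smoothing $D$ at $c_i$ gives two cycles on $\Sigma_g$: $\alpha_i$, which does not contain the basepoint, and $\beta_i$, which does. Let $\cdot$ denote the intersection number. For $a\in\{0,1\}$ put \[W_a(K;t)=\sum_{i\in I_a(D)}\varepsilon_i\,(t^{\alpha_i\cdot\beta_i}-1),\qquad F_{aa}(K;t)=\sum_{i,j\in I_a(D)}\varepsilon_i\varepsilon_j\,(t^{\alpha_i\cdot\alpha_j}-1),\] \[H_{aa}(K;t)=\sum_{i,j\in I_a(D)}\varepsilon_i\varepsilon_j\,(t^{\beta_i\cdot\beta_j}-1)-\omega_a(D)\,W_a(K;t)-\omega_a(D)\,W_a(K;t^{-1}),\]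 where $D$ is any diagram of the long virtual knot $K$; these are invariants of $K$. Let $sg_1(K)$ be the minimal genus $g$ of a surface realization $(\Sigma_g,D)$ of a diagram $D$ of $K$. Let $f(t)\in\mathbb{Z}[t,t^{-1}]$ be a Laurent polynomial. Then the following are equivalent. (i) There exists a long virtual knot $K$ with $F_{00}(K;t)=f(t)$. (ii) There exists a long virtual knot $K'$ with $F_{00}(K';t)=f(t)$ and $sg_1(K')\le 1$. (iii) $f(1)=0$ and $f(t)=f(t^{-1})$. The same equivalence holds with $F_{00}$ replaced by $F_{11}$, by $H_{00}$, and by $H_{11}$. -/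

import Mathlib

/-! Long virtual knots are modelled as long Gauss diagrams modulo Reidemeister moves, and closed
oriented surfaces as combinatorial maps (finite cell decompositions recorded by permutations of
the oriented edges). -/

/-- One passage of a long knot diagram through a real crossing: the name of the crossing, whether
the passage is the over-passage, and the sign of the crossing. -/
structure GaussLetter where
  /-- the name of the crossing -/
  chord : ℕ
  /-- `true` at the over-passage, `false` at the under-passage -/
  isOver : Bool
  /-- the sign of the crossing -/
  sign : ℤˣ
deriving DecidableEq

namespace GaussLetter

/-- The other passage through the same crossing. -/
def mate (x : GaussLetter) : GaussLetter := ⟨x.chord, !x.isOver, x.sign⟩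

/-- Rename the crossing. -/
def relabel (f : ℕ → ℕ) (x : GaussLetter) : GaussLetter := ⟨f x.chord, x.isOver, x.sign⟩

end GaussLetter

/-- A diagram of a long virtual knot, recorded by its long (i.e. based) Gauss diagram: the
passages through real crossings in the order in which they are met when travelling from `-∞` to
`∞`. Every crossing that occurs is passed exactly once over and exactly once under, with one
sign. Virtual crossings leave no trace. -/
structure LongDiagram where
  /-- the sequence of passages -/
  word : List GaussLetter
  /-- no passage is met twice -/
  nodup : (word.map fun x => (x.chord, x.isOver)).Nodup
  /-- with each passage the other passage of the same crossing occurs, with the same sign -/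
  paired : ∀ x ∈ word, x.mate ∈ word

/-- Two consecutive passages, in the order `x, y` if `o = 1` and `y, x` if `o = -1`. -/
def orderedPair (o : ℤˣ) (x y : GaussLetter) : List GaussLetter :=
  if o = 1 then [x, y] else [y, x]

/-- Renaming of crossings and the oriented Reidemeister moves I, II, III on Gauss words.

In move III a top, a middle and a bottom strand form a triangle, with crossings `a` (top over
middle), `b` (top over bottom) and `c` (middle over bottom) of signs `εa`, `εb`, `εc`. All sign
triples occur. If `δ = ±1` says on which side of the crossing `a` the bottom strand lies, then
`a` precedes `b` on the top strand iff `δ εb = 1`, `a` precedes `c` on the middle strand iff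
`δ εc = 1`, and `b` precedes `c` on the bottom strand iff `δ εa εb εc = 1`. The move changes `δ`,
hence reverses the three pairs `X`, `Y`, `Z` of passages, which are met in an arbitrary order. -/
inductive ReidemeisterMove : List GaussLetter → List GaussLetter → Prop
  | rename (w : List GaussLetter) (f : ℕ → ℕ) (hf : Function.Injective f) :
      ReidemeisterMove w (w.map (GaussLetter.relabel f))
  | one (u v : List GaussLetter) (x : GaussLetter) :
      ReidemeisterMove (u ++ v) (u ++ [x, x.mate] ++ v)
  | two_parallel (u v w : List GaussLetter) (x y : GaussLetter)
      (hover : x.isOver = y.isOver) (hsign : x.sign = -y.sign) :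
      ReidemeisterMove (u ++ v ++ w) (u ++ [x, y] ++ v ++ [x.mate, y.mate] ++ w)
  | two_antiparallel (u v w : List GaussLetter) (x y : GaussLetter)
      (hover : x.isOver = y.isOver) (hsign : x.sign = -y.sign) :
      ReidemeisterMove (u ++ v ++ w) (u ++ [x, y] ++ v ++ [y.mate, x.mate] ++ w)
  | three (u₀ u₁ u₂ u₃ X Y Z : List GaussLetter) (a b c : ℕ) (εa εb εc δ : ℤˣ)
      (h : [X, Y, Z].Perm
        [orderedPair (δ * εb) ⟨a, true, εa⟩ ⟨b, true, εb⟩,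
         orderedPair (δ * εc) ⟨a, false, εa⟩ ⟨c, true, εc⟩,
         orderedPair (δ * (εa * εb * εc)) ⟨b, false, εb⟩ ⟨c, false, εc⟩]) :
      ReidemeisterMove (u₀ ++ X ++ u₁ ++ Y ++ u₂ ++ Z ++ u₃)
        (u₀ ++ X.reverse ++ u₁ ++ Y.reverse ++ u₂ ++ Z.reverse ++ u₃)

/-- A long virtual knot: a class of diagrams under the equivalence relation generated by renaming
and Reidemeister moves between diagrams. -/
def LongVirtualKnot : Type :=
  Quot fun D D' : LongDiagram => ReidemeisterMove D.word D'.word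

namespace LongDiagram

/-- The diagram `D` presents the long virtual knot `K`. -/
def Presents (D : LongDiagram) (K : LongVirtualKnot) : Prop :=
  Quot.mk _ D = K

/-! ### Cycles and intersection numbers

On a surface realization the two ends of the long knot meet at a basepoint, and a diagram with
`N` passages becomes a closed oriented curve. Its edges are numbered `0, …, N`: edge `k` leads to
the passage at index `k` of the word (edge `N` leads to the basepoint), and edge `k + 1` leaves
that passage (edge `0` leaves the basepoint). A 1-chain carried by the curve is the function
assigning to every edge its multiplicity; only the values at `0, …, N` matter. -/

/-- The real crossings, each represented by its over-passage. -/
def crossings (D : LongDiagram) : Finset GaussLetter :=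
  D.word.toFinset.filter fun x => x.isOver = true

/-- The index in the word of a passage. -/
def pos (D : LongDiagram) (x : GaussLetter) : ℕ := D.word.idxOf x

/-- The crossings of type `a`: type `0` if the over-passage comes first, type `1` otherwise. -/
def crossingsOfType (D : LongDiagram) (a : Fin 2) : Finset GaussLetter :=
  D.crossings.filter fun c =>
    if a = 0 then D.pos c < D.pos c.mate else D.pos c.mate < D.pos c

/-- The cycle `α` at the crossing `c`: the part of the curve between the two passages of `c`. -/
def cycleα (D : LongDiagram) (c : GaussLetter) : ℕ → ℤ := fun e =>
  if min (D.pos c) (D.pos c.mate) < e ∧ e ≤ max (D.pos c) (D.pos c.mate) then 1 else 0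

/-- The cycle `β` at the crossing `c`: the rest of the curve, which contains the basepoint. -/
def cycleβ (D : LongDiagram) (c : GaussLetter) : ℕ → ℤ := fun e => 1 - D.cycleα c e

/-- The index of the strand at the crossing `c` that, together with the other strand (in this
order), gives a positive frame of the surface: the over-strand if `c` is positive and the
under-strand if `c` is negative. -/
def rightPos (D : LongDiagram) (c : GaussLetter) : ℕ :=
  if c.sign = 1 then D.pos c else D.pos c.mate

/-- The index of the other strand at the crossing `c`. -/
def leftPos (D : LongDiagram) (c : GaussLetter) : ℕ :=
  if c.sign = 1 then D.pos c.mate else D.pos c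

/-- The algebraic intersection number `x · y`, on the oriented surface, of two cycles carried by
the curve. Push `y` off the curve to its left. Around a crossing whose strands `r`, `l` run
eastwards and northwards, the pushed `y` then meets `x` only on the western edge, positively,
as many times as `y` runs along the southern edge, and on the northern edge, negatively, as many
times as `y` runs along the eastern edge. -/
def inter (D : LongDiagram) (x y : ℕ → ℤ) : ℤ :=
  ∑ c ∈ D.crossings,
    (x (D.rightPos c) * y (D.leftPos c) - x (D.leftPos c + 1) * y (D.rightPos c + 1))

/-! ### The polynomials of a diagram -/

open LaurentPolynomial

/-- The `a`-writhe of a diagram. -/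
def ω (D : LongDiagram) (a : Fin 2) : ℤ :=
  ∑ c ∈ D.crossingsOfType a, (c.sign : ℤ)

/-- The `a`-writhe polynomial of a diagram. -/
noncomputable def W (D : LongDiagram) (a : Fin 2) : LaurentPolynomial ℤ :=
  ∑ c ∈ D.crossingsOfType a,
    (c.sign : ℤ) • (T (D.inter (D.cycleα c) (D.cycleβ c)) - 1)

/-- The intersection polynomial `F_{ab}` of a diagram. -/
noncomputable def F (D : LongDiagram) (a b : Fin 2) : LaurentPolynomial ℤ :=
  ∑ c ∈ D.crossingsOfType a, ∑ d ∈ D.crossingsOfType b,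
    ((c.sign : ℤ) * (d.sign : ℤ)) • (T (D.inter (D.cycleα c) (D.cycleα d)) - 1)

/-- The intersection polynomial `H_{ab}` of a diagram. -/
noncomputable def H (D : LongDiagram) (a b : Fin 2) : LaurentPolynomial ℤ :=
  (∑ c ∈ D.crossingsOfType a, ∑ d ∈ D.crossingsOfType b,
    ((c.sign : ℤ) * (d.sign : ℤ)) • (T (D.inter (D.cycleβ c) (D.cycleβ d)) - 1))
  - D.ω a • D.W b - D.ω b • invert (D.W a)

/-! ### The diagram as a ribbon graph -/

/-- The darts (oriented edge ends) of the closed curve: the points on it are `0` (the basepoint)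
and `k + 1` (the passage at index `k`); at each point `p` there is an outgoing dart `(p, true)`
and an incoming dart `(p, false)`. -/
abbrev Dart (D : LongDiagram) : Type := Fin (D.word.length + 1) × Bool

/-- The other end of the same edge; the edge leaving a point enters the next one, cyclically. -/
def opp (D : LongDiagram) (d : D.Dart) : D.Dart :=
  if d.2 then (d.1 + 1, false) else (d.1 - 1, true)

/-- The next dart in counterclockwise order around the same point of the surface. At a positive
crossing the counterclockwise order is over-out, under-out, over-in, under-in; at a negative one
it is over-out, under-in, over-in, under-out. -/
def next (D : LongDiagram) : D.Dart → D.Dart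
  | (⟨0, _⟩, out) => (0, !out)
  | (⟨k + 1, h⟩, out) =>
    (⟨D.word.idxOf (D.word[k]'(Nat.lt_of_succ_lt_succ h)).mate + 1,
      Nat.succ_lt_succ (List.idxOf_lt_length_of_mem (D.paired _ (List.getElem_mem _)))⟩,
      if (D.word[k]'(Nat.lt_of_succ_lt_succ h)).isOver = true ↔
        (D.word[k]'(Nat.lt_of_succ_lt_succ h)).sign = 1 then out else !out)

end LongDiagram

/-- A connected closed oriented surface with a finite cell decomposition, as a combinatorial map:
`rot` turns an oriented edge counterclockwise around its starting vertex and `opp` reverses it. -/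
structure CellularSurface where
  /-- the oriented edges -/
  Dart : Type
  finite : Finite Dart
  rot : Equiv.Perm Dart
  opp : Equiv.Perm Dart
  opp_opp : ∀ d, opp (opp d) = d
  opp_ne : ∀ d, opp d ≠ d
  connected : ∀ d e, ∃ g ∈ Subgroup.closure {rot, opp}, g d = e

namespace CellularSurface

/-- The number of vertices. -/
noncomputable def numVertices (M : CellularSurface) : ℕ :=
  Nat.card (Quotient (Equiv.Perm.SameCycle.setoid M.rot))

/-- The number of edges. -/
noncomputable def numEdges (M : CellularSurface) : ℕ :=
  Nat.card (Quotient (Equiv.Perm.SameCycle.setoid M.opp))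

/-- The number of faces. -/
noncomputable def numFaces (M : CellularSurface) : ℕ :=
  Nat.card (Quotient (Equiv.Perm.SameCycle.setoid (M.rot * M.opp)))

/-- The surface has genus `g`: its Euler characteristic is `2 - 2g`. -/
def HasGenus (M : CellularSurface) (g : ℕ) : Prop :=
  (M.numVertices : ℤ) - M.numEdges + M.numFaces = 2 - 2 * g

end CellularSurface

/-- A surface realization of the diagram `D` on `M`: the curve is drawn in the 1-skeleton of `M`
so that at every crossing, and at the basepoint, its darts lie around one vertex of `M` in the
prescribed counterclockwise order. The decomposition may have further edges, so the complement of
the curve need not consist of disks. -/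
structure SurfaceRealization (D : LongDiagram) (M : CellularSurface) where
  /-- where the darts of the curve are drawn -/
  draw : D.Dart ↪ M.Dart
  draw_opp : ∀ d, M.opp (draw d) = draw (D.opp d)
  /-- turning counterclockwise from a dart of the curve, the first dart of the curve that is met
  is the prescribed one -/
  draw_next : ∀ d, ∃ k : ℕ, 0 < k ∧ (M.rot ^ k) (draw d) = draw (D.next d) ∧
    ∀ j : ℕ, 0 < j → j < k → (M.rot ^ j) (draw d) ∉ Set.range draw

namespace LongVirtualKnot

/-- The `1`-supporting genus: the minimal genus of a surface realization of a diagram that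
presents the long virtual knot. -/
noncomputable def sg₁ (K : LongVirtualKnot) : ℕ∞ :=
  ⨅ g ∈ {g : ℕ | ∃ (D : LongDiagram) (M : CellularSurface),
    D.Presents K ∧ Nonempty (SurfaceRealization D M) ∧ M.HasGenus g}, (g : ℕ∞)

/-- `F_{ab}(K; t) = f(t)`: the polynomial `F_{ab}` of every diagram presenting `K` is `f`. -/
def HasF (K : LongVirtualKnot) (a b : Fin 2) (f : LaurentPolynomial ℤ) : Prop :=
  ∀ D : LongDiagram, D.Presents K → D.F a b = f

/-- `H_{ab}(K; t) = f(t)`: the polynomial `H_{ab}` of every diagram presenting `K` is `f`. -/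
def HasH (K : LongVirtualKnot) (a b : Fin 2) (f : LaurentPolynomial ℤ) : Prop :=
  ∀ D : LongDiagram, D.Presents K → D.H a b = f

end LongVirtualKnot

/-! Necessity. The intersection form is antisymmetric, so exchanging the two summation indices of
`F` inverts `t`. The same holds for the double sum in `H`, and the two correction terms of `H` are
exchanged by inversion. Every summand is a multiple of some `t ^ m - 1` and vanishes at `1`. To pass
from diagrams to knots, invariance of `F` and `H` under the Reidemeister moves is proved as well
(`samePolynomials_of_presents`).

Moves shift the indices of passages, so a chain is described by its value at the basepoint and its
jumps at the passages, not by its values on numbered edges. In these terms intersection numbers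
become `form`, to which every crossing contributes separately (`inter_eq_form`). A kink has a null
cycle (`form_one_eq_zero`), the two crossings of a bigon have homologous cycles and opposite signs
(`form_bigon`), and in move III the contributions of the three crossings have the same total before
and after (`three_local_eq`).

Sufficiency. A symmetric `f` with `f(1) = 0` is an integral combination of the polynomials `t ^ k +
t ^ (-k) - 2` with `k ≥ 1` (`exists_eq_linearCombination_symmT`). An explicit diagram on the torus
has a single crossing `P` of type `a`, together with pairwise disjoint crossings of the other type
whose cycles meet that of `P` in `1, …, N` points algebraically (`TorusModel.realizable_zero`).
Replacing one of these crossings, of level `k`, by three consecutive crossings of the same two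
strands adds two homologous crossings of equal sign, exactly one of which has type `a`. It also adds
two bigons, so the genus does not change (`numFaces_twist`, `Tame.twist`), and the sign can be
chosen. Hence every signed number of type `a` crossings at each level can be reached.

The family of type `a` is then a star around `P`, and `F` is the sign of `P` times the sum of the
level polynomials (`Tame.F_eq`). For `H`, complementary cycles replace the level `k` by `k - N`.
Level `N` then contributes nothing and is free to make the `a`-writhe zero, which removes the
correction terms (`Tame.H_eq`). -/

namespace GaussLetter

/-! ### Chains on a Gauss word given by their jumps, and the intersection form. -/

@[simp] theorem mate_mate (x : GaussLetter) : x.mate.mate = x := by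
  cases x; simp [mate]

theorem mate_ne (x : GaussLetter) : x.mate ≠ x := by
  cases x with | mk c o s => cases o <;> simp [mate]

@[simp] theorem mate_inj {x y : GaussLetter} : x.mate = y.mate ↔ x = y :=
  ⟨fun h => by rw [← mate_mate x, h, mate_mate], fun h => h ▸ rfl⟩

theorem mate_eq_iff {x y : GaussLetter} : x.mate = y ↔ x = y.mate := by
  rw [← mate_inj, mate_mate]

@[simp] theorem mate_isOver (x : GaussLetter) : x.mate.isOver = !x.isOver := rfl
@[simp] theorem mate_sign (x : GaussLetter) : x.mate.sign = x.sign := rfl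
@[simp] theorem mate_chord (x : GaussLetter) : x.mate.chord = x.chord := rfl

/-- The passage along the strand that comes first in the positive frame at its crossing. -/
def isRight (x : GaussLetter) : Bool := x.isOver == decide (x.sign = 1)

@[simp] theorem isRight_mate (x : GaussLetter) : x.mate.isRight = !x.isRight := by
  cases x with | mk c o s => cases o <;> by_cases h : s = 1 <;> simp [mate, isRight, h]

/-- The jumps of the cycle at the crossing of `x` that starts at the passage `x`. -/
def chi (x q : GaussLetter) : ℤ := (if q = x then 1 else 0) - (if q = x.mate then 1 else 0)

theorem chi_mate_right (x q : GaussLetter) : chi x q.mate = -chi x q := by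
  simp [chi, mate_eq_iff]

theorem chi_mate_left (x q : GaussLetter) : chi x.mate q = -chi x q := by
  simp [chi]

@[simp] theorem chi_self (x : GaussLetter) : chi x x = 1 := by
  simp [chi, (mate_ne x).symm]

@[simp] theorem chi_self_mate (x : GaussLetter) : chi x x.mate = -1 := by
  rw [chi_mate_right, chi_self]

theorem chi_of_ne {x q : GaussLetter} (h : q ≠ x) (h' : q ≠ x.mate) : chi x q = 0 := by
  simp [chi, h, h']

/-- The value of a chain with jumps `j` just before the passage `p`, relative to its value at the
basepoint. -/
def pre (j : GaussLetter → ℤ) : List GaussLetter → GaussLetter → ℤ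
  | [], _ => 0
  | q :: t, p => if q = p then 0 else j q + pre j t p

theorem pre_append_of_mem {j : GaussLetter → ℤ} {u v : List GaussLetter} {p : GaussLetter}
    (h : p ∈ u) : pre j (u ++ v) p = pre j u p := by
  induction u with
  | nil => simp at h
  | cons q t ih =>
    by_cases hq : q = p
    · simp [pre, hq]
    · have : p ∈ t := by simpa [Ne.symm hq] using h
      simp [pre, hq, ih this]

theorem pre_append_of_notMem {j : GaussLetter → ℤ} {u v : List GaussLetter} {p : GaussLetter}
    (h : p ∉ u) : pre j (u ++ v) p = (u.map j).sum + pre j v p := by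
  induction u with
  | nil => simp
  | cons q t ih =>
    simp only [List.mem_cons, not_or] at h
    simp [pre, Ne.symm h.1, ih h.2, add_assoc]

theorem pre_add (j k : GaussLetter → ℤ) (w : List GaussLetter) (p : GaussLetter) :
    pre (fun q => j q + k q) w p = pre j w p + pre k w p := by
  induction w with
  | nil => simp [pre]
  | cons q t ih => by_cases h : q = p <;> simp [pre, h, ih]; ring

theorem pre_neg (j : GaussLetter → ℤ) (w : List GaussLetter) (p : GaussLetter) :
    pre (fun q => -j q) w p = -pre j w p := by
  induction w with
  | nil => simp [pre]
  | cons q t ih => by_cases h : q = p <;> simp [pre, h, ih]; ring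

theorem pre_eq_zero {j : GaussLetter → ℤ} {w : List GaussLetter} (p : GaussLetter)
    (h : ∀ q ∈ w, j q = 0) : pre j w p = 0 := by
  induction w with
  | nil => simp [pre]
  | cons q t ih =>
    rw [pre, h q (by simp), ih fun q hq => h q (by simp [hq])]; simp

theorem pre_map {ρ : GaussLetter → GaussLetter} (hρ : Function.Injective ρ)
    (j : GaussLetter → ℤ) (w : List GaussLetter) (p : GaussLetter) :
    pre j (w.map ρ) (ρ p) = pre (fun q => j (ρ q)) w p := by
  induction w with
  | nil => simp [pre]
  | cons q t ih => by_cases h : q = p <;> simp [pre, h, ih, hρ.eq_iff]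

/-- A block whose jumps cancel is invisible from outside. This is how values at old passages survive
moves I and II. -/
theorem pre_insert {j : GaussLetter → ℤ} {u B v : List GaussLetter} {p : GaussLetter}
    (hp : p ∉ B) (hB : (B.map j).sum = 0) :
    pre j (u ++ B ++ v) p = pre j (u ++ v) p := by
  by_cases hu : p ∈ u
  · rw [List.append_assoc, pre_append_of_mem hu, pre_append_of_mem hu]
  · rw [List.append_assoc, pre_append_of_notMem hu, pre_append_of_notMem hu,
      pre_append_of_notMem hp, hB, zero_add]

/-- A chain that changes by `j q` at every passage `q`, evaluated before the passage `p`. -/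
theorem eq_pre (w : List GaussLetter) (hw : w.Nodup) (j : GaussLetter → ℤ) (x : ℕ → ℤ)
    (h : ∀ (i : ℕ) (hi : i < w.length), x (i + 1) = x i + j w[i]) {p : GaussLetter} (hp : p ∈ w) :
    x (w.idxOf p) = x 0 + pre j w p := by
  induction w generalizing x with
  | nil => simp at hp
  | cons q t ih =>
    by_cases hq : q = p
    · simp [pre, hq]
    · have hpt : p ∈ t := by simpa [Ne.symm hq] using hp
      have := ih (List.nodup_cons.1 hw).2 (fun i => x (i + 1))
        (fun i hi => h (i + 1) (by simpa using hi)) hpt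
      rw [List.idxOf_cons_ne _ hq, Nat.succ_eq_add_one, this, h 0 (by simp)]
      simp [pre, hq, add_assoc]

theorem eq_pre_succ (w : List GaussLetter) (hw : w.Nodup) (j : GaussLetter → ℤ) (x : ℕ → ℤ)
    (h : ∀ (i : ℕ) (hi : i < w.length), x (i + 1) = x i + j w[i]) {p : GaussLetter} (hp : p ∈ w) :
    x (w.idxOf p + 1) = x 0 + pre j w p + j p := by
  rw [h _ (List.idxOf_lt_length_of_mem hp), eq_pre w hw j x h hp, List.getElem_idxOf]

/-- The contribution of the crossing with right passage `r` to the intersection number of the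
chains with values `b`, `b'` at the basepoint and jumps `j`, `k`. -/
def localForm (w : List GaussLetter) (b : ℤ) (j : GaussLetter → ℤ) (b' : ℤ) (k : GaussLetter → ℤ)
    (r : GaussLetter) : ℤ :=
  (b + pre j w r) * (b' + pre k w r.mate)
    - (b + pre j w r.mate + j r.mate) * (b' + pre k w r + k r)

/-- The intersection number of the chains with values `b`, `b'` at the basepoint and jumps
`j`, `k`. -/
def form (w : List GaussLetter) (b : ℤ) (j : GaussLetter → ℤ) (b' : ℤ) (k : GaussLetter → ℤ) : ℤ :=
  ∑ r ∈ w.toFinset, if r.isRight then localForm w b j b' k r else 0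

theorem form_sub_left (w : List GaussLetter) (j j' : GaussLetter → ℤ) (b' : ℤ)
    (k : GaussLetter → ℤ) :
    form w 0 (fun q => j q - j' q) b' k = form w 0 j b' k - form w 0 j' b' k := by
  simp only [form, ← Finset.sum_sub_distrib]
  refine Finset.sum_congr rfl fun r _ => ?_
  have : ∀ p, pre (fun q => j q - j' q) w p = pre j w p - pre j' w p := fun p => by
    simp only [sub_eq_add_neg, pre_add, pre_neg]
  split_ifs
  · simp only [localForm, this]; ring
  · simp

theorem sum_right_add_mate (S : Finset GaussLetter) (hS : ∀ x ∈ S, x.mate ∈ S)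
    (f : GaussLetter → ℤ) :
    ∑ r ∈ S, (if r.isRight then f r + f r.mate else 0) = ∑ r ∈ S, f r := by
  have h1 : ∑ r ∈ S, f r = ∑ r ∈ S, ((if r.isRight then f r else 0) +
      (if r.mate.isRight then f r else 0)) :=
    Finset.sum_congr rfl fun r _ => by cases h : r.isRight <;> simp [h]
  have h2 : ∑ r ∈ S, (if r.mate.isRight then f r else 0)
      = ∑ r ∈ S, (if r.isRight then f r.mate else 0) :=
    Finset.sum_nbij' mate mate hS hS (by simp) (by simp) (by simp)
  rw [h1, Finset.sum_add_distrib, h2, ← Finset.sum_add_distrib]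
  exact Finset.sum_congr rfl fun r _ => by split_ifs <;> simp

/-- The summand is the increment of the product of the two chains across the passage `p`, so the sum
telescopes. -/
theorem sum_pre_telescope (w : List GaussLetter) (hw : w.Nodup) (j k : GaussLetter → ℤ)
    (b b' : ℤ) :
    ∑ p ∈ w.toFinset, (k p * (b + pre j w p) + j p * (b' + pre k w p) + j p * k p)
      = (b + (w.map j).sum) * (b' + (w.map k).sum) - b * b' := by
  induction w generalizing b b' with
  | nil => simp
  | cons q t ih =>
    have hq : q ∉ t := (List.nodup_cons.1 hw).1
    rw [List.toFinset_cons, Finset.sum_insert (by simpa using hq)]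
    have : ∀ p ∈ t.toFinset, (k p * (b + pre j (q :: t) p) + j p * (b' + pre k (q :: t) p)
        + j p * k p) = (k p * ((b + j q) + pre j t p) + j p * ((b' + k q) + pre k t p)
        + j p * k p) := fun p hp => by
      have : q ≠ p := fun h => hq (by simpa [h] using hp)
      simp only [pre, this, if_false]; ring
    rw [Finset.sum_congr rfl this, ih (List.nodup_cons.1 hw).2]
    simp [pre]; ring

theorem sum_map_antimate (w : List GaussLetter) (hw : w.Nodup) (hm : ∀ x ∈ w, x.mate ∈ w)
    (j : GaussLetter → ℤ) (hj : ∀ q, j q.mate = -j q) : (w.map j).sum = 0 := by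
  rw [← List.sum_toFinset _ hw,
    ← sum_right_add_mate w.toFinset (by simpa using hm) j]
  exact Finset.sum_eq_zero fun r _ => by simp [hj]

/-- At each crossing the symmetrised contribution equals the total increment of the product of the
chains at its two passages. These increments telescope around the closed curve, and both chains
return to their base values because jumps at mates cancel. -/
theorem form_antisymm (w : List GaussLetter) (hw : w.Nodup) (hm : ∀ x ∈ w, x.mate ∈ w)
    (b b' : ℤ) (j k : GaussLetter → ℤ) (hj : ∀ q, j q.mate = -j q) (hk : ∀ q, k q.mate = -k q) :
    form w b j b' k = -form w b' k b j := by
  rw [← add_eq_zero_iff_eq_neg, form, form, ← Finset.sum_add_distrib]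
  have h := sum_pre_telescope w hw j k b b'
  rw [sum_map_antimate w hw hm j hj, sum_map_antimate w hw hm k hk,
    ← sum_right_add_mate w.toFinset (by simpa using hm)] at h
  refine Eq.trans (Finset.sum_congr rfl fun r _ => ?_) (h.trans (by ring))
  split_ifs
  · simp only [localForm, hj, hk]; ring
  · simp

end GaussLetter

/-! ### Intersection numbers of a diagram in terms of first passages. -/

namespace LongDiagram
open GaussLetter

theorem word_nodup (D : LongDiagram) : D.word.Nodup := D.nodup.of_map _

theorem mate_mem_iff {D : LongDiagram} {x : GaussLetter} : x.mate ∈ D.word ↔ x ∈ D.word :=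
  ⟨fun h => by simpa using D.paired _ h, D.paired x⟩

theorem pos_inj {D : LongDiagram} {x y : GaussLetter} (hx : x ∈ D.word) :
    D.pos x = D.pos y ↔ x = y := List.idxOf_inj hx

theorem pos_ne_mate {D : LongDiagram} {x : GaussLetter} (hx : x ∈ D.word) :
    D.pos x ≠ D.pos x.mate := fun h => mate_ne x ((pos_inj hx).1 h).symm

theorem pos_getElem (D : LongDiagram) (i : ℕ) (hi : i < D.word.length) :
    D.pos D.word[i] = i := D.word_nodup.idxOf_getElem i hi

theorem cycleα_mate (D : LongDiagram) (x : GaussLetter) : D.cycleα x.mate = D.cycleα x := by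
  funext e; simp [cycleα, min_comm, max_comm]

theorem cycleα_zero (D : LongDiagram) (x : GaussLetter) : D.cycleα x 0 = 0 := by
  simp [cycleα]

theorem cycleα_step (D : LongDiagram) {t : GaussLetter}
    (hf : D.pos t < D.pos t.mate) (i : ℕ) (hi : i < D.word.length) :
    D.cycleα t (i + 1) = D.cycleα t i + chi t D.word[i] := by
  have h1 : D.word[i] = t ↔ i = D.pos t := by
    rw [← pos_inj (List.getElem_mem hi), pos_getElem]
  have h2 : D.word[i] = t.mate ↔ i = D.pos t.mate := by
    rw [← pos_inj (List.getElem_mem hi), pos_getElem]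
  simp only [cycleα, chi, h1, h2, min_eq_left hf.le, max_eq_right hf.le]
  split_ifs <;> omega

/-- The passage `t` is the first one through its crossing. -/
theorem pos_lt_iff (D : LongDiagram) {t : GaussLetter} (ht : t ∈ D.word) :
    D.pos t < D.pos t.mate ↔ pre (chi t) D.word t.mate = 1 := by
  constructor
  · intro hf
    have := eq_pre D.word D.word_nodup (chi t) (D.cycleα t) (D.cycleα_step hf) (D.paired t ht)
    rw [cycleα_zero, zero_add] at this
    rw [← this]
    change D.cycleα t (D.pos t.mate) = 1
    simp [cycleα, min_eq_left hf.le, max_eq_right hf.le, hf]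
  · intro h
    by_contra hf
    have hlt : D.pos t.mate < D.pos t := lt_of_le_of_ne (not_lt.1 hf) (pos_ne_mate ht).symm
    -- If `t.mate` came first, the cycle would have jumps `chi t.mate`, and the hypothesis would
    -- give it the value `-1`. It takes only the values `0` and `1`.
    have := eq_pre D.word D.word_nodup (chi t.mate) (D.cycleα t.mate)
      (D.cycleα_step (by simpa using hlt)) (D.paired t ht)
    rw [cycleα_zero, zero_add, show chi t.mate = fun q => -chi t q from funext (chi_mate_left t),
      pre_neg, h] at this
    change D.cycleα t.mate (D.pos t.mate) = -1 at this
    simp only [cycleα] at this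
    split_ifs at this

/-- One sum represents a crossing by its over-passage, the other by its right passage. These agree
at positive crossings and are mates at negative ones. -/
theorem inter_eq_form (D : LongDiagram) (x y : ℕ → ℤ) (j k : GaussLetter → ℤ)
    (hx : ∀ (i : ℕ) (hi : i < D.word.length), x (i + 1) = x i + j D.word[i])
    (hy : ∀ (i : ℕ) (hi : i < D.word.length), y (i + 1) = y i + k D.word[i]) :
    D.inter x y = form D.word (x 0) j (y 0) k := by
  rw [form, ← Finset.sum_filter]
  refine Finset.sum_nbij' (fun c => if c.sign = 1 then c else c.mate)
    (fun c => if c.sign = 1 then c else c.mate) ?_ ?_ ?_ ?_ ?_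
  · intro c hc
    simp only [crossings, Finset.mem_filter, List.mem_toFinset] at hc ⊢
    split_ifs with h
    · simp [hc, isRight, h]
    · simp [hc, isRight, h, D.paired]
  · intro c hc
    simp only [crossings, Finset.mem_filter, List.mem_toFinset, isRight, beq_iff_eq] at hc ⊢
    split_ifs with h
    · simp [hc.1, hc.2, h]
    · simp [hc.1, hc.2, h, D.paired]
  · intro c _
    split_ifs <;> simp_all
  · intro c _
    split_ifs <;> simp_all
  · intro c hc
    have hc' : c ∈ D.word := by
      simp only [crossings, Finset.mem_filter, List.mem_toFinset] at hc; exact hc.1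
    have e1 : ∀ p ∈ D.word, x (D.pos p) = x 0 + pre j D.word p := fun p hp =>
      eq_pre _ D.word_nodup j x hx hp
    have e2 : ∀ p ∈ D.word, x (D.pos p + 1) = x 0 + pre j D.word p + j p := fun p hp =>
      eq_pre_succ _ D.word_nodup j x hx hp
    have e3 : ∀ p ∈ D.word, y (D.pos p) = y 0 + pre k D.word p := fun p hp =>
      eq_pre _ D.word_nodup k y hy hp
    have e4 : ∀ p ∈ D.word, y (D.pos p + 1) = y 0 + pre k D.word p + k p := fun p hp =>
      eq_pre_succ _ D.word_nodup k y hy hp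
    have hm := D.paired c hc'
    simp only [localForm, rightPos, leftPos]
    split_ifs
    · rw [e1 c hc', e3 _ hm, e2 _ hm, e4 _ hc']
    · rw [e1 _ hm, e3 c hc', e2 _ hc', e4 _ hm]; simp

/-- The first passages through the crossings of type `a`. -/
def firsts (D : LongDiagram) (a : Fin 2) : Finset GaussLetter :=
  D.word.toFinset.filter fun t => (t.isOver = true ↔ a = 0) ∧ pre (chi t) D.word t.mate = 1

theorem mem_firsts {D : LongDiagram} {a : Fin 2} {t : GaussLetter} :
    t ∈ D.firsts a ↔ t ∈ D.word ∧ (t.isOver = true ↔ a = 0) ∧ D.pos t < D.pos t.mate := by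
  simp only [firsts, Finset.mem_filter, List.mem_toFinset]
  constructor
  · rintro ⟨h, h', h''⟩; exact ⟨h, h', (D.pos_lt_iff h).2 h''⟩
  · rintro ⟨h, h', h''⟩; exact ⟨h, h', (D.pos_lt_iff h).1 h''⟩

/-- The over-passage is the first one at type `0` and the second one at type `1`. With first
passages as representatives, the jumps of `α` are `chi` for both types. -/
theorem sum_crossingsOfType {M : Type*} [AddCommMonoid M] (D : LongDiagram) (a : Fin 2)
    (f : GaussLetter → M) (hf : ∀ x, f x.mate = f x) :
    ∑ c ∈ D.crossingsOfType a, f c = ∑ t ∈ D.firsts a, f t := by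
  by_cases ha : a = 0
  · refine Finset.sum_congr ?_ fun _ _ => rfl
    ext t
    simp only [mem_firsts, crossingsOfType, crossings, Finset.mem_filter, List.mem_toFinset, ha]
    tauto
  · refine Finset.sum_nbij' mate mate ?_ ?_ (by simp) (by simp) (by simp [hf])
    · intro c hc
      simp only [mem_firsts, crossingsOfType, crossings, Finset.mem_filter, List.mem_toFinset,
        ha, if_false] at hc ⊢
      simp [D.paired _ hc.1.1, hc]
    · intro c hc
      simp only [mem_firsts, crossingsOfType, crossings, Finset.mem_filter, List.mem_toFinset,
        ha, if_false] at hc ⊢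
      simpa [D.paired _ hc.1, hc.2.2] using hc.2.1

/-- `α_c · α_d`, the passages `c` and `d` being the first ones through their crossings. -/
def interα (D : LongDiagram) (c d : GaussLetter) : ℤ := form D.word 0 (chi c) 0 (chi d)

/-- The intersection number of `α_c` with the whole curve, `c` being a first passage. -/
def index (D : LongDiagram) (c : GaussLetter) : ℤ := form D.word 0 (chi c) 1 (fun _ => 0)

theorem inter_α_α (D : LongDiagram) {a b : Fin 2} {c d : GaussLetter} (hc : c ∈ D.firsts a)
    (hd : d ∈ D.firsts b) : D.inter (D.cycleα c) (D.cycleα d) = D.interα c d := by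
  rw [mem_firsts] at hc hd
  rw [D.inter_eq_form _ _ _ _ (D.cycleα_step hc.2.2) (D.cycleα_step hd.2.2)]
  simp [cycleα_zero, interα]

theorem inter_α_one (D : LongDiagram) {a : Fin 2} {c : GaussLetter} (hc : c ∈ D.firsts a) :
    D.inter (D.cycleα c) (fun _ => 1) = D.index c := by
  rw [mem_firsts] at hc
  rw [D.inter_eq_form _ (fun _ => 1) _ (fun _ => 0) (D.cycleα_step hc.2.2) (by simp)]
  simp [cycleα_zero, index]

theorem inter_one_α (D : LongDiagram) {a : Fin 2} {c : GaussLetter} (hc : c ∈ D.firsts a) :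
    D.inter (fun _ => 1) (D.cycleα c) = -D.index c := by
  rw [mem_firsts] at hc
  rw [D.inter_eq_form (fun _ => 1) _ (fun _ => 0) _ (by simp) (D.cycleα_step hc.2.2),
    form_antisymm _ D.word_nodup D.paired _ _ _ _ (by simp) (chi_mate_right c)]
  simp [cycleα_zero, index]

theorem interα_antisymm (D : LongDiagram) (c d : GaussLetter) :
    D.interα c d = -D.interα d c :=
  form_antisymm _ D.word_nodup D.paired _ _ _ _ (chi_mate_right c) (chi_mate_right d)

/-- `β` is the whole curve minus `α`, and `α · α = 0` by antisymmetry. -/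
theorem inter_α_β (D : LongDiagram) {a : Fin 2} {c : GaussLetter} (hc : c ∈ D.firsts a) :
    D.inter (D.cycleα c) (D.cycleβ c) = D.index c := by
  have h : D.inter (D.cycleα c) (D.cycleβ c) =
      D.inter (D.cycleα c) (fun _ => 1) - D.inter (D.cycleα c) (D.cycleα c) := by
    simp only [inter, cycleβ, ← Finset.sum_sub_distrib]
    exact Finset.sum_congr rfl fun _ _ => by ring
  have h0 := D.interα_antisymm c c
  rw [h, D.inter_α_one hc, D.inter_α_α hc hc]
  omega

theorem inter_β_β (D : LongDiagram) {a b : Fin 2} {c d : GaussLetter} (hc : c ∈ D.firsts a)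
    (hd : d ∈ D.firsts b) :
    D.inter (D.cycleβ c) (D.cycleβ d) = D.index d - D.index c + D.interα c d := by
  have h : D.inter (D.cycleβ c) (D.cycleβ d) = D.inter (fun _ => 1) (fun _ => 1)
      - D.inter (fun _ => 1) (D.cycleα d) - D.inter (D.cycleα c) (fun _ => 1)
      + D.inter (D.cycleα c) (D.cycleα d) := by
    simp only [inter, cycleβ, ← Finset.sum_sub_distrib, ← Finset.sum_add_distrib]
    exact Finset.sum_congr rfl fun _ _ => by ring
  have h1 : D.inter (fun _ => 1) (fun _ => 1) = 0 := by simp [inter]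
  rw [h, h1, D.inter_one_α hd, D.inter_α_one hc, D.inter_α_α hc hd]
  ring

theorem cycleβ_mate (D : LongDiagram) (x : GaussLetter) : D.cycleβ x.mate = D.cycleβ x := by
  funext e; simp [cycleβ, cycleα_mate]

end LongDiagram

/-! ### The polynomials of a finite family of signed classes -/

namespace ClassFamily
open LaurentPolynomial
variable {ι : Type*}

/-- The writhe polynomial of a family of signs `ε` and indices `n`. -/
noncomputable def polyW (S : Finset ι) (ε n : ι → ℤ) : LaurentPolynomial ℤ :=
  ∑ c ∈ S, ε c • (T (n c) - 1)

/-- The polynomial of a family of signs `ε` and intersection numbers `g`. -/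
noncomputable def polyF (S : Finset ι) (ε : ι → ℤ) (g : ι → ι → ℤ) : LaurentPolynomial ℤ :=
  ∑ c ∈ S, ∑ d ∈ S, (ε c * ε d) • (T (g c d) - 1)

/-- The corrected polynomial of the complementary classes. -/
noncomputable def polyH (S : Finset ι) (ε : ι → ℤ) (g : ι → ι → ℤ) (n : ι → ℤ) :
    LaurentPolynomial ℤ :=
  polyF S ε (fun c d => n d - n c + g c d) - (∑ c ∈ S, ε c) • polyW S ε n
    - (∑ c ∈ S, ε c) • invert (polyW S ε n)

end ClassFamily

/-! ### The diagram polynomials as polynomials of a family. -/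

namespace LongDiagram
open GaussLetter ClassFamily

theorem ω_eq (D : LongDiagram) (a : Fin 2) : D.ω a = ∑ c ∈ D.firsts a, (c.sign : ℤ) :=
  D.sum_crossingsOfType a _ (by simp)

theorem W_eq (D : LongDiagram) (a : Fin 2) :
    D.W a = polyW (D.firsts a) (fun c => (c.sign : ℤ)) D.index := by
  rw [W, D.sum_crossingsOfType a _ (by simp [cycleα_mate, cycleβ_mate]), polyW]
  exact Finset.sum_congr rfl fun c hc => by rw [D.inter_α_β hc]

theorem F_eq (D : LongDiagram) (a : Fin 2) :
    D.F a a = polyF (D.firsts a) (fun c => (c.sign : ℤ)) D.interα := by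
  rw [F, D.sum_crossingsOfType a _ (by simp [cycleα_mate]), polyF]
  refine Finset.sum_congr rfl fun c hc => ?_
  rw [D.sum_crossingsOfType a _ (by simp [cycleα_mate])]
  exact Finset.sum_congr rfl fun d hd => by rw [D.inter_α_α hc hd]

theorem H_eq (D : LongDiagram) (a : Fin 2) :
    D.H a a = polyH (D.firsts a) (fun c => (c.sign : ℤ)) D.interα D.index := by
  rw [H, polyH, ω_eq, W_eq, D.sum_crossingsOfType a _ (by simp [cycleβ_mate]), polyF]
  congr 2
  refine Finset.sum_congr rfl fun c hc => ?_
  rw [D.sum_crossingsOfType a _ (by simp [cycleβ_mate])]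
  exact Finset.sum_congr rfl fun d hd => by rw [D.inter_β_β hc hd]

end LongDiagram

/-! ### Adding a null class or a cancelling pair to a family. -/

namespace ClassFamily
open LaurentPolynomial
variable {ι κ : Type*}

theorem invert_polyW (S : Finset ι) (ε n : ι → ℤ) :
    invert (polyW S ε n) = ∑ c ∈ S, ε c • (T (-n c) - 1) := by
  simp [polyW, map_sum]

theorem polyW_congr {S : Finset ι} (ε : ι → ℤ) {n n' : ι → ℤ} (h : ∀ c ∈ S, n c = n' c) :
    polyW S ε n = polyW S ε n' :=
  Finset.sum_congr rfl fun c hc => by rw [h c hc]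

theorem polyF_congr {S : Finset ι} (ε : ι → ℤ) {g g' : ι → ι → ℤ}
    (h : ∀ c ∈ S, ∀ d ∈ S, g c d = g' c d) : polyF S ε g = polyF S ε g' :=
  Finset.sum_congr rfl fun c hc => Finset.sum_congr rfl fun d hd => by rw [h c hc d hd]

theorem polyH_congr {S : Finset ι} (ε : ι → ℤ) {g g' : ι → ι → ℤ} {n n' : ι → ℤ}
    (h : ∀ c ∈ S, ∀ d ∈ S, g c d = g' c d) (h' : ∀ c ∈ S, n c = n' c) :
    polyH S ε g n = polyH S ε g' n' := by
  rw [polyH, polyH, polyW_congr ε h',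
    polyF_congr ε fun c hc d hd => by rw [h c hc d hd, h' c hc, h' d hd]]

variable [DecidableEq ι]

theorem polyF_image {S : Finset κ} {φ : κ → ι} (hφ : Function.Injective φ)
    (ε : ι → ℤ) (g : ι → ι → ℤ) :
    polyF (S.image φ) ε g = polyF S (fun c => ε (φ c)) (fun c d => g (φ c) (φ d)) := by
  simp only [polyF, Finset.sum_image fun _ _ _ _ h => hφ h]

theorem polyH_image {S : Finset κ} {φ : κ → ι} (hφ : Function.Injective φ)
    (ε : ι → ℤ) (g : ι → ι → ℤ) (n : ι → ℤ) :
    polyH (S.image φ) ε g n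
      = polyH S (fun c => ε (φ c)) (fun c d => g (φ c) (φ d)) (fun c => n (φ c)) := by
  simp only [polyH, polyF_image hφ, polyW, Finset.sum_image fun _ _ _ _ h => hφ h]

theorem polyF_insert {S : Finset ι} {x : ι} (hx : x ∉ S) (ε : ι → ℤ) {g : ι → ι → ℤ}
    (h : ∀ c, g x c = 0) (h' : ∀ c, g c x = 0) :
    polyF (insert x S) ε g = polyF S ε g := by
  simp [polyF, Finset.sum_insert hx, h, h']

/-- The complement of a null class is the whole curve, so the double sum gains `ε x` times the
writhe polynomial and its inverse. The writhe also changes by `ε x`, and the correction terms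
subtract exactly this gain. -/
theorem polyH_insert {S : Finset ι} {x : ι} (hx : x ∉ S) (ε : ι → ℤ) {g : ι → ι → ℤ} {n : ι → ℤ}
    (h : ∀ c, g x c = 0) (h' : ∀ c, g c x = 0) (hn : n x = 0) :
    polyH (insert x S) ε g n = polyH S ε g n := by
  have h1 : ∑ d ∈ S, (ε x * ε d) • (T (n d) - 1 : LaurentPolynomial ℤ) = ε x • polyW S ε n := by
    simp only [polyW, Finset.smul_sum, mul_smul]
  have h2 : ∑ d ∈ S, (ε d * ε x) • (T (-n d) - 1 : LaurentPolynomial ℤ)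
      = ε x • invert (polyW S ε n) := by
    rw [invert_polyW]
    simp only [Finset.smul_sum]
    exact Finset.sum_congr rfl fun d _ => by rw [mul_comm, mul_smul]
  have hW : polyW (insert x S) ε n = polyW S ε n := by
    simp [polyW, Finset.sum_insert hx, hn]
  have hF : polyF (insert x S) ε (fun c d => n d - n c + g c d)
      = polyF S ε (fun c d => n d - n c + g c d)
        + ε x • polyW S ε n + ε x • invert (polyW S ε n) := by
    rw [← h1, ← h2]
    simp only [polyF, Finset.sum_insert hx, Finset.sum_add_distrib, h, h', hn, zero_sub, sub_zero,
      add_zero, neg_zero, T_zero, sub_self, smul_zero, zero_add]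
    abel
  rw [polyH, polyH, hW, hF, Finset.sum_insert hx, add_smul, add_smul]
  abel

theorem sum_insert_pair {M : Type*} [AddCommGroup M] {S : Finset ι} {x y : ι} (hxy : x ≠ y)
    (hx : x ∉ S) (hy : y ∉ S) {ε : ι → ℤ} (hε : ε y = -ε x) {φ : ι → M} (hφ : φ x = φ y) :
    ∑ c ∈ insert x (insert y S), ε c • φ c = ∑ c ∈ S, ε c • φ c := by
  rw [Finset.sum_insert (by simp [hxy, hx]), Finset.sum_insert hy, hε, hφ]
  simp

theorem polyF_insert_pair {S : Finset ι} {x y : ι} (hxy : x ≠ y) (hx : x ∉ S) (hy : y ∉ S)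
    {ε : ι → ℤ} (hε : ε y = -ε x) {g : ι → ι → ℤ} (h : ∀ c, g x c = g y c)
    (h' : ∀ c, g c x = g c y) :
    polyF (insert x (insert y S)) ε g = polyF S ε g := by
  simp only [polyF, mul_smul, ← Finset.smul_sum]
  rw [sum_insert_pair hxy hx hy hε (by simp only [h])]
  refine Finset.sum_congr rfl fun c _ => ?_
  rw [sum_insert_pair hxy hx hy hε (by rw [h'])]

/-- Equal classes with opposite signs cancel in each of the sums that make up `polyH`. -/
theorem polyH_insert_pair {S : Finset ι} {x y : ι} (hxy : x ≠ y) (hx : x ∉ S) (hy : y ∉ S)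
    {ε : ι → ℤ} (hε : ε y = -ε x) {g : ι → ι → ℤ} {n : ι → ℤ} (h : ∀ c, g x c = g y c)
    (h' : ∀ c, g c x = g c y) (hn : n x = n y) :
    polyH (insert x (insert y S)) ε g n = polyH S ε g n := by
  have hω : ∑ c ∈ insert x (insert y S), ε c = ∑ c ∈ S, ε c := by
    simpa using sum_insert_pair hxy hx hy hε (φ := fun _ => (1 : ℤ)) rfl
  have hW : polyW (insert x (insert y S)) ε n = polyW S ε n :=
    sum_insert_pair hxy hx hy hε (by rw [hn])
  rw [polyH, polyH, hω, hW, polyF_insert_pair hxy hx hy hε] <;> intro c <;> simp [h, h', hn]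

end ClassFamily

/-! ### Moves I and II on the intersection form. -/

namespace GaussLetter

theorem form_eq_list_sum {w : List GaussLetter} (hw : w.Nodup) (b : ℤ) (j : GaussLetter → ℤ)
    (b' : ℤ) (k : GaussLetter → ℤ) :
    form w b j b' k = (w.map fun r => if r.isRight then localForm w b j b' k r else 0).sum :=
  List.sum_toFinset _ hw

theorem sum_map_chi {u : List GaussLetter} {x : GaussLetter} (h : x ∉ u) (h' : x.mate ∉ u) :
    (u.map (chi x)).sum = 0 := by
  refine List.sum_eq_zero fun n hn => ?_
  obtain ⟨q, hq, rfl⟩ := List.mem_map.1 hn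
  exact chi_of_ne (fun e => h (e ▸ hq)) (fun e => h' (e ▸ hq))

/-! ### The first Reidemeister move -/

section one
variable {u v : List GaussLetter} {x : GaussLetter} (hw : (u ++ [x, x.mate] ++ v).Nodup)
  {j k : GaussLetter → ℤ}
include hw

theorem pre_one_left : pre j (u ++ [x, x.mate] ++ v) x = (u.map j).sum := by
  have : x ∉ u := fun h => by simp only [List.nodup_append] at hw; grind
  rw [List.append_assoc, pre_append_of_notMem this]; simp [pre]

theorem pre_one_right : pre j (u ++ [x, x.mate] ++ v) x.mate = (u.map j).sum + j x := by
  have : x.mate ∉ u := fun h => by simp only [List.nodup_append] at hw; grind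
  rw [List.append_assoc, pre_append_of_notMem this]; simp [pre, (mate_ne x).symm]

/-- A chain without jumps at the kink is constant on all edges around the new crossing, so the two
products in `localForm` cancel there. -/
theorem form_insert_one (hm : ∀ p ∈ u ++ v, p.mate ∈ u ++ v) (hj : ∀ q, j q.mate = -j q)
    (hk : ∀ q, k q.mate = -k q) (hjx : j x = 0) (hkx : k x = 0) (b b' : ℤ) :
    form (u ++ [x, x.mate] ++ v) b j b' k = form (u ++ v) b j b' k := by
  have hn : ∀ p ∈ u ++ v, p ∉ [x, x.mate] := fun p hp h => by
    simp only [List.nodup_append, List.mem_append] at hw hp; grind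
  have hp : ∀ (i : GaussLetter → ℤ), i x + i x.mate = 0 → ∀ p ∈ u ++ v,
      pre i (u ++ [x, x.mate] ++ v) p = pre i (u ++ v) p := fun i hi p hp =>
    pre_insert (hn p hp) (by simpa using hi)
  have hl : ∀ p ∈ u ++ v, localForm (u ++ [x, x.mate] ++ v) b j b' k p
      = localForm (u ++ v) b j b' k p := fun p h => by
    simp only [localForm, hp j (by simp [hj]) p h, hp k (by simp [hk]) p h,
      hp j (by simp [hj]) _ (hm p h), hp k (by simp [hk]) _ (hm p h)]
  have hw' : (u ++ v).Nodup := by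
    simp only [List.nodup_append, List.mem_append] at hw ⊢; grind
  rw [form_eq_list_sum hw, form_eq_list_sum hw']
  simp only [List.map_append, List.sum_append, List.map_cons, List.map_nil, List.sum_cons,
    List.sum_nil]
  have h0 : localForm (u ++ [x, x.mate] ++ v) b j b' k x = 0 := by
    simp only [localForm, pre_one_left hw, pre_one_right hw, hj, hjx, hkx]; ring
  have h1 : localForm (u ++ [x, x.mate] ++ v) b j b' k x.mate = 0 := by
    simp only [localForm, mate_mate, pre_one_left hw, pre_one_right hw, hk, hjx, hkx]; ring
  rw [h0, h1, List.map_congr_left fun p hp => by rw [hl p (by simp [hp])],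
    List.map_congr_left (l := v) fun p hp => by rw [hl p (by simp [hp])]]
  simp

/-- The cycle is the single edge of the kink, so only the kink's own crossing could contribute.
There the two products vanish or cancel, whichever passage is the right one. -/
theorem form_one_eq_zero (hk : ∀ q, k q.mate = -k q) (b' : ℤ) :
    form (u ++ [x, x.mate] ++ v) 0 (chi x) b' k = 0 := by
  have hn : ∀ p ∈ u ++ v, p ≠ x ∧ p ≠ x.mate := fun p hp => by
    simp only [List.nodup_append, List.mem_append] at hw hp; grind
  have hu : (u.map (chi x)).sum = 0 := sum_map_chi (fun h => (hn x (by simp [h])).1 rfl)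
    (fun h => (hn x.mate (by simp [h])).2 rfl)
  have hp : ∀ p, p ≠ x → p ≠ x.mate → pre (chi x) (u ++ [x, x.mate] ++ v) p = 0 :=
    fun p h h' => by
      rw [pre_insert (by simp [h, h']) (by simp)]
      exact pre_eq_zero _ fun q hq => chi_of_ne (hn q hq).1 (hn q hq).2
  refine Finset.sum_eq_zero fun r _ => ?_
  split_ifs
  · by_cases h1 : r = x
    · subst h1
      simp only [localForm, pre_one_left hw, pre_one_right hw, hu, chi_self_mate, chi_self]
      ring
    · by_cases h2 : r = x.mate
      · subst h2
        simp only [localForm, mate_mate, pre_one_left hw, pre_one_right hw, hu, chi_self, hk]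
        ring
      · have h3 : r.mate ≠ x := fun h => h2 (mate_eq_iff.1 h)
        have h4 : r.mate ≠ x.mate := fun h => h1 (mate_inj.1 h)
        rw [localForm, hp _ h1 h2, hp _ h3 h4, chi_of_ne h3 h4]; ring
  · rfl

end one

/-! ### The second Reidemeister move -/

section two
variable {u v z B : List GaussLetter} {x y : GaussLetter}
  (hw : (u ++ [x, y] ++ v ++ B ++ z).Nodup)
  (hB : B = [x.mate, y.mate] ∨ B = [y.mate, x.mate]) {j k : GaussLetter → ℤ}
include hw hB

theorem two_ne : x ≠ y ∧ x ≠ x.mate ∧ x ≠ y.mate ∧ y ≠ x.mate ∧ y ≠ y.mate ∧ x.mate ≠ y.mate := by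
  simp only [List.nodup_append, List.mem_append] at hw
  rcases hB with rfl | rfl <;> grind

theorem two_notMem : ∀ p ∈ u ++ v ++ z, p ≠ x ∧ p ≠ y ∧ p ≠ x.mate ∧ p ≠ y.mate := by
  intro p hp
  simp only [List.nodup_append, List.mem_append] at hw hp
  rcases hB with rfl | rfl <;> grind

theorem pre_two (p : GaussLetter) (h1 : p ≠ x) (h2 : p ≠ y) (h3 : p ≠ x.mate) (h4 : p ≠ y.mate)
    (hj : ∀ q, j q.mate = -j q) (hxy : j x + j y = 0) :
    pre j (u ++ [x, y] ++ v ++ B ++ z) p = pre j (u ++ v ++ z) p := by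
  rw [pre_insert (by rcases hB with rfl | rfl <;> simp [h3, h4])
      (by rcases hB with rfl | rfl <;> simp [hj] <;> omega), List.append_assoc,
    pre_insert (by simp [h1, h2]) (by simpa using hxy), ← List.append_assoc]

theorem pre_two_x : pre j (u ++ [x, y] ++ v ++ B ++ z) x = (u.map j).sum := by
  have : x ∉ u := fun h => (two_notMem hw hB x (by simp [h])).1 rfl
  simp only [List.append_assoc]
  rw [pre_append_of_notMem this]; simp [pre]

theorem pre_two_y : pre j (u ++ [x, y] ++ v ++ B ++ z) y = (u.map j).sum + j x := by
  have : y ∉ u := fun h => (two_notMem hw hB y (by simp [h])).2.1 rfl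
  simp only [List.append_assoc]
  rw [pre_append_of_notMem this]; simp [pre, (two_ne hw hB).1]

theorem notMem_two_mate : x.mate ∉ u ++ [x, y] ++ v ∧ y.mate ∉ u ++ [x, y] ++ v := by
  simp only [List.nodup_append, List.mem_append] at hw ⊢
  rcases hB with rfl | rfl <;> grind

/-- The order of the mates is repeated in each alternative, so that applications to two different
chains can be matched. -/
theorem pre_two_mate : (B = [x.mate, y.mate] ∧
      pre j (u ++ [x, y] ++ v ++ B ++ z) x.mate = ((u ++ [x, y] ++ v).map j).sum ∧
      pre j (u ++ [x, y] ++ v ++ B ++ z) y.mate = ((u ++ [x, y] ++ v).map j).sum + j x.mate) ∨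
    (B = [y.mate, x.mate] ∧
      pre j (u ++ [x, y] ++ v ++ B ++ z) x.mate = ((u ++ [x, y] ++ v).map j).sum + j y.mate ∧
      pre j (u ++ [x, y] ++ v ++ B ++ z) y.mate = ((u ++ [x, y] ++ v).map j).sum) := by
  have hne := (two_ne hw hB).2.2.2.2.2
  have hm := notMem_two_mate hw hB
  rw [List.append_assoc (u ++ [x, y] ++ v), pre_append_of_notMem hm.1, pre_append_of_notMem hm.2]
  rcases hB with rfl | rfl
  · left; simp [pre, mate_inj.not.1 hne]
  · right; simp [pre, Ne.symm (mate_inj.not.1 hne)]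

/-- Both chains are constant along each of the two strands of the bigon. The two crossings
contribute the same determinant with opposite signs, since their right passages lie on different
strands. -/
theorem form_insert_two (hr : x.isRight = !y.isRight)
    (hm : ∀ p ∈ u ++ v ++ z, p.mate ∈ u ++ v ++ z)
    (hj : ∀ q, j q.mate = -j q) (hk : ∀ q, k q.mate = -k q) (hjx : j x = 0) (hjy : j y = 0)
    (hkx : k x = 0) (hky : k y = 0) (b b' : ℤ) :
    form (u ++ [x, y] ++ v ++ B ++ z) b j b' k = form (u ++ v ++ z) b j b' k := by
  have hn := two_notMem hw hB
  have hl : ∀ p ∈ u ++ v ++ z, localForm (u ++ [x, y] ++ v ++ B ++ z) b j b' k p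
      = localForm (u ++ v ++ z) b j b' k p := fun p h => by
    obtain ⟨h1, h2, h3, h4⟩ := hn p h
    obtain ⟨h1', h2', h3', h4'⟩ := hn _ (hm p h)
    simp only [localForm]
    rw [pre_two hw hB p h1 h2 h3 h4 hj (by simp [hjx, hjy]),
      pre_two hw hB p h1 h2 h3 h4 hk (by simp [hkx, hky]),
      pre_two hw hB _ h1' h2' h3' h4' hj (by simp [hjx, hjy]),
      pre_two hw hB _ h1' h2' h3' h4' hk (by simp [hkx, hky])]
  have hw' : (u ++ v ++ z).Nodup := by
    simp only [List.nodup_append, List.mem_append] at hw ⊢; grind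
  have e1 := pre_two_x hw hB (j := j)
  have e2 := pre_two_y hw hB (j := j)
  have e3 := pre_two_x hw hB (j := k)
  have e4 := pre_two_y hw hB (j := k)
  have e5 := pre_two_mate hw hB (j := j)
  have e6 := pre_two_mate hw hB (j := k)
  simp only [hj, hk, hjx, hjy, hkx, hky, neg_zero, add_zero] at e1 e2 e3 e4 e5 e6
  replace e5 : _ ∧ _ := e5.elim (fun h => h.2) (fun h => h.2)
  replace e6 : _ ∧ _ := e6.elim (fun h => h.2) (fun h => h.2)
  have hs : ∀ f : GaussLetter → ℤ, (B.map f).sum = f x.mate + f y.mate := fun f => by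
    rcases hB with rfl | rfl <;> simp [add_comm]
  rw [form_eq_list_sum hw, form_eq_list_sum hw']
  have hL : ∀ l : List GaussLetter, (∀ p ∈ l, p ∈ u ++ v ++ z) →
      (l.map fun r => if r.isRight then
        localForm (u ++ [x, y] ++ v ++ B ++ z) b j b' k r else 0).sum
      = (l.map fun r => if r.isRight then localForm (u ++ v ++ z) b j b' k r else 0).sum :=
    fun l h => by rw [List.map_congr_left fun p hp => by rw [hl p (h p hp)]]
  generalize hf : (fun r : GaussLetter => if r.isRight then
        localForm (u ++ [x, y] ++ v ++ B ++ z) b j b' k r else 0) = f at hL ⊢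
  have hc : f x + f y + (f x.mate + f y.mate) = 0 := by
    rw [← hf]
    simp only [isRight_mate, hr, localForm, mate_mate, e1, e2, e3, e4, e5, e6, hj, hk, hjx, hjy,
      hkx, hky]
    cases y.isRight <;> simp
  simp only [List.map_append, List.sum_append, hs]
  rw [hL u (by simp +contextual), hL v (by simp +contextual), hL z (by simp +contextual)]
  simp only [List.map_cons, List.map_nil, List.sum_cons, List.sum_nil]
  linear_combination hc

/-- The two crossings of a bigon have homologous cycles. -/
theorem form_bigon (hr : x.isRight = !y.isRight) (hk : ∀ q, k q.mate = -k q) (b' : ℤ) :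
    form (u ++ [x, y] ++ v ++ B ++ z) 0 (chi x) b' k
      = form (u ++ [x, y] ++ v ++ B ++ z) 0 (chi y) b' k := by
  rw [← sub_eq_zero, ← form_sub_left]
  obtain ⟨n1, n2, n3, n4, n5, n6⟩ := two_ne hw hB
  have n7 : x.mate ≠ y := n4.symm
  have n8 : y.mate ≠ x := n3.symm
  -- These are the jumps of the boundary of the bigon: the chain is supported on the edge between
  -- `x` and `y` and the edge between their mates. The claim is that it meets no closed chain.
  set δ : GaussLetter → ℤ := fun q => chi x q - chi y q with hδ
  have hδm : ∀ q, δ q.mate = -δ q := fun q => by simp only [hδ, chi_mate_right]; ring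
  have hδx : δ x = 1 := by simp [hδ, chi_of_ne n1 n3]
  have hδy : δ y = -1 := by simp [hδ, chi_of_ne n1.symm n4]
  have hδ0 : ∀ p, p ≠ x → p ≠ y → p ≠ x.mate → p ≠ y.mate → δ p = 0 := fun p h1 h2 h3 h4 => by
    simp [hδ, chi_of_ne h1 h3, chi_of_ne h2 h4]
  have hn := two_notMem hw hB
  have hz : ∀ l : List GaussLetter, (∀ p ∈ l, p ∈ u ++ v ++ z) → (l.map δ).sum = 0 := fun l hl => by
    refine List.sum_eq_zero fun n hn' => ?_
    obtain ⟨q, hq, rfl⟩ := List.mem_map.1 hn'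
    obtain ⟨h1, h2, h3, h4⟩ := hn q (hl q hq)
    exact hδ0 q h1 h2 h3 h4
  have hp : ∀ p, p ≠ x → p ≠ y → p ≠ x.mate → p ≠ y.mate →
      pre δ (u ++ [x, y] ++ v ++ B ++ z) p = 0 := fun p h1 h2 h3 h4 => by
    rw [pre_two hw hB p h1 h2 h3 h4 hδm (by simp [hδx, hδy])]
    exact pre_eq_zero _ fun q hq => by
      obtain ⟨h1, h2, h3, h4⟩ := hn q hq
      exact hδ0 q h1 h2 h3 h4
  have hsum : ((u ++ [x, y] ++ v).map δ).sum = 0 := by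
    simp [hz u (by simp +contextual), hz v (by simp +contextual), hδx, hδy]
  have e1 := pre_two_x hw hB (j := δ)
  have e2 := pre_two_y hw hB (j := δ)
  have e3 := pre_two_x hw hB (j := k)
  have e4 := pre_two_y hw hB (j := k)
  have e5 := pre_two_mate hw hB (j := δ)
  have e6 := pre_two_mate hw hB (j := k)
  rw [hz u (by simp +contextual)] at e1 e2
  rw [hsum] at e5
  have hs : ∀ f : GaussLetter → ℤ, (B.map f).sum = f x.mate + f y.mate := fun f => by
    rcases hB with rfl | rfl <;> simp [add_comm]
  rw [form_eq_list_sum hw]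
  generalize hf : (fun r : GaussLetter => if r.isRight then
        localForm (u ++ [x, y] ++ v ++ B ++ z) 0 δ b' k r else 0) = f
  have hL : ∀ l : List GaussLetter, (∀ p ∈ l, p ∈ u ++ v ++ z) → (l.map f).sum = 0 := fun l hl => by
    refine List.sum_eq_zero fun n hn' => ?_
    obtain ⟨q, hq, rfl⟩ := List.mem_map.1 hn'
    obtain ⟨h1, h2, h3, h4⟩ := hn q (hl q hq)
    have h1' : q.mate ≠ x := fun e => h3 (mate_eq_iff.1 e)
    have h2' : q.mate ≠ y := fun e => h4 (mate_eq_iff.1 e)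
    have h3' : q.mate ≠ x.mate := fun e => h1 (mate_inj.1 e)
    have h4' : q.mate ≠ y.mate := fun e => h2 (mate_inj.1 e)
    simp only [← hf, localForm, hp q h1 h2 h3 h4, hp _ h1' h2' h3' h4', hδ0 _ h1' h2' h3' h4']
    simp
  -- Only the two corners of the bigon can contribute. For either order of the mates their
  -- contributions cancel; the mixed cases ask `B` to have both orders at once.
  have hc : f x + f y + (f x.mate + f y.mate) = 0 := by
    rw [← hf]
    rcases e5 with ⟨h5, e5, e5'⟩ | ⟨h5, e5, e5'⟩ <;>
    rcases e6 with ⟨h6, e6, e6'⟩ | ⟨h6, e6, e6'⟩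
    · simp only [isRight_mate, hr, localForm, mate_mate, e1, e2, e3, e4, e5, e6, e5', e6', hδm, hk,
        hδx, hδy]
      cases y.isRight <;> simp <;> ring
    · rw [h5] at h6; simp_all
    · rw [h5] at h6; simp_all
    · simp only [isRight_mate, hr, localForm, mate_mate, e1, e2, e3, e4, e5, e6, e5', e6', hδm, hk,
        hδx, hδy]
      cases y.isRight <;> simp <;> ring
  simp only [List.map_append, List.sum_append, hs]
  rw [hL u (by simp +contextual), hL v (by simp +contextual), hL z (by simp +contextual)]
  simp only [List.map_cons, List.map_nil, List.sum_cons, List.sum_nil]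
  linear_combination hc

end two

end GaussLetter

namespace GaussLetter

/-! ### The third Reidemeister move -/

theorem pre_congr_block {j : GaussLetter → ℤ} {A B B' C : List GaussLetter} {p : GaussLetter}
    (hB : B.Perm B') (hp : p ∉ B) : pre j (A ++ B ++ C) p = pre j (A ++ B' ++ C) p := by
  rw [List.append_assoc, List.append_assoc]
  by_cases hA : p ∈ A
  · rw [pre_append_of_mem hA, pre_append_of_mem hA]
  · rw [pre_append_of_notMem hA, pre_append_of_notMem hA, pre_append_of_notMem hp,
      pre_append_of_notMem (hB.mem_iff.not.1 hp), (hB.map j).sum_eq]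

/-- The passages `x`, `y` are adjacent in `w`, in this order if `o = 1` and in the reverse order
otherwise, and are interchanged in `w'`. -/
def SwapFacts (w w' : List GaussLetter) (o : ℤˣ) (x y : GaussLetter) : Prop :=
  ∀ j : GaussLetter → ℤ, ∃ t : ℤ, pre j w x = t + (if o = 1 then 0 else j y) ∧
    pre j w y = t + (if o = 1 then j x else 0) ∧ pre j w' x = t + (if o = 1 then j y else 0) ∧
    pre j w' y = t + (if o = 1 then 0 else j x)

theorem swapFacts_of_block {A A' C C' : List GaussLetter} (hA : A.Perm A') {o : ℤˣ}
    {x y : GaussLetter} (hw : (A ++ orderedPair o x y ++ C).Nodup) :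
    SwapFacts (A ++ orderedPair o x y ++ C) (A' ++ (orderedPair o x y).reverse ++ C') o x y := by
  intro j
  refine ⟨(A.map j).sum, ?_⟩
  have hx : x ∉ A ∧ y ∉ A ∧ x ≠ y := by
    simp only [List.nodup_append, List.mem_append, orderedPair] at hw
    split_ifs at hw <;> grind
  have hx' : x ∉ A' ∧ y ∉ A' := by rw [← hA.mem_iff, ← hA.mem_iff]; exact ⟨hx.1, hx.2.1⟩
  simp only [List.append_assoc]
  rw [pre_append_of_notMem hx.1, pre_append_of_notMem hx.2.1, pre_append_of_notMem hx'.1,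
    pre_append_of_notMem hx'.2, ← (hA.map j).sum_eq]
  rcases Int.units_eq_one_or o with rfl | rfl
  · simp [orderedPair, pre, hx.2.2, hx.2.2.symm]
  · have : (-1 : ℤˣ) ≠ 1 := by decide
    simp [orderedPair, pre, hx.2.2, hx.2.2.symm, this]

theorem orderedPair_perm (o : ℤˣ) (x y : GaussLetter) : (orderedPair o x y).Perm [x, y] := by
  unfold orderedPair
  split_ifs
  · exact List.Perm.refl _
  · exact List.Perm.swap _ _ _

section three
variable {u₀ u₁ u₂ u₃ X Y Z : List GaussLetter} {o₁ o₂ o₃ : ℤˣ}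
  {x₁ y₁ x₂ y₂ x₃ y₃ : GaussLetter}
  (h : [X, Y, Z].Perm [orderedPair o₁ x₁ y₁, orderedPair o₂ x₂ y₂, orderedPair o₃ x₃ y₃])
  (hw : (u₀ ++ X ++ u₁ ++ Y ++ u₂ ++ Z ++ u₃).Nodup)

theorem swapFacts_of_mem (hw : (u₀ ++ X ++ u₁ ++ Y ++ u₂ ++ Z ++ u₃).Nodup) {o : ℤˣ}
    {x y : GaussLetter} (hm : orderedPair o x y ∈ [X, Y, Z]) :
    SwapFacts (u₀ ++ X ++ u₁ ++ Y ++ u₂ ++ Z ++ u₃)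
      (u₀ ++ X.reverse ++ u₁ ++ Y.reverse ++ u₂ ++ Z.reverse ++ u₃) o x y := by
  have hX := X.reverse_perm.symm
  have hY := Y.reverse_perm.symm
  simp only [List.mem_cons, List.not_mem_nil, or_false] at hm
  rcases hm with rfl | rfl | rfl
  · have := swapFacts_of_block (A' := u₀) (C := u₁ ++ Y ++ u₂ ++ Z ++ u₃)
      (C' := u₁ ++ Y.reverse ++ u₂ ++ Z.reverse ++ u₃) (List.Perm.refl _)
      (o := o) (x := x) (y := y) (by simpa only [List.append_assoc] using hw)
    simpa only [List.append_assoc] using this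
  · have := swapFacts_of_block (A := u₀ ++ X ++ u₁) (A' := u₀ ++ X.reverse ++ u₁)
      (C := u₂ ++ Z ++ u₃) (C' := u₂ ++ Z.reverse ++ u₃)
      ((hX.append_left u₀).append_right u₁)
      (o := o) (x := x) (y := y) (by simpa only [List.append_assoc] using hw)
    simpa only [List.append_assoc] using this
  · have := swapFacts_of_block (A := u₀ ++ X ++ u₁ ++ Y ++ u₂)
      (A' := u₀ ++ X.reverse ++ u₁ ++ Y.reverse ++ u₂) (C := u₃) (C' := u₃)
      (((((hX.append_left u₀).append_right u₁).append hY)).append_right u₂)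
      (o := o) (x := x) (y := y) (by simpa only [List.append_assoc] using hw)
    simpa only [List.append_assoc] using this

/-- Reversing a block does not change its total jump, so values outside the three blocks are
unaffected. -/
theorem pre_three_of_notMem (j : GaussLetter → ℤ) {p : GaussLetter} (hX : p ∉ X) (hY : p ∉ Y)
    (hZ : p ∉ Z) : pre j (u₀ ++ X.reverse ++ u₁ ++ Y.reverse ++ u₂ ++ Z.reverse ++ u₃) p
      = pre j (u₀ ++ X ++ u₁ ++ Y ++ u₂ ++ Z ++ u₃) p := by
  have e1 := pre_congr_block (j := j) (A := u₀ ++ X ++ u₁ ++ Y ++ u₂) (C := u₃)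
    Z.reverse_perm.symm hZ
  have e2 := pre_congr_block (j := j) (A := u₀ ++ X ++ u₁) (C := u₂ ++ Z.reverse ++ u₃)
    Y.reverse_perm.symm hY
  have e3 := pre_congr_block (j := j) (A := u₀)
    (C := u₁ ++ Y.reverse ++ u₂ ++ Z.reverse ++ u₃) X.reverse_perm.symm hX
  simp only [List.append_assoc] at e1 e2 e3 ⊢
  rw [e1, e2, e3]

include h

theorem three_mem_iff {p : GaussLetter} : (p ∈ X ∨ p ∈ Y ∨ p ∈ Z) ↔
    p = x₁ ∨ p = y₁ ∨ p = x₂ ∨ p = y₂ ∨ p = x₃ ∨ p = y₃ := by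
  have := h.flatten.mem_iff (a := p)
  simpa [(orderedPair_perm _ _ _).mem_iff, or_assoc] using this

theorem three_nodup {β : Type*} (f : GaussLetter → β)
    (hw : ((u₀ ++ X ++ u₁ ++ Y ++ u₂ ++ Z ++ u₃).map f).Nodup) :
    ([x₁, y₁, x₂, y₂, x₃, y₃].map f).Nodup := by
  have h1 : (X ++ (Y ++ Z)).Perm [x₁, y₁, x₂, y₂, x₃, y₃] := by
    have := h.flatten
    simp only [List.flatten_cons, List.flatten_nil, List.append_nil] at this
    exact this.trans (((orderedPair_perm _ _ _).append
      ((orderedPair_perm _ _ _).append (orderedPair_perm _ _ _))))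
  have h2 : (X ++ (Y ++ Z)).Sublist (u₀ ++ X ++ u₁ ++ Y ++ u₂ ++ Z ++ u₃) := by
    simp only [List.append_assoc]
    exact ((((List.sublist_append_left Z u₃).trans (List.sublist_append_right u₂ _)).append_left
      Y).trans (List.sublist_append_right u₁ _)).append_left X |>.trans
        (List.sublist_append_right u₀ _)
  exact ((h1.map f).nodup_iff).1 (hw.sublist (h2.map f))

end three

/-- Around the triangle a chain is determined by its values on entering the three strands (the `t`
of `SwapFacts`) and its jumps at three crossings. For each of the sixteen choices of signs the claim
is a polynomial identity in these unknowns. The crossings exchange contributions, so only their sum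
is invariant. -/
theorem three_local_eq {w w' : List GaussLetter} {a b c : ℕ} {εa εb εc δ : ℤˣ}
    (h1 : SwapFacts w w' (δ * εb) ⟨a, true, εa⟩ ⟨b, true, εb⟩)
    (h2 : SwapFacts w w' (δ * εc) ⟨a, false, εa⟩ ⟨c, true, εc⟩)
    (h3 : SwapFacts w w' (δ * (εa * εb * εc)) ⟨b, false, εb⟩ ⟨c, false, εc⟩)
    {j k : GaussLetter → ℤ} (hj : ∀ q, j q.mate = -j q) (hk : ∀ q, k q.mate = -k q) (β β' : ℤ)
    (f f' : GaussLetter → ℤ)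
    (hf : f = fun r => if r.isRight then localForm w β j β' k r else 0)
    (hf' : f' = fun r => if r.isRight then localForm w' β j β' k r else 0) :
    f ⟨a, true, εa⟩ + f ⟨a, false, εa⟩ + f ⟨b, true, εb⟩ + f ⟨b, false, εb⟩
        + f ⟨c, true, εc⟩ + f ⟨c, false, εc⟩
      = f' ⟨a, true, εa⟩ + f' ⟨a, false, εa⟩ + f' ⟨b, true, εb⟩ + f' ⟨b, false, εb⟩
        + f' ⟨c, true, εc⟩ + f' ⟨c, false, εc⟩ := by
  subst hf hf'
  obtain ⟨t1, p1, p2, p3, p4⟩ := h1 j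
  obtain ⟨t2, p5, p6, p7, p8⟩ := h2 j
  obtain ⟨t3, p9, p10, p11, p12⟩ := h3 j
  obtain ⟨s1, q1, q2, q3, q4⟩ := h1 k
  obtain ⟨s2, q5, q6, q7, q8⟩ := h2 k
  obtain ⟨s3, q9, q10, q11, q12⟩ := h3 k
  have ja : j ⟨a, false, εa⟩ = -j ⟨a, true, εa⟩ := hj ⟨a, true, εa⟩
  have jb : j ⟨b, false, εb⟩ = -j ⟨b, true, εb⟩ := hj ⟨b, true, εb⟩
  have jc : j ⟨c, false, εc⟩ = -j ⟨c, true, εc⟩ := hj ⟨c, true, εc⟩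
  have ka : k ⟨a, false, εa⟩ = -k ⟨a, true, εa⟩ := hk ⟨a, true, εa⟩
  have kb : k ⟨b, false, εb⟩ = -k ⟨b, true, εb⟩ := hk ⟨b, true, εb⟩
  have kc : k ⟨c, false, εc⟩ = -k ⟨c, true, εc⟩ := hk ⟨c, true, εc⟩
  simp only [localForm, mate, isRight, Bool.not_true, Bool.not_false, p1, p2, p3, p4, p5, p6, p7,
    p8, p9, p10, p11, p12, q1, q2, q3, q4, q5, q6, q7, q8, q9, q10, q11, q12, ja, jb, jc, ka, kb,
    kc]
  clear p1 p2 p3 p4 p5 p6 p7 p8 p9 p10 p11 p12 q1 q2 q3 q4 q5 q6 q7 q8 q9 q10 q11 q12 h1 h2 h3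
  generalize j ⟨a, true, εa⟩ = ja
  generalize j ⟨b, true, εb⟩ = jb
  generalize j ⟨c, true, εc⟩ = jc
  generalize k ⟨a, true, εa⟩ = ka
  generalize k ⟨b, true, εb⟩ = kb
  generalize k ⟨c, true, εc⟩ = kc
  have hn : ((-1 : ℤˣ) = 1) = False := by decide
  rcases Int.units_eq_one_or εa with rfl | rfl <;> rcases Int.units_eq_one_or εb with rfl | rfl <;>
  rcases Int.units_eq_one_or εc with rfl | rfl <;> rcases Int.units_eq_one_or δ with rfl | rfl <;>
  (simp [hn]; try ring)

end GaussLetter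

/-! ### Move III on diagrams. -/

namespace LongDiagram
open GaussLetter ClassFamily

theorem form_three {D D' : LongDiagram} {u₀ u₁ u₂ u₃ X Y Z : List GaussLetter} {a b c : ℕ}
    {εa εb εc δ : ℤˣ} (h : [X, Y, Z].Perm
        [orderedPair (δ * εb) ⟨a, true, εa⟩ ⟨b, true, εb⟩,
         orderedPair (δ * εc) ⟨a, false, εa⟩ ⟨c, true, εc⟩,
         orderedPair (δ * (εa * εb * εc)) ⟨b, false, εb⟩ ⟨c, false, εc⟩])
    (hD : D.word = u₀ ++ X ++ u₁ ++ Y ++ u₂ ++ Z ++ u₃)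
    (hD' : D'.word = u₀ ++ X.reverse ++ u₁ ++ Y.reverse ++ u₂ ++ Z.reverse ++ u₃)
    {j k : GaussLetter → ℤ} (hj : ∀ q, j q.mate = -j q) (hk : ∀ q, k q.mate = -k q) (β β' : ℤ) :
    form D.word β j β' k = form D'.word β j β' k := by
  have hnd := D.nodup
  have hnd' := D.word_nodup
  have hset : D'.word.toFinset = D.word.toFinset := by
    ext p; simp [hD, hD']
  have hdist := three_nodup h _ (hD ▸ hnd)
  have f1 := swapFacts_of_mem (hD ▸ hnd') (h.mem_iff.2 (by simp) :
    orderedPair (δ * εb) ⟨a, true, εa⟩ ⟨b, true, εb⟩ ∈ [X, Y, Z])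
  have f2 := swapFacts_of_mem (hD ▸ hnd') (h.mem_iff.2 (by simp) :
    orderedPair (δ * εc) ⟨a, false, εa⟩ ⟨c, true, εc⟩ ∈ [X, Y, Z])
  have f3 := swapFacts_of_mem (hD ▸ hnd') (h.mem_iff.2 (by simp) :
    orderedPair (δ * (εa * εb * εc)) ⟨b, false, εb⟩ ⟨c, false, εc⟩ ∈ [X, Y, Z])
  rw [← hD, ← hD'] at f1 f2 f3
  have hmem := fun p => three_mem_iff (p := p) h
  have hpre : ∀ (i : GaussLetter → ℤ) p, ¬(p ∈ X ∨ p ∈ Y ∨ p ∈ Z) →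
      pre i D'.word p = pre i D.word p := fun i p hp => by
    rw [hD, hD']
    exact pre_three_of_notMem i (fun h => hp (Or.inl h)) (fun h => hp (Or.inr (Or.inl h)))
      (fun h => hp (Or.inr (Or.inr h)))
  have hin : ∀ p, (p ∈ X ∨ p ∈ Y ∨ p ∈ Z) → p ∈ D.word := fun p hp => by
    rw [hD]; simp only [List.mem_append]; tauto
  have key := three_local_eq f1 f2 f3 hj hk β β' _ _ rfl rfl
  set f : GaussLetter → ℤ := fun r => if r.isRight then localForm D.word β j β' k r else 0 with hf
  set f' : GaussLetter → ℤ := fun r => if r.isRight then localForm D'.word β j β' k r else 0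
    with hf'
  have hS : ({⟨a, true, εa⟩, ⟨a, false, εa⟩, ⟨b, true, εb⟩, ⟨b, false, εb⟩, ⟨c, true, εc⟩,
      ⟨c, false, εc⟩} : Finset GaussLetter) ⊆ D.word.toFinset := by
    intro p hp
    rw [List.mem_toFinset]
    apply hin
    rw [hmem]
    simp only [Finset.mem_insert, Finset.mem_singleton] at hp
    tauto
  have hsum : ∀ g : GaussLetter → ℤ, ∑ p ∈ ({⟨a, true, εa⟩, ⟨a, false, εa⟩, ⟨b, true, εb⟩,
      ⟨b, false, εb⟩, ⟨c, true, εc⟩, ⟨c, false, εc⟩} : Finset GaussLetter), g p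
      = g ⟨a, true, εa⟩ + g ⟨a, false, εa⟩ + g ⟨b, true, εb⟩ + g ⟨b, false, εb⟩
        + g ⟨c, true, εc⟩ + g ⟨c, false, εc⟩ := fun g => by
    simp only [List.map_cons, List.map_nil, List.nodup_cons, List.mem_cons, Prod.mk.injEq,
      and_true, List.not_mem_nil, or_false] at hdist
    have d1 : a ≠ b := by tauto
    have d2 : a ≠ c := by tauto
    have d3 : b ≠ c := by tauto
    rw [Finset.sum_insert, Finset.sum_insert, Finset.sum_insert, Finset.sum_insert,
      Finset.sum_insert, Finset.sum_singleton]
    · ring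
    all_goals simp [d1, d2, d3]
  change ∑ r ∈ D.word.toFinset, f r = ∑ r ∈ D'.word.toFinset, f' r
  rw [hset, ← Finset.sum_sdiff hS, ← Finset.sum_sdiff (f := f') hS, hsum, hsum, key]
  congr 1
  refine Finset.sum_congr rfl fun r hr => ?_
  simp only [Finset.mem_sdiff, Finset.mem_insert, Finset.mem_singleton] at hr
  have hr1 : ¬(r ∈ X ∨ r ∈ Y ∨ r ∈ Z) := by rw [hmem]; tauto
  have hr2 : ¬(r.mate ∈ X ∨ r.mate ∈ Y ∨ r.mate ∈ Z) := by
    rw [hmem]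
    rintro (h | h | h | h | h | h) <;> exact hr.2 (by simp [mate_eq_iff.1 h, mate])
  simp only [hf, hf', localForm, hpre _ _ hr1, hpre _ _ hr2]

/-- Each reversed pair consists of passages through two different crossings, so the order of the two
passages through any one crossing does not change. -/
theorem firsts_three {D D' : LongDiagram} {u₀ u₁ u₂ u₃ X Y Z : List GaussLetter} {a b c : ℕ}
    {εa εb εc δ : ℤˣ} (h : [X, Y, Z].Perm
        [orderedPair (δ * εb) ⟨a, true, εa⟩ ⟨b, true, εb⟩,
         orderedPair (δ * εc) ⟨a, false, εa⟩ ⟨c, true, εc⟩,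
         orderedPair (δ * (εa * εb * εc)) ⟨b, false, εb⟩ ⟨c, false, εc⟩])
    (hD : D.word = u₀ ++ X ++ u₁ ++ Y ++ u₂ ++ Z ++ u₃)
    (hD' : D'.word = u₀ ++ X.reverse ++ u₁ ++ Y.reverse ++ u₂ ++ Z.reverse ++ u₃) (e : Fin 2) :
    D'.firsts e = D.firsts e := by
  have hnd' := D.word_nodup
  have hset : D'.word.toFinset = D.word.toFinset := by
    ext p; simp [hD, hD']
  have hdist := three_nodup h _ (hD ▸ D.nodup)
  have f1 := swapFacts_of_mem (hD ▸ hnd') (h.mem_iff.2 (by simp) :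
    orderedPair (δ * εb) ⟨a, true, εa⟩ ⟨b, true, εb⟩ ∈ [X, Y, Z])
  have f2 := swapFacts_of_mem (hD ▸ hnd') (h.mem_iff.2 (by simp) :
    orderedPair (δ * εc) ⟨a, false, εa⟩ ⟨c, true, εc⟩ ∈ [X, Y, Z])
  have f3 := swapFacts_of_mem (hD ▸ hnd') (h.mem_iff.2 (by simp) :
    orderedPair (δ * (εa * εb * εc)) ⟨b, false, εb⟩ ⟨c, false, εc⟩ ∈ [X, Y, Z])
  rw [← hD, ← hD'] at f1 f2 f3
  have hmem := fun p => three_mem_iff (p := p) h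
  simp only [List.map_cons, List.map_nil, List.nodup_cons, List.mem_cons, Prod.mk.injEq,
    and_true, List.not_mem_nil, or_false] at hdist
  have d1 : a ≠ b := by tauto
  have d2 : a ≠ c := by tauto
  have d3 : b ≠ c := by tauto
  unfold firsts
  rw [hset]
  refine Finset.filter_congr fun t _ => ?_
  have : pre (chi t) D'.word t.mate = pre (chi t) D.word t.mate := by
    by_cases hp : t.mate ∈ X ∨ t.mate ∈ Y ∨ t.mate ∈ Z
    · rw [hmem] at hp
      obtain ⟨t1, p1, p2, p3, p4⟩ := f1 (chi t)
      obtain ⟨t2, p5, p6, p7, p8⟩ := f2 (chi t)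
      obtain ⟨t3, p9, p10, p11, p12⟩ := f3 (chi t)
      simp only [mate_eq_iff] at hp
      rcases hp with rfl | rfl | rfl | rfl | rfl | rfl <;>
      simp only [mate_mate, p1, p2, p3, p4, p5, p6, p7, p8, p9, p10, p11, p12] <;>
      simp [chi, mate, d1, d2, d3, d1.symm, d2.symm, d3.symm]
    · rw [hD, hD']
      exact pre_three_of_notMem _ (fun h => hp (Or.inl h)) (fun h => hp (Or.inr (Or.inl h)))
        (fun h => hp (Or.inr (Or.inr h)))
  rw [this]

/-! ### Invariance under the moves -/

theorem firsts_one {D D' : LongDiagram} {u v : List GaussLetter} {x : GaussLetter}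
    (hD : D.word = u ++ v) (hD' : D'.word = u ++ [x, x.mate] ++ v) (e : Fin 2) :
    D'.firsts e = if x.isOver = true ↔ e = 0 then insert x (D.firsts e) else D.firsts e := by
  have hw := hD' ▸ D'.word_nodup
  have hn : ∀ p ∈ u ++ v, p ≠ x ∧ p ≠ x.mate := fun p hp => by
    simp only [List.nodup_append, List.mem_append] at hw hp; grind
  have hu : (u.map (chi x)).sum = 0 := sum_map_chi (fun h => (hn x (by simp [h])).1 rfl)
    (fun h => (hn x.mate (by simp [h])).2 rfl)
  have hx : pre (chi x) D'.word x.mate = 1 := by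
    rw [hD', pre_one_right hw, hu, chi_self]; rfl
  have hx' : pre (chi x.mate) D'.word x.mate.mate ≠ 1 := by
    rw [mate_mate, show chi x.mate = fun q => -chi x q from funext (chi_mate_left x), pre_neg,
      hD', pre_one_left hw, hu]; simp
  have hp : ∀ t ∈ D.word, pre (chi t) D'.word t.mate = pre (chi t) D.word t.mate := fun t ht => by
    rw [hD, hD']
    have := hn t.mate (hD ▸ D.paired t ht)
    exact pre_insert (by simpa using this) (by simp [chi_mate_right])
  have hmem : ∀ t, t ∈ D'.word ↔ t = x ∨ t = x.mate ∨ t ∈ D.word := fun t => by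
    rw [hD, hD']; simp only [List.mem_append, List.mem_cons, List.not_mem_nil]; tauto
  ext t
  have : t ∈ D'.firsts e ↔ (t = x ∧ (x.isOver = true ↔ e = 0)) ∨ t ∈ D.firsts e := by
    simp only [firsts, Finset.mem_filter, List.mem_toFinset, hmem]
    constructor
    · rintro ⟨rfl | rfl | h, h1, h2⟩
      · exact Or.inl ⟨rfl, h1⟩
      · exact absurd h2 hx'
      · exact Or.inr ⟨h, h1, hp t h ▸ h2⟩
    · rintro (⟨rfl, h⟩ | ⟨h, h1, h2⟩)
      · exact ⟨Or.inl rfl, h, hx⟩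
      · exact ⟨Or.inr (Or.inr h), h1, (hp t h).trans h2⟩
  rw [this]
  split_ifs with h <;> simp [h]

/-- Nothing is assumed about signs or over-passages, so the statement also covers the bigons created
by twisting a crossing. -/
theorem firsts_two {D D' : LongDiagram} {u v z B : List GaussLetter} {x y : GaussLetter}
    (hD : D.word = u ++ v ++ z) (hD' : D'.word = u ++ [x, y] ++ v ++ B ++ z)
    (hB : B = [x.mate, y.mate] ∨ B = [y.mate, x.mate]) (e : Fin 2) (t : GaussLetter) :
    t ∈ D'.firsts e ↔
      (t = x ∧ (x.isOver = true ↔ e = 0)) ∨ (t = y ∧ (y.isOver = true ↔ e = 0)) ∨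
        t ∈ D.firsts e := by
  have hw := hD' ▸ D'.word_nodup
  obtain ⟨n1, n2, n3, n4, n5, n6⟩ := two_ne hw hB
  have hn := two_notMem hw hB
  have hmem : ∀ t, t ∈ D'.word ↔ t = x ∨ t = y ∨ t = x.mate ∨ t = y.mate ∨ t ∈ D.word :=
    fun t => by
      rw [hD, hD']
      rcases hB with rfl | rfl <;>
      simp only [List.mem_append, List.mem_cons, List.not_mem_nil] <;> tauto
  have hm : ∀ t ∈ D'.word, (pre (chi t) D'.word t.mate = 1 ↔
      t = x ∨ t = y ∨ (t ∈ D.word ∧ pre (chi t) D.word t.mate = 1)) := fun t ht => by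
    have s0 : ∀ t, t = x ∨ t = y → ∀ l : List GaussLetter, (∀ p ∈ l, p ∈ u ++ v ++ z) →
        (l.map (chi t)).sum = 0 := fun t ht l hl => sum_map_chi
          (fun h => by have := hn t (hl _ h); grind) (fun h => by have := hn _ (hl _ h); grind)
    have sxu := s0 x (Or.inl rfl) u (by simp +contextual)
    have sxv := s0 x (Or.inl rfl) v (by simp +contextual)
    have syu := s0 y (Or.inr rfl) u (by simp +contextual)
    have syv := s0 y (Or.inr rfl) v (by simp +contextual)
    have cxy : chi x y = 0 := chi_of_ne n1.symm n4
    have cyx : chi y x = 0 := chi_of_ne n1 n3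
    rw [hmem] at ht
    rcases ht with rfl | rfl | rfl | rfl | ht
    · have := pre_two_mate hw hB (j := chi t)
      simp only [List.map_append, List.sum_append, sxu, sxv, List.map_cons, List.map_nil,
        List.sum_cons, List.sum_nil, cxy, chi_mate_right, chi_self] at this
      rw [← hD'] at this
      rcases this with ⟨_, h, -⟩ | ⟨_, h, -⟩ <;> simp [h]
    · have := pre_two_mate hw hB (j := chi t)
      simp only [List.map_append, List.sum_append, syu, syv, List.map_cons, List.map_nil,
        List.sum_cons, List.sum_nil, cyx, chi_mate_right, chi_self] at this
      rw [← hD'] at this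
      rcases this with ⟨_, -, h⟩ | ⟨_, -, h⟩ <;> simp [h]
    · rw [mate_mate, show chi x.mate = fun q => -chi x q from funext (chi_mate_left x), pre_neg,
        hD', pre_two_x hw hB, sxu]
      have : x.mate ∉ D.word := fun h => (hn _ (hD ▸ h)).2.2.1 rfl
      simp [this, n2.symm, n4.symm]
    · rw [mate_mate, show chi y.mate = fun q => -chi y q from funext (chi_mate_left y), pre_neg,
        hD', pre_two_y hw hB, syu, cyx]
      have : y.mate ∉ D.word := fun h => (hn _ (hD ▸ h)).2.2.2 rfl
      simp [this, n3.symm, n5.symm]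
    · obtain ⟨h1, h2, h3, h4⟩ := hn t (hD ▸ ht)
      obtain ⟨h1', h2', h3', h4'⟩ := hn t.mate (hD ▸ D.paired t ht)
      rw [hD', pre_two hw hB _ h1' h2' h3' h4' (chi_mate_right t)
        (by rw [chi_of_ne (Ne.symm h1) (fun e => h3 (by rw [e, mate_mate])),
          chi_of_ne (Ne.symm h2) (fun e => h4 (by rw [e, mate_mate]))]; rfl), ← hD]
      simp [ht, h1, h2]
  simp only [firsts, Finset.mem_filter, List.mem_toFinset]
  constructor
  · rintro ⟨h, h1, h2⟩
    rcases (hm t h).1 h2 with rfl | rfl | h3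
    · exact Or.inl ⟨rfl, h1⟩
    · exact Or.inr (Or.inl ⟨rfl, h1⟩)
    · exact Or.inr (Or.inr ⟨h3.1, h1, h3.2⟩)
  · rintro (⟨rfl, h⟩ | ⟨rfl, h⟩ | ⟨h, h1, h2⟩)
    · have := (hmem t).2 (Or.inl rfl)
      exact ⟨this, h, (hm t this).2 (Or.inl rfl)⟩
    · have := (hmem t).2 (Or.inr (Or.inl rfl))
      exact ⟨this, h, (hm t this).2 (Or.inr (Or.inl rfl))⟩
    · have := (hmem t).2 (Or.inr (Or.inr (Or.inr (Or.inr h))))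
      exact ⟨this, h1, (hm t this).2 (Or.inr (Or.inr ⟨h, h2⟩))⟩

/-- Two diagrams have the same intersection polynomials. -/
def SamePolynomials (D D' : LongDiagram) : Prop :=
  ∀ e, D.F e e = D'.F e e ∧ D.H e e = D'.H e e

theorem chi_eq_zero_of_mem {D : LongDiagram} {c q : GaussLetter} (hc : c ∈ D.word)
    (hq : q ∉ D.word) : chi c q = 0 :=
  chi_of_ne (fun e => hq (e ▸ hc)) (fun e => hq (e ▸ D.paired c hc))

theorem mem_word_of_mem_firsts {D : LongDiagram} {e : Fin 2} {c : GaussLetter}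
    (hc : c ∈ D.firsts e) : c ∈ D.word := (mem_firsts.1 hc).1

theorem samePolynomials_one {D D' : LongDiagram} {u v : List GaussLetter} {x : GaussLetter}
    (hD : D.word = u ++ v) (hD' : D'.word = u ++ [x, x.mate] ++ v) : SamePolynomials D D' := by
  intro e
  have hw := hD' ▸ D'.word_nodup
  have hx : x ∉ D.word := fun h => by
    rw [hD] at h; simp only [List.nodup_append, List.mem_append] at hw h; grind
  have hm : ∀ p ∈ u ++ v, p.mate ∈ u ++ v := hD ▸ D.paired
  have hg : ∀ c ∈ D.firsts e, ∀ d ∈ D.firsts e, D.interα c d = D'.interα c d := fun c hc d hd => by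
    rw [interα, interα, hD, hD', form_insert_one hw hm (chi_mate_right c) (chi_mate_right d)
      (chi_eq_zero_of_mem (mem_word_of_mem_firsts hc) hx)
      (chi_eq_zero_of_mem (mem_word_of_mem_firsts hd) hx)]
  have hn : ∀ c ∈ D.firsts e, D.index c = D'.index c := fun c hc => by
    rw [index, index, hD, hD', form_insert_one hw hm (chi_mate_right c) (by simp)
      (chi_eq_zero_of_mem (mem_word_of_mem_firsts hc) hx) rfl]
  have h0 : ∀ d, D'.interα x d = 0 := fun d => by
    rw [interα, hD', form_one_eq_zero hw (chi_mate_right d)]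
  have h0' : ∀ d, D'.interα d x = 0 := fun d => by rw [interα_antisymm, h0, neg_zero]
  have h0n : D'.index x = 0 := by rw [index, hD', form_one_eq_zero hw (by simp)]
  have hxf : x ∉ D.firsts e := fun h => hx (mem_word_of_mem_firsts h)
  rw [F_eq, F_eq, H_eq, H_eq, polyF_congr _ hg, polyH_congr _ hg hn, firsts_one hD hD' e]
  split_ifs
  · rw [polyF_insert hxf _ h0 h0', polyH_insert hxf _ h0 h0' h0n]
    exact ⟨rfl, rfl⟩
  · exact ⟨rfl, rfl⟩

theorem samePolynomials_two {D D' : LongDiagram} {u v z B : List GaussLetter} {x y : GaussLetter}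
    (hD : D.word = u ++ v ++ z) (hD' : D'.word = u ++ [x, y] ++ v ++ B ++ z)
    (hB : B = [x.mate, y.mate] ∨ B = [y.mate, x.mate]) (hover : x.isOver = y.isOver)
    (hsign : x.sign = -y.sign) : SamePolynomials D D' := by
  intro e
  have hw := hD' ▸ D'.word_nodup
  have hr : x.isRight = !y.isRight := by
    have hn : ((-1 : ℤˣ) = 1) = False := by decide
    unfold isRight
    rw [hover, hsign]
    rcases Int.units_eq_one_or y.sign with h | h <;> cases y.isOver <;> simp [h, hn]
  have hnm := two_notMem hw hB
  have hx : x ∉ D.word := fun h => (hnm x (hD ▸ h)).1 rfl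
  have hy : y ∉ D.word := fun h => (hnm y (hD ▸ h)).2.1 rfl
  have hm : ∀ p ∈ u ++ v ++ z, p.mate ∈ u ++ v ++ z := hD ▸ D.paired
  have hg : ∀ c ∈ D.firsts e, ∀ d ∈ D.firsts e, D.interα c d = D'.interα c d := fun c hc d hd => by
    rw [interα, interα, hD, hD', form_insert_two hw hB hr hm (chi_mate_right c) (chi_mate_right d)
      (chi_eq_zero_of_mem (mem_word_of_mem_firsts hc) hx)
      (chi_eq_zero_of_mem (mem_word_of_mem_firsts hc) hy)
      (chi_eq_zero_of_mem (mem_word_of_mem_firsts hd) hx)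
      (chi_eq_zero_of_mem (mem_word_of_mem_firsts hd) hy)]
  have hn : ∀ c ∈ D.firsts e, D.index c = D'.index c := fun c hc => by
    rw [index, index, hD, hD', form_insert_two hw hB hr hm (chi_mate_right c) (by simp)
      (chi_eq_zero_of_mem (mem_word_of_mem_firsts hc) hx)
      (chi_eq_zero_of_mem (mem_word_of_mem_firsts hc) hy) rfl rfl]
  have h0 : ∀ d, D'.interα x d = D'.interα y d := fun d => by
    rw [interα, interα, hD', form_bigon hw hB hr (chi_mate_right d)]
  have h0' : ∀ d, D'.interα d x = D'.interα d y := fun d => by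
    rw [interα_antisymm, h0, ← interα_antisymm]
  have h0n : D'.index x = D'.index y := by
    rw [index, index, hD', form_bigon hw hB hr (by simp)]
  have hxf : x ∉ D.firsts e := fun h => hx (mem_word_of_mem_firsts h)
  have hyf : y ∉ D.firsts e := fun h => hy (mem_word_of_mem_firsts h)
  have hxy := (two_ne hw hB).1
  have hε : (y.sign : ℤ) = -(x.sign : ℤ) := by rw [hsign]; simp
  have hf := firsts_two hD hD' hB e
  rw [F_eq, F_eq, H_eq, H_eq, polyF_congr _ hg, polyH_congr _ hg hn]
  by_cases hc : x.isOver = true ↔ e = 0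
  · have : D'.firsts e = insert x (insert y (D.firsts e)) := by
      ext t; rw [hf]; simp only [← hover, hc, Finset.mem_insert]; tauto
    rw [this, polyF_insert_pair hxy hxf hyf hε h0 h0', polyH_insert_pair hxy hxf hyf hε h0 h0' h0n]
    exact ⟨rfl, rfl⟩
  · have : D'.firsts e = D.firsts e := by
      ext t; rw [hf]; simp only [← hover, hc]; tauto
    rw [this]
    exact ⟨rfl, rfl⟩

theorem form_map {ρ : GaussLetter → GaussLetter} (hρ : Function.Injective ρ)
    (hm : ∀ x, (ρ x).mate = ρ x.mate) (hr : ∀ x, (ρ x).isRight = x.isRight)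
    (w : List GaussLetter) (hw : w.Nodup) (b b' : ℤ) (j k : GaussLetter → ℤ) :
    form (w.map ρ) b j b' k = form w b (fun q => j (ρ q)) b' (fun q => k (ρ q)) := by
  rw [form_eq_list_sum (hw.map hρ), form_eq_list_sum hw, List.map_map]
  congr 1
  refine List.map_congr_left fun r _ => ?_
  simp only [Function.comp, hr, localForm, hm, pre_map hρ]

theorem samePolynomials_rename {D D' : LongDiagram} {f : ℕ → ℕ} (hf : Function.Injective f)
    (hD' : D'.word = D.word.map (relabel f)) : SamePolynomials D D' := by
  intro e
  have hρ : Function.Injective (relabel f) := fun x y h => by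
    cases x; cases y; simpa [relabel, hf.eq_iff] using h
  have hm : ∀ x, (relabel f x).mate = relabel f x.mate := fun _ => rfl
  have hr : ∀ x, (relabel f x).isRight = x.isRight := fun _ => rfl
  have hχ : ∀ x q, chi (relabel f x) (relabel f q) = chi x q := fun x q => by
    simp only [chi, hm, hρ.eq_iff]
  have hg : ∀ c d, D'.interα (relabel f c) (relabel f d) = D.interα c d := fun c d => by
    simp only [interα, hD', form_map hρ hm hr _ D.word_nodup, hχ]
  have hn : ∀ c, D'.index (relabel f c) = D.index c := fun c => by
    simp only [index, hD', form_map hρ hm hr _ D.word_nodup, hχ]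
  have hfirst : D'.firsts e = (D.firsts e).image (relabel f) := by
    ext t
    simp only [firsts, hD', Finset.mem_filter, List.mem_toFinset, List.mem_map, Finset.mem_image]
    constructor
    · rintro ⟨⟨q, hq, rfl⟩, h1, h2⟩
      rw [hm, pre_map hρ] at h2
      simp only [hχ] at h2
      exact ⟨q, ⟨hq, h1, h2⟩, rfl⟩
    · rintro ⟨q, ⟨hq, h1, h2⟩, rfl⟩
      refine ⟨⟨q, hq, rfl⟩, h1, ?_⟩
      rw [hm, pre_map hρ]
      simpa only [hχ] using h2
  rw [F_eq, F_eq, H_eq, H_eq, hfirst, polyF_image hρ, polyH_image hρ]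
  simp only [hg, hn]
  exact ⟨rfl, rfl⟩

theorem samePolynomials_of_move {D D' : LongDiagram} (h : ReidemeisterMove D.word D'.word) :
    SamePolynomials D D' := by
  generalize hD : D.word = w at h
  generalize hD' : D'.word = w' at h
  cases h with
  | rename f hf => subst hD; exact samePolynomials_rename ‹_› hD'
  | one u v x => exact samePolynomials_one hD hD'
  | two_parallel u v z x y ho hs => exact samePolynomials_two hD hD' (Or.inl rfl) ho hs
  | two_antiparallel u v z x y ho hs => exact samePolynomials_two hD hD' (Or.inr rfl) ho hs
  | three u₀ u₁ u₂ u₃ X Y Z a b c εa εb εc δ hp =>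
    intro e
    have hg : ∀ c ∈ D.firsts e, ∀ d ∈ D.firsts e, D.interα c d = D'.interα c d :=
      fun c _ d _ => form_three hp hD hD' (chi_mate_right c) (chi_mate_right d) 0 0
    have hn : ∀ c ∈ D.firsts e, D.index c = D'.index c :=
      fun c _ => form_three hp hD hD' (chi_mate_right c) (by simp) 0 1
    rw [F_eq, F_eq, H_eq, H_eq, polyF_congr _ hg, polyH_congr _ hg hn, firsts_three hp hD hD' e]
    exact ⟨rfl, rfl⟩

theorem samePolynomials_of_presents {D D' : LongDiagram} {K : LongVirtualKnot}
    (h : D.Presents K) (h' : D'.Presents K) : SamePolynomials D D' := by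
  have := Quot.eqvGen_exact (h.trans h'.symm)
  clear h h'
  induction this with
  | rel D D' h => exact samePolynomials_of_move h
  | refl D => exact fun e => ⟨rfl, rfl⟩
  | symm D D' _ ih => exact fun e => ⟨(ih e).1.symm, (ih e).2.symm⟩
  | trans D D' D'' _ _ ih ih' => exact fun e => ⟨(ih e).1.trans (ih' e).1, (ih e).2.trans (ih' e).2⟩

end LongDiagram

/-! ### Necessity: vanishing at one and symmetry. -/

namespace ClassFamily
open LaurentPolynomial
variable {ι : Type*}

theorem eval_one_T_sub_one (m : ℤ) :
    eval₂ (RingHom.id ℤ) 1 (T m - 1 : LaurentPolynomial ℤ) = 0 := by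
  simp

theorem eval_one_polyW (S : Finset ι) (ε n : ι → ℤ) :
    eval₂ (RingHom.id ℤ) 1 (polyW S ε n) = 0 := by
  simp [polyW, map_sum, eval_one_T_sub_one]

theorem eval_one_polyF (S : Finset ι) (ε : ι → ℤ) (g : ι → ι → ℤ) :
    eval₂ (RingHom.id ℤ) 1 (polyF S ε g) = 0 := by
  simp [polyF, map_sum, eval_one_T_sub_one]

theorem invert_polyF (S : Finset ι) (ε : ι → ℤ) {g : ι → ι → ℤ} (h : ∀ c d, g c d = -g d c) :
    invert (polyF S ε g) = polyF S ε g := by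
  simp only [polyF, map_sum, map_zsmul, map_sub, invert_T, map_one]
  rw [Finset.sum_comm]
  exact Finset.sum_congr rfl fun c _ => Finset.sum_congr rfl fun d _ => by
    rw [h d c, neg_neg, mul_comm]

theorem eval_one_polyH (S : Finset ι) (ε : ι → ℤ) (g : ι → ι → ℤ) (n : ι → ℤ) :
    eval₂ (RingHom.id ℤ) 1 (polyH S ε g n) = 0 := by
  have h : eval₂ (RingHom.id ℤ) 1 (invert (polyW S ε n)) = 0 := by
    simp [polyW, map_sum]
  rw [polyH, map_sub, map_sub, map_zsmul, map_zsmul, eval_one_polyF, eval_one_polyW, h]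
  simp

/-- The pairing `n d - n c + g c d` of complementary classes is again antisymmetric, and inversion
exchanges the two correction terms. -/
theorem invert_polyH (S : Finset ι) (ε : ι → ℤ) {g : ι → ι → ℤ} (n : ι → ℤ)
    (h : ∀ c d, g c d = -g d c) : invert (polyH S ε g n) = polyH S ε g n := by
  rw [polyH, map_sub, map_sub, map_zsmul, map_zsmul, involutive_invert,
    invert_polyF S ε fun c d => by rw [h c d]; ring]
  abel

end ClassFamily

namespace LongDiagram
open GaussLetter ClassFamily LaurentPolynomial

theorem F_symmetric (D : LongDiagram) (a : Fin 2) :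
    eval₂ (RingHom.id ℤ) 1 (D.F a a) = 0 ∧ D.F a a = invert (D.F a a) := by
  rw [F_eq]
  exact ⟨eval_one_polyF _ _ _, (invert_polyF _ _ D.interα_antisymm).symm⟩

theorem H_symmetric (D : LongDiagram) (a : Fin 2) :
    eval₂ (RingHom.id ℤ) 1 (D.H a a) = 0 ∧ D.H a a = invert (D.H a a) := by
  rw [H_eq]
  exact ⟨eval_one_polyH _ _ _ _, (invert_polyH _ _ _ D.interα_antisymm).symm⟩

end LongDiagram

/-! ### Counting cycles of permutations -/

namespace Equiv.Perm

/-- The number of cycles of a permutation, fixed points included. -/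
noncomputable def numCycles {X : Type*} (σ : Perm X) : ℕ :=
  Nat.card (Quotient (SameCycle.setoid σ))

theorem SameCycle.eq_of_invariant {X B : Type*} {σ : Perm X} {L : X → B}
    (hL : ∀ x, L (σ x) = L x) {x y : X} (h : σ.SameCycle x y) : L x = L y := by
  obtain ⟨i, rfl⟩ := h
  induction i with
  | zero => rfl
  | succ i ih => rw [ih, add_comm, zpow_add, zpow_one, mul_apply, hL]
  | pred i ih =>
    rw [ih, ← hL ((σ ^ (-(i : ℤ) - 1)) x), ← mul_apply, ← zpow_one_add]
    congr 2; ring_nf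

/-- The cycles of `σ` are classified by `L`, and `r` picks a point on each of them. -/
theorem numCycles_eq {X B : Type*} {σ : Perm X} (L : X → B) (r : B → X)
    (hL : ∀ x, L (σ x) = L x) (hr : ∀ x, σ.SameCycle x (r (L x))) (hLr : ∀ b, L (r b) = b) :
    σ.numCycles = Nat.card B := by
  refine Nat.card_congr ⟨Quotient.lift L fun x y h => SameCycle.eq_of_invariant hL h,
    fun b => Quotient.mk _ (r b), ?_, hLr⟩
  rintro ⟨x⟩
  exact Quotient.sound (hr x).symm

theorem numCycles_conj {X Y : Type*} {σ : Perm X} {τ : Perm Y} (e : X ≃ Y)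
    (h : ∀ x, e (σ x) = τ (e x)) : σ.numCycles = τ.numCycles := by
  have h1 : ∀ x, (Quotient.mk (SameCycle.setoid τ) (e (σ x))) = Quotient.mk _ (e x) := fun x => by
    rw [h]; exact Quotient.sound (sameCycle_apply_left.2 (SameCycle.refl τ _))
  have h2 : ∀ y, (Quotient.mk (SameCycle.setoid σ) (e.symm (τ y))) = Quotient.mk _ (e.symm y) :=
    fun y => by
      obtain ⟨x, rfl⟩ := e.surjective y
      rw [← h, e.symm_apply_apply, e.symm_apply_apply]
      exact Quotient.sound (sameCycle_apply_left.2 (SameCycle.refl σ _))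
  refine Nat.card_congr ⟨Quotient.lift (fun x => Quotient.mk (SameCycle.setoid τ) (e x))
      fun x y h => SameCycle.eq_of_invariant (σ := σ)
        (L := fun x => Quotient.mk (SameCycle.setoid τ) (e x)) h1 h,
    Quotient.lift (fun y => Quotient.mk (SameCycle.setoid σ) (e.symm y))
      fun x y h => SameCycle.eq_of_invariant (σ := τ)
        (L := fun y => Quotient.mk (SameCycle.setoid σ) (e.symm y)) h2 h, ?_, ?_⟩
  · rintro ⟨x⟩; simp [Quotient.lift_mk]; rfl
  · rintro ⟨x⟩; simp [Quotient.lift_mk]; rfl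

end Equiv.Perm

/-! ### Faces of a closed curve -/

/-- A closed curve on an oriented surface: the points on it with their successors, the other
passage through the same point of the surface, and the side from which the other strand is
crossed. -/
structure ClosedCurve (P : Type*) where
  /-- the next point on the curve -/
  succ : Equiv.Perm P
  /-- the other passage -/
  mate : P → P
  /-- the direction in which the strand lies relative to the other one -/
  right : P → Bool
  mate_mate : ∀ p, mate (mate p) = p
  right_mate : ∀ p, mate p ≠ p → right (mate p) = !right p

namespace ClosedCurve
open Equiv.Perm
variable {P Q : Type*}

/-- The next dart in counterclockwise order. -/
def next (C : ClosedCurve P) (d : P × Bool) : P × Bool :=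
  (C.mate d.1, if C.right d.1 then d.2 else !d.2)

/-- Two quarter turns at a crossing reverse the direction along the strand. A fixed point of `mate`,
such as a basepoint, already has period at most two. -/
theorem next_iterate (C : ClosedCurve P) (d : P × Bool) :
    C.next (C.next (C.next (C.next d))) = d := by
  obtain ⟨p, o⟩ := d
  by_cases h : C.mate p = p
  · simp only [next, h]; cases C.right p <;> simp
  · simp only [next, C.mate_mate, C.right_mate p h]; cases C.right p <;> simp

/-- The counterclockwise rotation. -/
def rot (C : ClosedCurve P) : Equiv.Perm (P × Bool) where
  toFun := C.next
  invFun d := C.next (C.next (C.next d))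
  left_inv := C.next_iterate
  right_inv := C.next_iterate

/-- The reversal of edges. -/
def opp (C : ClosedCurve P) : Equiv.Perm (P × Bool) where
  toFun d := if d.2 then (C.succ d.1, false) else (C.succ.symm d.1, true)
  invFun d := if d.2 then (C.succ d.1, false) else (C.succ.symm d.1, true)
  left_inv := by rintro ⟨p, _ | _⟩ <;> simp
  right_inv := by rintro ⟨p, _ | _⟩ <;> simp

/-- The number of faces. -/
noncomputable def numFaces (C : ClosedCurve P) : ℕ := (C.rot * C.opp).numCycles

theorem face_true (C : ClosedCurve P) (p : P) :
    (C.rot * C.opp) (p, true) = C.next (C.succ p, false) := by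
  simp [opp, rot]

theorem face_succ_false (C : ClosedCurve P) (p : P) :
    (C.rot * C.opp) (C.succ p, false) = C.next (p, true) := by
  simp [opp, rot]

theorem numFaces_congr (C : ClosedCurve P) (C' : ClosedCurve Q) (e : P ≃ Q)
    (hs : ∀ p, e (C.succ p) = C'.succ (e p)) (hm : ∀ p, e (C.mate p) = C'.mate (e p))
    (hr : ∀ p, C.right p = C'.right (e p)) : C.numFaces = C'.numFaces := by
  have hn : ∀ p o, ((C.next (p, o)).map e id) = C'.next (e p, o) := fun p o => by
    simp [next, hm, hr]
  refine numCycles_conj (e.prodCongr (Equiv.refl Bool)) ?_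
  rintro ⟨p, _ | _⟩
  · obtain ⟨q, rfl⟩ := C.succ.surjective p
    have := C'.face_succ_false (e q)
    rw [← hs] at this
    rw [face_succ_false]
    exact (hn q true).trans this.symm
  · rw [face_true]
    have := C'.face_true (e p)
    rw [← hs] at this
    exact (hn _ false).trans this.symm

/-- Replacing a crossing by three consecutive crossings of the same two parallel strands adds two
bigons. -/
theorem numFaces_twist [Finite P] (C : ClosedCurve P) (C' : ClosedCurve (P ⊕ Fin 4)) (r l : P)
    (hrl : C.mate r = l) (hne : r ≠ l) (hr : C.right r = true)
    (hm : ∀ p, C'.mate (.inl p) = .inl (C.mate p)) (hright : ∀ p, C'.right (.inl p) = C.right p)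
    (hm0 : C'.mate (.inr 0) = .inr 2) (hm1 : C'.mate (.inr 1) = .inr 3)
    (hr0 : C'.right (.inr 0) = false) (hr1 : C'.right (.inr 1) = true)
    (hs : ∀ p, p ≠ r → p ≠ l → C'.succ (.inl p) = .inl (C.succ p))
    (hsr : C'.succ (.inl r) = .inr 0) (hs0 : C'.succ (.inr 0) = .inr 1)
    (hs1 : C'.succ (.inr 1) = .inl (C.succ r))
    (hsl : C'.succ (.inl l) = .inr 2) (hs2 : C'.succ (.inr 2) = .inr 3)
    (hs3 : C'.succ (.inr 3) = .inl (C.succ l)) :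
    C'.numFaces = C.numFaces + 2 := by
  classical
  have hlr : C.mate l = r := by rw [← hrl, C.mate_mate]
  have hl : C.right l = false := by rw [← hrl, C.right_mate r (by rw [hrl]; exact hne.symm), hr]; rfl
  have hm2 : C'.mate (.inr 2) = .inr 0 := by rw [← hm0, C'.mate_mate]
  have hm3 : C'.mate (.inr 3) = .inr 1 := by rw [← hm1, C'.mate_mate]
  have hr2 : C'.right (.inr 2) = true := by
    rw [← hm0, C'.right_mate _ (by simp [hm0]), hr0]; rfl
  have hr3 : C'.right (.inr 3) = false := by
    rw [← hm1, C'.right_mate _ (by simp [hm1]), hr1]; rfl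
  set φ := C.rot * C.opp with hφ
  set φ' := C'.rot * C'.opp with hφ'
  have hinl : ∀ p o, C'.next (.inl p, o) = ((.inl (C.next (p, o)).1, (C.next (p, o)).2)) :=
    fun p o => by simp [next, hm, hright]
  let ι : P × Bool → (P ⊕ Fin 4) × Bool := fun d => (.inl d.1, d.2)
  -- The facts `f1` to `f14` give the new face permutation on all darts. The pairs `f6`, `f7` and
  -- `f13`, `f14` are the two new bigons. The remaining facts show the old faces with extra darts
  -- inserted. The dart `(l, true)` now bounds a bigon, and its old face runs through `(.inr 3,
  -- true)` instead.
  have f1 : ∀ p, p ≠ r → p ≠ l → φ' (.inl p, true) = ι (φ (p, true)) := fun p h h' => by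
    rw [hφ', hφ, face_true, face_true, hs p h h', hinl]
  have f2 : ∀ p, p ≠ r → p ≠ l → φ' (.inl (C.succ p), false) = ι (φ (C.succ p, false)) :=
    fun p h h' => by
      rw [hφ', hφ, face_succ_false, ← hs p h h', face_succ_false, hinl]
  have f3 : φ' (.inl r, true) = (.inr 2, true) := by
    rw [hφ', face_true, hsr]; simp [next, hm0, hr0]
  have f4 : φ' (.inr 2, true) = (.inr 1, true) := by
    rw [hφ', face_true, hs2]; simp [next, hm3, hr3]
  have f5 : φ' (.inr 1, true) = ι (φ (r, true)) := by
    rw [hφ', hφ, face_true, face_true, hs1, hinl]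
  have f6 : φ' (.inl l, true) = (.inr 0, false) := by
    rw [hφ', face_true, hsl]; simp [next, hm2, hr2]
  have f7 : φ' (.inr 0, false) = (.inl l, true) := by
    rw [hφ', ← hsr, face_succ_false]; simp [next, hm, hright, hrl, hr]
  have f8 : φ' (.inl (C.succ r), false) = (.inr 3, true) := by
    rw [hφ', ← hs1, face_succ_false]; simp [next, hm1, hr1]
  have f9 : φ' (.inr 3, true) = ι (φ (l, true)) := by
    rw [hφ', hφ, face_true, face_true, hs3, hinl]
  have f10 : φ' (.inl (C.succ l), false) = (.inr 1, false) := by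
    rw [hφ', ← hs3, face_succ_false]; simp [next, hm3, hr3]
  have f11 : φ' (.inr 1, false) = (.inr 2, false) := by
    rw [hφ', ← hs0, face_succ_false]; simp [next, hm0, hr0]
  have f12 : φ' (.inr 2, false) = (.inl r, false) := by
    rw [hφ', ← hsl, face_succ_false]; simp [next, hm, hright, hlr, hl]
  have f13 : φ' (.inr 0, true) = (.inr 3, false) := by
    rw [hφ', face_true, hs0]; simp [next, hm1, hr1]
  have f14 : φ' (.inr 3, false) = (.inr 0, true) := by
    rw [hφ', ← hs2, face_succ_false]; simp [next, hm2, hr2]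
  have g1 : φ (C.succ r, false) = (l, true) := by
    rw [hφ, face_succ_false]; simp [next, hrl, hr]
  have g2 : φ (C.succ l, false) = (r, false) := by
    rw [hφ, face_succ_false]; simp [next, hlr, hl]
  have g3 : ∀ d, φ d = (l, true) → d = (C.succ r, false) := fun d h =>
    φ.injective (h.trans g1.symm)
  have g4 : ∀ p, φ (p, true) ≠ (l, true) := fun p h => by simpa using congrArg Prod.snd (g3 _ h)
  have step : ∀ x, φ.SameCycle (φ x) x := fun x => sameCycle_apply_left.2 (SameCycle.refl _ _)
  have step' : ∀ x, φ'.SameCycle x (φ' x) := fun x => sameCycle_apply_right.2 (SameCycle.refl _ _)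
  -- the representative in the twisted curve of a dart of the original one
  let g : P × Bool → (P ⊕ Fin 4) × Bool := fun d => if d = (l, true) then (.inr 3, true) else ι d
  have gι : ∀ d, d ≠ (l, true) → g d = ι d := fun d h => if_neg h
  have gl : g (l, true) = (.inr 3, true) := if_pos rfl
  have hg : ∀ d, φ'.SameCycle (g d) (g (φ d)) := by
    rintro ⟨p, _ | _⟩
    · obtain ⟨q, rfl⟩ := C.succ.surjective p
      rw [gι (C.succ q, false) (by simp)]
      by_cases h : q = r
      · subst h
        rw [g1, gl, ← f8]; exact step' _
      · by_cases h' : q = l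
        · subst h'
          rw [g2, gι _ (by simp)]
          change φ'.SameCycle _ (Sum.inl r, false)
          rw [← f12, ← f11, ← f10]
          exact ((step' _).trans (step' _)).trans (step' _)
        · rw [gι _ fun e => h (by simpa using g3 _ e), ← f2 q h h']; exact step' _
    · rw [gι _ (g4 p)]
      by_cases h : p = r
      · subst h
        rw [gι _ (by simp [hne]), ← f5, ← f4, ← f3]
        exact ((step' _).trans (step' _)).trans (step' _)
      · by_cases h' : p = l
        · subst h'
          rw [gl, ← f9]; exact step' _
        · rw [gι _ (by simp [h']), ← f1 p h h']; exact step' _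
  have hg' : ∀ x y, φ.SameCycle x y → φ'.SameCycle (g x) (g y) := fun x y h => by
    have : ∀ x, Quotient.mk (SameCycle.setoid φ') (g (φ x)) = Quotient.mk _ (g x) :=
      fun x => Quotient.sound (hg x).symm
    exact Quotient.exact (SameCycle.eq_of_invariant
      (L := fun x => Quotient.mk (SameCycle.setoid φ') (g x)) this h)
  let q : P × Bool → Quotient (SameCycle.setoid φ) := Quotient.mk _
  have hq : ∀ x, q (φ x) = q x := fun x => Quotient.sound (step x)
  -- The label of a dart is the old face that contains it, or one of the two bigons.
  let L : (P ⊕ Fin 4) × Bool → Quotient (SameCycle.setoid φ) ⊕ Fin 2 := fun x => match x with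
    | (.inl p, o) => if (p, o) = (l, true) then .inr 0 else .inl (q (p, o))
    | (.inr 0, true) => .inr 1
    | (.inr 0, false) => .inr 0
    | (.inr 1, o) => .inl (q (r, o))
    | (.inr 2, o) => .inl (q (r, o))
    | (.inr 3, true) => .inl (q (l, true))
    | (.inr 3, false) => .inr 1
  have Lι : ∀ d, d ≠ (l, true) → L (ι d) = .inl (q d) := fun d h => if_neg h
  have Ll : L (.inl l, true) = .inr 0 := if_pos rfl
  have hcard : Nat.card (Quotient (SameCycle.setoid φ) ⊕ Fin 2) = C.numFaces + 2 := by
    rw [Nat.card_sum, Nat.card_eq_fintype_card (α := Fin 2), Fintype.card_fin]; rfl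
  rw [← hcard]
  refine numCycles_eq L (fun b => match b with
    | .inl c => g c.out
    | .inr 0 => (.inl l, true)
    | .inr 1 => (.inr 0, true)) ?_ ?_ ?_
  · rintro ⟨p | i, o⟩
    · cases o with
      | false =>
        obtain ⟨p, rfl⟩ := C.succ.surjective p
        rw [show L (.inl (C.succ p), false) = .inl (q (C.succ p, false)) from
          Lι (C.succ p, false) (by simp)]
        by_cases h : p = r
        · subst h; rw [← hφ', f8, ← hq, g1]
        · by_cases h' : p = l
          · subst h'; rw [← hφ', f10, ← hq, g2]
          · rw [← hφ', f2 p h h', Lι _ fun e => h (by simpa using g3 _ e), hq]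
      | true =>
        by_cases h : p = r
        · subst h
          rw [show L (.inl p, true) = .inl (q (p, true)) from
            Lι (p, true) (by simp [hne]), ← hφ', f3]
        · by_cases h' : p = l
          · subst h'; rw [← hφ', f6, Ll]
          · rw [show L (.inl p, true) = .inl (q (p, true)) from
              Lι (p, true) (by simp [h']), ← hφ',
              f1 p h h', Lι _ (g4 p), hq]
    · rw [← hφ']
      fin_cases i <;> cases o
      · exact (congrArg L f7).trans Ll
      · exact congrArg L f13
      · exact congrArg L f11
      · exact (congrArg L f5).trans ((Lι _ (g4 r)).trans (congrArg _ (hq _)))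
      · exact (congrArg L f12).trans (Lι (r, false) (by simp))
      · exact congrArg L f4
      · exact congrArg L f14
      · exact (congrArg L f9).trans ((Lι _ (g4 l)).trans (congrArg _ (hq _)))
  · have hout : ∀ d, φ'.SameCycle (g d) (g (q d).out) := fun d =>
      hg' _ _ (Quotient.exact (Quotient.out_eq (q d)).symm)
    rintro ⟨p | i, o⟩
    · by_cases h : (p, o) = (l, true)
      · rw [Prod.mk.injEq] at h
        obtain ⟨rfl, rfl⟩ := h
        rw [Ll]
      · rw [show L (.inl p, o) = .inl (q (p, o)) from Lι _ h]
        have := hout (p, o)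
        rwa [gι _ h] at this
    · fin_cases i <;> cases o
      · change φ'.SameCycle (.inr 0, false) (.inl l, true)
        rw [← f7]; exact step' _
      · exact SameCycle.refl _ _
      · refine SameCycle.trans ?_ (hout (r, false))
        rw [gι _ (by simp)]
        change φ'.SameCycle (.inr 1, false) (.inl r, false)
        rw [← f12, ← f11]; exact (step' _).trans (step' _)
      · refine SameCycle.trans ?_ (hout (r, true))
        rw [gι _ (by simp [hne])]
        change φ'.SameCycle (.inr 1, true) (.inl r, true)
        refine SameCycle.symm ?_
        rw [← f4, ← f3]; exact (step' _).trans (step' _)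
      · refine SameCycle.trans ?_ (hout (r, false))
        rw [gι _ (by simp)]
        change φ'.SameCycle (.inr 2, false) (.inl r, false)
        rw [← f12]; exact step' _
      · refine SameCycle.trans ?_ (hout (r, true))
        rw [gι _ (by simp [hne])]
        change φ'.SameCycle (.inr 2, true) (.inl r, true)
        refine SameCycle.symm ?_
        rw [← f3]; exact step' _
      · change φ'.SameCycle (.inr 3, false) (.inr 0, true)
        rw [← f14]; exact step' _
      · refine SameCycle.trans ?_ (hout (l, true))
        rw [gl]
        exact SameCycle.refl _ _
  · rintro (c | i)
    · change L (g c.out) = .inl c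
      have hc : q c.out = c := Quotient.out_eq c
      by_cases h : c.out = (l, true)
      · rw [h, gl]; change Sum.inl (q (l, true)) = _; rw [← h, hc]
      · rw [gι _ h, Lι _ h, hc]
    · fin_cases i
      · exact Ll
      · rfl

end ClosedCurve

namespace ClosedCurve
variable {P Q : Type*}

/-- A closed curve transported along a renaming of its points. -/
def pullback (C : ClosedCurve Q) (e : P ≃ Q) : ClosedCurve P where
  succ := (e.trans C.succ).trans e.symm
  mate p := e.symm (C.mate (e p))
  right p := C.right (e p)
  mate_mate p := by simp [C.mate_mate]
  right_mate p h := by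
    have : C.mate (e p) ≠ e p := fun h' => h (by rw [h', e.symm_apply_apply])
    simp [C.right_mate _ this]

theorem numFaces_pullback (C : ClosedCurve Q) (e : P ≃ Q) :
    (C.pullback e).numFaces = C.numFaces :=
  numFaces_congr _ _ e (by simp [pullback]) (by simp [pullback]) (by simp [pullback])

end ClosedCurve

/-- The involution exchanges `{p | p ≤ m p}` and `{p | m p ≤ p}`, which cover everything and meet in
the single fixed point. It serves to count points modulo `mate`, with the smaller point of each pair
as representative. -/
theorem Fin.two_mul_card_le_involution {n : ℕ} (m : Fin (n + 1) → Fin (n + 1))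
    (hm : ∀ p, m (m p) = p) (h0 : ∀ p, m p = p ↔ p = 0) :
    2 * Nat.card {p // p ≤ m p} = n + 2 := by
  have h1 : (Finset.univ.filter fun p => p ≤ m p).card
      = (Finset.univ.filter fun p => m p ≤ p).card :=
    Finset.card_nbij' m m (fun p hp => by simpa [hm] using hp) (fun p hp => by simpa [hm] using hp)
      (fun p _ => hm p) (fun p _ => hm p)
  have h2 := Finset.card_union_add_card_inter (Finset.univ.filter fun p => p ≤ m p)
    (Finset.univ.filter fun p => m p ≤ p)
  have h3 : (Finset.univ.filter fun p => p ≤ m p) ∪ (Finset.univ.filter fun p => m p ≤ p)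
      = Finset.univ := by
    ext p; simp [le_total]
  have h4 : (Finset.univ.filter fun p => p ≤ m p) ∩ (Finset.univ.filter fun p => m p ≤ p)
      = {0} := by
    ext p
    simp only [Finset.mem_inter, Finset.mem_filter, Finset.mem_univ, true_and,
      Finset.mem_singleton, ← h0]
    exact ⟨fun h => le_antisymm h.2 h.1, fun h => by rw [h]; simp⟩
  rw [h3, h4, Finset.card_singleton, Finset.card_univ, Fintype.card_fin, ← h1] at h2
  rw [Nat.card_eq_fintype_card, Fintype.card_subtype]
  omega

/-! ### The closed curve of a diagram and the genus of its minimal surface. -/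

namespace LongDiagram
open GaussLetter Equiv.Perm

theorem next_zero (D : LongDiagram) (o : Bool) : D.next (0, o) = (0, !o) := rfl

theorem next_of_val (D : LongDiagram) {p q : Fin (D.word.length + 1)} {x : GaussLetter} {i j : ℕ}
    (hp : p.val = i + 1) (hq : q.val = j + 1) (hi : D.word[i]? = some x)
    (hj : D.word[j]? = some x.mate) (o : Bool) :
    D.next (p, o) = (q, if x.isRight then o else !o) := by
  obtain ⟨p, hp'⟩ := p
  obtain ⟨q, hq'⟩ := q
  simp only at hp hq
  subst hp hq
  obtain ⟨hi', hi⟩ := List.getElem?_eq_some_iff.1 hi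
  obtain ⟨hj', hj⟩ := List.getElem?_eq_some_iff.1 hj
  have h1 : D.word.idxOf D.word[i].mate = j := by
    rw [hi, ← hj]; exact D.word_nodup.idxOf_getElem j hj'
  have h2 : (x.isOver = true ↔ x.sign = 1) ↔ x.isRight = true := by
    unfold isRight; cases x.isOver <;> by_cases h : x.sign = 1 <;> simp [h]
  simp only [next, hi, h2]
  refine Prod.ext (Fin.ext ?_) rfl
  simp only [← hi, h1]

theorem point_cases (D : LongDiagram) (p : Fin (D.word.length + 1)) :
    p = 0 ∨ ∃ (q : Fin (D.word.length + 1)) (x : GaussLetter) (i j : ℕ), p.val = i + 1 ∧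
      q.val = j + 1 ∧ D.word[i]? = some x ∧ D.word[j]? = some x.mate := by
  obtain ⟨_ | i, hp⟩ := p
  · exact Or.inl rfl
  · right
    have hi : i < D.word.length := by omega
    have hj := List.idxOf_lt_length_of_mem (D.paired _ (List.getElem_mem hi))
    exact ⟨⟨_, Nat.succ_lt_succ hj⟩, D.word[i], i, _, rfl, rfl, List.getElem?_eq_getElem hi,
      by rw [List.getElem?_eq_getElem hj, List.getElem_idxOf]⟩

theorem next_fst_fst (D : LongDiagram) (p : Fin (D.word.length + 1)) (o : Bool) :
    D.next (p, o) = ((D.next (p, true)).1, if (D.next (p, true)).2 then o else !o) := by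
  rcases D.point_cases p with rfl | ⟨q, x, i, j, hp, hq, hi, hj⟩
  · simp [next_zero]
  · simp only [D.next_of_val hp hq hi hj]
    cases x.isRight <;> simp

/-- The closed curve of a diagram, with the basepoint as point `0`. -/
def curve (D : LongDiagram) : ClosedCurve (Fin (D.word.length + 1)) where
  succ := Equiv.addRight 1
  mate p := (D.next (p, true)).1
  right p := (D.next (p, true)).2
  mate_mate p := by
    rcases D.point_cases p with rfl | ⟨q, x, i, j, hp, hq, hi, hj⟩
    · simp [next_zero]
    · simp only [D.next_of_val hp hq hi hj, D.next_of_val hq hp hj (by simpa using hi)]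
  right_mate p h := by
    rcases D.point_cases p with rfl | ⟨q, x, i, j, hp, hq, hi, hj⟩
    · simp [next_zero] at h
    · simp only [D.next_of_val hp hq hi hj, D.next_of_val hq hp hj (by simpa using hi)]
      cases h : x.isRight <;> simp [h]

theorem curve_next (D : LongDiagram) (d : D.Dart) : D.curve.next d = D.next d := by
  rw [← Prod.mk.eta (p := d), D.next_fst_fst]; rfl

theorem curve_mate_zero (D : LongDiagram) : D.curve.mate 0 = 0 := rfl

theorem curve_right_zero (D : LongDiagram) : D.curve.right 0 = false := rfl

theorem curve_mate (D : LongDiagram) {p q : Fin (D.word.length + 1)} {x : GaussLetter} {i j : ℕ}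
    (hp : p.val = i + 1) (hq : q.val = j + 1) (hi : D.word[i]? = some x)
    (hj : D.word[j]? = some x.mate) : D.curve.mate p = q :=
  congrArg Prod.fst (D.next_of_val hp hq hi hj true)

theorem curve_right (D : LongDiagram) {p : Fin (D.word.length + 1)} {x : GaussLetter} {i : ℕ}
    (hp : p.val = i + 1) (hi : D.word[i]? = some x) : D.curve.right p = x.isRight := by
  rcases D.point_cases p with rfl | ⟨q, y, i', j, hp', hq, hi', hj⟩
  · simp at hp
  · obtain rfl : i' = i := by omega
    have : y = x := by simpa [hi] using hi'.symm
    subst this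
    rw [show D.curve.right p = (D.next (p, true)).2 from rfl, D.next_of_val hp' hq hi hj]
    cases y.isRight <;> simp

theorem curve_succ_val (D : LongDiagram) (p : Fin (D.word.length + 1)) :
    (D.curve.succ p).val = if p.val = D.word.length then 0 else p.val + 1 := by
  change (p + 1).val = _
  rw [Fin.val_add_one]
  simp [Fin.ext_iff]

theorem curve_mate_eq_self (D : LongDiagram) (p : Fin (D.word.length + 1)) :
    D.curve.mate p = p ↔ p = 0 := by
  rcases D.point_cases p with rfl | ⟨q, x, i, j, hp, hq, hi, hj⟩
  · simp [curve_mate_zero]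
  · rw [D.curve_mate hp hq hi hj]
    constructor
    · rintro rfl
      obtain rfl : i = j := by omega
      rw [hi] at hj
      exact absurd (Option.some.inj hj).symm (mate_ne x)
    · rintro rfl; simp at hp

theorem curve_opp (D : LongDiagram) (d : D.Dart) : D.curve.opp d = D.opp d := by
  obtain ⟨p, _ | _⟩ := d
  · simp [ClosedCurve.opp, opp, curve, sub_eq_add_neg]
  · simp [ClosedCurve.opp, opp, curve]

theorem curve_rot (D : LongDiagram) (d : D.Dart) : D.curve.rot d = D.next d := D.curve_next d

theorem rot_rot (D : LongDiagram) {p : Fin (D.word.length + 1)} (hp : p ≠ 0) (o : Bool) :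
    D.curve.rot (D.curve.rot (p, o)) = (p, !o) := by
  have h := D.curve.right_mate p fun h => hp ((D.curve_mate_eq_self p).1 h)
  change D.curve.next (D.curve.next (p, o)) = _
  simp only [ClosedCurve.next, D.curve.mate_mate, h]
  cases D.curve.right p <;> simp

/-- Travelling along the curve reaches every dart: `opp` goes to the next point, and two quarter
turns go straight through a crossing. -/
theorem connected_aux (D : LongDiagram) (d : D.Dart) :
    ∃ g ∈ Subgroup.closure {D.curve.rot, D.curve.opp}, g (0, true) = d := by
  have hr : D.curve.rot ∈ Subgroup.closure {D.curve.rot, D.curve.opp} :=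
    Subgroup.subset_closure (by simp)
  have ho : D.curve.opp ∈ Subgroup.closure {D.curve.rot, D.curve.opp} :=
    Subgroup.subset_closure (by simp)
  obtain ⟨⟨p, hp⟩, o⟩ := d
  induction p generalizing o with
  | zero =>
    cases o
    · exact ⟨_, hr, D.curve_rot _⟩
    · exact ⟨1, one_mem _, rfl⟩
  | succ p ih =>
    obtain ⟨g, hg, hg'⟩ := ih true (by omega)
    have h1 : D.curve.opp (⟨p, by omega⟩, true) = (⟨p + 1, hp⟩, false) := by
      have : D.curve.succ ⟨p, by omega⟩ = ⟨p + 1, hp⟩ :=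
        Fin.ext (by rw [curve_succ_val, if_neg (by simp only; omega)])
      simp [ClosedCurve.opp, this]
    cases o
    · exact ⟨D.curve.opp * g, mul_mem ho hg, by rw [mul_apply, hg', h1]⟩
    · refine ⟨D.curve.rot * D.curve.rot * (D.curve.opp * g), mul_mem (mul_mem hr hr)
        (mul_mem ho hg), ?_⟩
      rw [mul_apply, mul_apply, mul_apply, hg', h1, rot_rot]
      · rfl
      · simp [Fin.ext_iff]

/-- The minimal surface that carries a diagram. -/
def surface (D : LongDiagram) : CellularSurface where
  Dart := D.Dart
  finite := inferInstance
  rot := D.curve.rot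
  opp := D.curve.opp
  opp_opp := by rintro ⟨p, _ | _⟩ <;> simp [ClosedCurve.opp]
  opp_ne := by rintro ⟨p, _ | _⟩ <;> simp [ClosedCurve.opp]
  connected d e := by
    obtain ⟨g, hg, rfl⟩ := D.connected_aux d
    obtain ⟨h, hh, rfl⟩ := D.connected_aux e
    exact ⟨h * g⁻¹, mul_mem hh (inv_mem hg), by simp⟩

/-- A diagram is realized on its minimal surface. -/
def surfaceRealization (D : LongDiagram) : SurfaceRealization D D.surface where
  draw := Function.Embedding.refl _
  draw_opp := D.curve_opp
  draw_next d := ⟨1, one_pos, D.curve_rot d, fun j hj hj' => by omega⟩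

/-- Orbits of the rotation are points modulo `mate`. The basepoint, alone fixed by `mate`, is a
vertex of its own. -/
theorem numVertices_surface (D : LongDiagram) :
    2 * D.surface.numVertices = D.word.length + 2 := by
  have h1 : ∀ p o, D.curve.rot.SameCycle (p, o) (p, true) := fun p o => by
    cases o
    · by_cases hp : p = 0
      · subst hp
        rw [show ((0 : Fin (D.word.length + 1)), true) = D.curve.rot (0, false) from
          ((D.curve_rot (0, false)).trans (D.next_zero false)).symm]
        exact sameCycle_apply_right.2 (SameCycle.refl _ _)
      · rw [show (p, true) = D.curve.rot (D.curve.rot (p, false)) from (D.rot_rot hp false).symm]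
        exact sameCycle_apply_right.2 (sameCycle_apply_right.2 (SameCycle.refl _ _))
    · exact SameCycle.refl _ _
  have h2 : ∀ p, D.curve.rot.SameCycle (p, true) (D.curve.mate p, true) := fun p =>
    SameCycle.trans (sameCycle_apply_right.2 (SameCycle.refl _ _)) (h1 _ _)
  have h3 : ∀ p o, (D.curve.rot (p, o)).1 = D.curve.mate p := fun _ _ => rfl
  have h4 : ∀ p, (if p ≤ D.curve.mate p then p else D.curve.mate p)
      ≤ D.curve.mate (if p ≤ D.curve.mate p then p else D.curve.mate p) := fun p => by
    split_ifs with h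
    · exact h
    · rw [D.curve.mate_mate]; exact (not_le.1 h).le
  rw [← Fin.two_mul_card_le_involution D.curve.mate D.curve.mate_mate D.curve_mate_eq_self]
  congr 1
  refine numCycles_eq (σ := D.curve.rot)
    (fun d => (⟨if d.1 ≤ D.curve.mate d.1 then d.1 else D.curve.mate d.1, h4 d.1⟩ :
      {p // p ≤ D.curve.mate p})) (fun b => (b.1, true)) ?_ ?_ ?_
  · rintro ⟨p, o⟩
    simp only [h3, D.curve.mate_mate, Subtype.mk.injEq]
    rcases lt_trichotomy p (D.curve.mate p) with h | h | h
    · rw [if_neg (not_le.2 h), if_pos h.le]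
    · rw [← h, if_pos le_rfl]
    · rw [if_pos h.le, if_neg (not_le.2 h)]
  · rintro ⟨p, o⟩
    dsimp only
    split_ifs
    · exact h1 p o
    · exact (h1 p o).trans (h2 p)
  · rintro ⟨p, hp⟩
    simp [hp]

theorem numEdges_surface (D : LongDiagram) : D.surface.numEdges = D.word.length + 1 := by
  have h := numCycles_eq (σ := D.curve.opp)
    (fun d => if d.2 then d.1 else D.curve.succ.symm d.1) (fun b => (b, true)) ?_ ?_ ?_
  · rw [Nat.card_eq_fintype_card, Fintype.card_fin] at h; exact h
  · rintro ⟨p, _ | _⟩ <;> simp [ClosedCurve.opp]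
  · rintro ⟨p, _ | _⟩
    · have : D.curve.opp (p, false) = (D.curve.succ.symm p, true) := by simp [ClosedCurve.opp]
      simp only [Bool.false_eq_true, if_false, ← this]
      exact sameCycle_apply_right.2 (SameCycle.refl _ _)
    · exact SameCycle.refl _ _
  · simp

/-- With `2n` passages there are `n + 1` vertices and `2n + 1` edges, so `n` faces give Euler
characteristic zero. -/
theorem sg₁_le_one {D : LongDiagram} {K : LongVirtualKnot} (hD : D.Presents K)
    (h : 2 * D.curve.numFaces = D.word.length) : K.sg₁ ≤ 1 := by
  refine iInf₂_le_of_le 1 ⟨D, D.surface, hD, ⟨D.surfaceRealization⟩, ?_⟩ (by simp)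
  have hv := D.numVertices_surface
  have he := D.numEdges_surface
  have hf : D.surface.numFaces = D.curve.numFaces := rfl
  unfold CellularSurface.HasGenus
  omega

/-! ### Twisting a crossing -/

theorem getElem?_block {α : Type*} (A l C : List α) {i k : ℕ} (hi : i = A.length + k)
    (hk : k < l.length) : (A ++ l ++ C)[i]? = l[k]? := by
  subst hi
  rw [List.append_assoc, List.getElem?_append_right (by omega), Nat.add_sub_cancel_left,
    List.getElem?_append_left hk]

section twist
variable {D D' : LongDiagram} {u v w : List GaussLetter} {x y z : GaussLetter}

theorem twist_old (hD : D.word = u ++ [x] ++ v ++ [x.mate] ++ w) : D.word[u.length]? = some x ∧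
    D.word[u.length + 1 + v.length]? = some x.mate := by
  rw [hD]
  constructor
  · rw [List.append_assoc (u ++ _), List.append_assoc (u ++ _),
      getElem?_block _ _ _ (k := 0) (by simp) (by simp)]; rfl
  · rw [getElem?_block _ _ _ (k := 0) (by simp; omega) (by simp)]; rfl

theorem twist_getElem? (hD : D.word = u ++ [x] ++ v ++ [x.mate] ++ w)
    (hD' : D'.word = u ++ [x, y, z] ++ v ++ [x.mate, y.mate, z.mate] ++ w) (i : ℕ) :
    D'.word[if i ≤ u.length then i else if i ≤ u.length + 1 + v.length then i + 2 else i + 4]?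
      = D.word[i]? := by
  rw [hD, hD']
  split_ifs with h1 h2
  · rcases h1.lt_or_eq with h | h
    · simp only [List.append_assoc]
      rw [List.getElem?_append_left h, List.getElem?_append_left h]
    · simp [h]
  · rcases h2.lt_or_eq with h | h
    · rw [List.append_assoc _ [x.mate], List.append_assoc _ [x.mate, y.mate, z.mate],
        getElem?_block _ _ _ (k := i - (u.length + 1)) (by simp; omega) (by omega),
        getElem?_block _ _ _ (k := i - (u.length + 1)) (by simp; omega) (by omega)]
    · rw [getElem?_block _ _ _ (k := 0) (by simp; omega) (by simp),
        getElem?_block _ _ _ (k := 0) (by simp; omega) (by simp)]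
      rfl
  · rw [List.getElem?_append_right (by simp; omega), List.getElem?_append_right (by simp; omega)]
    congr 1
    simp; omega

theorem twist_new (hD' : D'.word = u ++ [x, y, z] ++ v ++ [x.mate, y.mate, z.mate] ++ w) :
    D'.word[u.length + 1]? = some y ∧ D'.word[u.length + 2]? = some z ∧
    D'.word[u.length + v.length + 4]? = some y.mate ∧
    D'.word[u.length + v.length + 5]? = some z.mate := by
  rw [hD']
  refine ⟨?_, ?_, ?_, ?_⟩
  · rw [List.append_assoc (u ++ _), List.append_assoc (u ++ _),
      getElem?_block _ _ _ (k := 1) (by simp) (by simp)]; rfl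
  · rw [List.append_assoc (u ++ _), List.append_assoc (u ++ _),
      getElem?_block _ _ _ (k := 2) (by simp) (by simp)]; rfl
  · rw [getElem?_block _ _ _ (k := 1) (by simp; omega) (by simp)]; rfl
  · rw [getElem?_block _ _ _ (k := 2) (by simp; omega) (by simp)]; rfl

theorem numFaces_twist (hD : D.word = u ++ [x] ++ v ++ [x.mate] ++ w)
    (hD' : D'.word = u ++ [x, y, z] ++ v ++ [x.mate, y.mate, z.mate] ++ w)
    (hy : y.isRight = !x.isRight) (hz : z.isRight = x.isRight) :
    D'.curve.numFaces = D.curve.numFaces + 2 := by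
  have hlen : D'.word.length = D.word.length + 4 := by rw [hD, hD']; simp; omega
  have hL : D.word.length = u.length + v.length + w.length + 2 := by rw [hD]; simp; omega
  obtain ⟨ny, nz, ny', nz'⟩ := twist_new hD'
  obtain ⟨ox, ox'⟩ := twist_old hD
  -- the strand of the right passage and the other strand
  obtain ⟨r, y₁, z₁, l, y₂, z₂, hcase⟩ : ∃ r y₁ z₁ l y₂ z₂ : ℕ,
      (x.isRight = true ∧ r = u.length + 1 ∧ y₁ = u.length + 2 ∧ z₁ = u.length + 3 ∧
        l = u.length + v.length + 2 ∧ y₂ = u.length + v.length + 5 ∧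
        z₂ = u.length + v.length + 6) ∨
      (x.isRight = false ∧ l = u.length + 1 ∧ y₂ = u.length + 2 ∧ z₂ = u.length + 3 ∧
        r = u.length + v.length + 2 ∧ y₁ = u.length + v.length + 5 ∧
        z₁ = u.length + v.length + 6) := by
    cases x.isRight
    · exact ⟨_, _, _, _, _, _, Or.inr ⟨rfl, rfl, rfl, rfl, rfl, rfl, rfl⟩⟩
    · exact ⟨_, _, _, _, _, _, Or.inl ⟨rfl, rfl, rfl, rfl, rfl, rfl, rfl⟩⟩
  -- The point of a passage is its index plus one, since point `0` is the basepoint. Old points move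
  -- by `0`, `2` or `4`, according to how many of the inserted pairs precede them.
  let sh : ℕ → ℕ := fun p =>
    if p ≤ u.length + 1 then p else if p ≤ u.length + v.length + 2 then p + 2 else p + 4
  have hsh : ∀ p, sh p = if p ≤ u.length + 1 then p
    else if p ≤ u.length + v.length + 2 then p + 2 else p + 4 := fun _ => rfl
  have hshi : ∀ i, sh (i + 1) = (if i ≤ u.length then i
      else if i ≤ u.length + 1 + v.length then i + 2 else i + 4) + 1 := fun i => by
    rw [hsh]; split_ifs <;> omega
  let E : Fin (D.word.length + 1) ⊕ Fin 4 → ℕ := Sum.elim (fun p => sh p) ![y₁, z₁, y₂, z₂]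
  have hElt : ∀ s, E s < D'.word.length + 1 := by
    rintro (p | i)
    · have := p.2; simp only [E, Sum.elim_inl, hsh]; split_ifs <;> omega
    · fin_cases i <;> simp [E] <;> omega
  have hEinj : Function.Injective fun s => (⟨E s, hElt s⟩ : Fin (D'.word.length + 1)) := by
    have h4 : ∀ (p : ℕ) (i : Fin 4), sh p ≠ ![y₁, z₁, y₂, z₂] i := fun p i => by
      rw [hsh]; fin_cases i <;> simp <;> split_ifs <;> omega
    rintro (p | i) (q | j) h
    all_goals simp only [Fin.mk.injEq, E, Sum.elim_inl, Sum.elim_inr] at h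
    · rw [hsh, hsh] at h
      congr 1; ext; split_ifs at h <;> omega
    · exact absurd h (h4 _ _)
    · exact absurd h.symm (h4 _ _)
    · congr 1
      fin_cases i <;> fin_cases j <;> simp at h ⊢ <;> omega
  let e : Fin (D.word.length + 1) ⊕ Fin 4 ≃ Fin (D'.word.length + 1) := Equiv.ofBijective _
    ((Fintype.bijective_iff_injective_and_card _).2 ⟨hEinj, by simp [hlen]⟩)
  have he : ∀ s, (e s).val = E s := fun s => rfl
  have hel : ∀ p, (e (.inl p)).val = sh p := fun p => rfl
  have e0 : (e (.inr 0)).val = y₁ := rfl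
  have e1 : (e (.inr 1)).val = z₁ := rfl
  have e2 : (e (.inr 2)).val = y₂ := rfl
  have e3 : (e (.inr 3)).val = z₂ := rfl
  have hr' : r < D.word.length + 1 := by omega
  have hl' : l < D.word.length + 1 := by omega
  have hold : ∀ i, D'.word[sh (i + 1) - 1]? = D.word[i]? := fun i => by
    rw [hshi, Nat.add_sub_cancel]; exact twist_getElem? hD hD' i
  have hsh1 : ∀ i, sh (i + 1) = sh (i + 1) - 1 + 1 := fun i => by rw [hshi]; omega
  have he0 : e (.inl 0) = 0 := by ext; rw [hel]; simp [hsh]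
  have hm : ∀ p, D'.curve.mate (e (.inl p)) = e (.inl (D.curve.mate p)) := fun p => by
    rcases D.point_cases p with rfl | ⟨q, t, i, j, hp, hq, hi, hj⟩
    · rw [curve_mate_zero, he0, curve_mate_zero]
    · rw [D.curve_mate hp hq hi hj]
      exact D'.curve_mate (by rw [hel, hp]; exact hsh1 i) (by rw [hel, hq]; exact hsh1 j)
        ((hold i).trans hi) ((hold j).trans hj)
  have hright : ∀ p, D'.curve.right (e (.inl p)) = D.curve.right p := fun p => by
    rcases D.point_cases p with rfl | ⟨q, t, i, j, hp, hq, hi, hj⟩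
    · rw [he0, curve_right_zero, curve_right_zero]
    · rw [D.curve_right hp hi]
      exact D'.curve_right (by rw [hel, hp]; exact hsh1 i) ((hold i).trans hi)
  have hrx : D.curve.mate ⟨r, hr'⟩ = ⟨l, hl'⟩ ∧ D.curve.right ⟨r, hr'⟩ = true := by
    rcases hcase with ⟨hx, rfl, -, -, rfl, -, -⟩ | ⟨hx, rfl, -, -, rfl, -, -⟩
    · exact ⟨D.curve_mate rfl (by simp only; omega) ox ox', (D.curve_right rfl ox).trans hx⟩
    · exact ⟨D.curve_mate (i := u.length + 1 + v.length) (by simp only; omega) rfl ox'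
        (by simpa using ox), (D.curve_right (i := u.length + 1 + v.length)
          (by simp only; omega) ox').trans (by simp [hx])⟩
  have hnew : D'.curve.mate (e (.inr 0)) = e (.inr 2) ∧ D'.curve.mate (e (.inr 1)) = e (.inr 3) ∧
      D'.curve.right (e (.inr 0)) = false ∧ D'.curve.right (e (.inr 1)) = true := by
    rcases hcase with ⟨hx, -, rfl, rfl, -, rfl, rfl⟩ | ⟨hx, -, rfl, rfl, -, rfl, rfl⟩
    · exact ⟨D'.curve_mate e0 e2 ny ny', D'.curve_mate e1 e3 nz nz',
        (D'.curve_right e0 ny).trans (by simp [hy, hx]),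
        (D'.curve_right e1 nz).trans (by simp [hz, hx])⟩
    · exact ⟨D'.curve_mate e0 e2 ny' (by simpa using ny),
        D'.curve_mate e1 e3 nz' (by simpa using nz),
        (D'.curve_right e0 ny').trans (by simp [hy, hx]),
        (D'.curve_right e1 nz').trans (by simp [hz, hx])⟩
  have hs : ∀ a b, (e b).val = (if (e a).val = D'.word.length then 0 else (e a).val + 1) →
      D'.curve.succ (e a) = e b := fun a b h => Fin.ext (by rw [curve_succ_val, h])
  rw [← D'.curve.numFaces_pullback e]
  refine ClosedCurve.numFaces_twist D.curve _ ⟨r, hr'⟩ ⟨l, hl'⟩ hrx.1 ?_ hrx.2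
    ?_ ?_ ?_ ?_ ?_ ?_ ?_ ?_ ?_ ?_ ?_ ?_ ?_
  · simp only [ne_eq, Fin.mk.injEq]; omega
  · intro p; simp [ClosedCurve.pullback, hm]
  · intro p; simp [ClosedCurve.pullback, hright]
  · simp [ClosedCurve.pullback, hnew]
  · simp [ClosedCurve.pullback, hnew]
  · simp [ClosedCurve.pullback, hnew]
  · simp [ClosedCurve.pullback, hnew]
  all_goals
    try intro p hp hp'
    simp only [ClosedCurve.pullback, Equiv.trans_apply, Equiv.symm_apply_eq]
    apply hs
    simp only [hel, e0, e1, e2, e3, hsh, curve_succ_val]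
  · have h1 : p.val ≠ r := fun h => hp (Fin.ext h)
    have h2 : p.val ≠ l := fun h => hp' (Fin.ext h)
    have := p.2
    split_ifs <;> omega
  all_goals split_ifs <;> omega

end twist

end LongDiagram

namespace GaussLetter

/-- A passage with prescribed direction relative to the other strand. -/
def ofRight (n : ℕ) (o r : Bool) : GaussLetter := ⟨n, o, if o = r then 1 else -1⟩

@[simp] theorem ofRight_chord (n : ℕ) (o r : Bool) : (ofRight n o r).chord = n := rfl

@[simp] theorem ofRight_isOver (n : ℕ) (o r : Bool) : (ofRight n o r).isOver = o := rfl

theorem ofRight_sign (n : ℕ) (o r : Bool) : (ofRight n o r).sign = if o = r then 1 else -1 := rfl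

@[simp] theorem ofRight_isRight (n : ℕ) (o r : Bool) : (ofRight n o r).isRight = r := by
  have hn : ((-1 : ℤˣ) = 1) = False := by decide
  cases o <;> cases r <;> simp [ofRight, isRight, hn]

theorem ofRight_mate (n : ℕ) (o r : Bool) : (ofRight n o r).mate = ofRight n (!o) (!r) := by
  simp [ofRight, mate]

end GaussLetter

namespace LongDiagram
open GaussLetter

theorem exists_word_eq {D : LongDiagram} {x : GaussLetter} (hx : x ∈ D.word)
    (hf : D.pos x < D.pos x.mate) :
    ∃ u v w, D.word = u ++ [x] ++ v ++ [x.mate] ++ w := by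
  obtain ⟨u, t, hu⟩ := List.append_of_mem hx
  have hxu : x ∉ u := fun h => by
    have := D.word_nodup
    rw [hu] at this
    simp only [List.nodup_append, List.mem_cons] at this
    grind
  have hm := D.paired x hx
  have hmu : x.mate ∉ u := fun h => by
    unfold pos at hf
    rw [hu, List.idxOf_append_of_mem h, List.idxOf_append_of_notMem hxu] at hf
    have := List.idxOf_lt_length_of_mem h
    omega
  have hmt : x.mate ∈ t := by
    rw [hu] at hm
    simpa [hmu, mate_ne x] using hm
  obtain ⟨v, w, ht⟩ := List.append_of_mem hmt
  exact ⟨u, v, w, by rw [hu, ht]; simp⟩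

theorem exists_fresh (D : LongDiagram) : ∃ n, ∀ t ∈ D.word, t.chord < n :=
  ⟨(D.word.toFinset.sup chord) + 1, fun _ ht =>
    Nat.lt_succ_of_le (Finset.le_sup (f := chord) (List.mem_toFinset.2 ht))⟩

/-- Twisting a crossing. -/
theorem exists_twist {D : LongDiagram} {u v w : List GaussLetter} {x y z : GaussLetter}
    (hD : D.word = u ++ [x] ++ v ++ [x.mate] ++ w) (hy : ∀ t ∈ D.word, t.chord ≠ y.chord)
    (hz : ∀ t ∈ D.word, t.chord ≠ z.chord) (hyz : y.chord ≠ z.chord) :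
    ∃ D' : LongDiagram,
      D'.word = u ++ [x, y, z] ++ v ++ [x.mate, y.mate, z.mate] ++ w := by
  have hp : (u ++ [x, y, z] ++ v ++ [x.mate, y.mate, z.mate] ++ w).Perm
      ([y, z, y.mate, z.mate] ++ D.word) := by
    rw [hD, List.perm_iff_count]
    intro a
    simp only [List.count_append, List.count_cons, List.count_nil]
    omega
  refine ⟨⟨_, ?_, ?_⟩, rfl⟩
  · rw [(hp.map _).nodup_iff, List.map_append, List.nodup_append]
    refine ⟨?_, D.nodup, ?_⟩
    · simp [hyz, Ne.symm hyz]
    · intro a ha b hb hab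
      obtain ⟨t, ht, rfl⟩ := List.mem_map.1 hb
      have h1 := hy t ht
      have h2 := hz t ht
      simp only [List.map_cons, List.map_nil, List.mem_cons, List.not_mem_nil, or_false] at ha
      subst hab
      simp only [Prod.mk.injEq, mate_chord, h1, h2, false_and, or_self] at ha
  · intro t ht
    rw [hp.mem_iff] at ht ⊢
    simp only [List.mem_append, List.mem_cons, List.not_mem_nil, or_false, mate_eq_iff,
      mate_mate, mate_mem_iff] at ht ⊢
    tauto

/-! ### Tame diagrams and the adjustment of their level sums. -/

/-- The crossing `P` of type `a` meets the crossings in `T`, which are pairwise disjoint, and `T`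
contains all other crossings of type `a`; the surface of the diagram is a torus. -/
structure Tame (D : LongDiagram) (a : Fin 2) (N : ℕ) (P : GaussLetter) (T : Finset GaussLetter)
    (lev : GaussLetter → ℕ) : Prop where
  torus : 2 * D.curve.numFaces = D.word.length
  P_mem : P ∈ D.firsts a
  P_notMem : P ∉ T
  first : ∀ t ∈ T, ∃ e, t ∈ D.firsts e
  subset : D.firsts a ⊆ insert P T
  lev_mem : ∀ t ∈ T, lev t ∈ Finset.Icc 1 N
  interα_eq_zero : ∀ s ∈ T, ∀ t ∈ T, D.interα s t = 0
  interα_P : ∀ t ∈ T, D.interα P t = lev t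
  index_eq_zero : ∀ t ∈ T, D.index t = 0
  index_P : D.index P = N
  lev_surj : ∀ k ∈ Finset.Icc 1 N, ∃ t ∈ T, lev t = k

/-- The signed number of crossings of type `a` at each level. -/
noncomputable def levelSum (D : LongDiagram) (a : Fin 2) (P : GaussLetter)
    (lev : GaussLetter → ℕ) : ℕ →₀ ℤ :=
  ∑ t ∈ (D.firsts a).erase P, Finsupp.single (lev t) (t.sign : ℤ)

/-- There is a tame diagram with given signed numbers of crossings at each level. -/
def Realizable (a : Fin 2) (N : ℕ) (P : GaussLetter) (m : ℕ →₀ ℤ) : Prop :=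
  ∃ (D : LongDiagram) (T : Finset GaussLetter) (lev : GaussLetter → ℕ),
    D.Tame a N P T lev ∧ D.levelSum a P lev = m

/-- The new crossings `y`, `z` are homologous to `x`, because consecutive crossings among `x`, `y`,
`z` bound bigons. All intersection data of `D'` thus reduce to those of `D`. -/
theorem Tame.twist {D D' : LongDiagram} {a : Fin 2} {N : ℕ} {P : GaussLetter}
    {T : Finset GaussLetter} {lev : GaussLetter → ℕ} (h : D.Tame a N P T lev)
    {u v w : List GaussLetter} {x y z : GaussLetter} (hx : x ∈ T)
    (hD : D.word = u ++ [x] ++ v ++ [x.mate] ++ w)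
    (hD' : D'.word = u ++ [x, y, z] ++ v ++ [x.mate, y.mate, z.mate] ++ w)
    (hyD : y ∉ D.word) (hzD : z ∉ D.word)
    (hy : y.isRight = !x.isRight) (hz : z.isRight = x.isRight)
    (ho : z.isOver = !y.isOver) :
    ∃ (T' : Finset GaussLetter) (lev' : GaussLetter → ℕ), D'.Tame a N P T' lev' ∧
      D'.levelSum a P lev' = D.levelSum a P lev +
        Finsupp.single (lev x) ((if y.isOver = true ↔ a = 0 then y else z).sign : ℤ) := by
  -- The word is read in two ways: with `y`, `z` as a bigon inserted into `D`, and with `x`, `y` as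
  -- a bigon.
  have e1 : D'.word = (u ++ [x]) ++ [y, z] ++ (v ++ [x.mate]) ++ [y.mate, z.mate] ++ w := by
    rw [hD']; simp
  have e2 : D'.word = u ++ [x, y] ++ ([z] ++ v) ++ [x.mate, y.mate] ++ ([z.mate] ++ w) := by
    rw [hD']; simp
  have e0 : D.word = (u ++ [x]) ++ (v ++ [x.mate]) ++ w := by rw [hD]; simp
  have hw1 := e1 ▸ D'.word_nodup
  have hw2 := e2 ▸ D'.word_nodup
  have hyz : y.isRight = !z.isRight := by rw [hy, hz]
  have hxy : x.isRight = !y.isRight := by rw [hy]; simp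
  have hm : ∀ p ∈ (u ++ [x]) ++ (v ++ [x.mate]) ++ w,
      p.mate ∈ (u ++ [x]) ++ (v ++ [x.mate]) ++ w := e0 ▸ D.paired
  have hTD : ∀ t ∈ T, t ∈ D.word := fun t ht => by
    obtain ⟨e, he⟩ := h.first t ht; exact mem_word_of_mem_firsts he
  have hPD := mem_word_of_mem_firsts h.P_mem
  have hold : ∀ c ∈ D.word, ∀ k : GaussLetter → ℤ, (∀ q, k q.mate = -k q) → k y = 0 → k z = 0 →
      ∀ b, form D'.word 0 (chi c) b k = form D.word 0 (chi c) b k := fun c hc k hk hky hkz b => by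
    rw [e1, e0]
    exact form_insert_two hw1 (Or.inl rfl) hyz hm (chi_mate_right c) hk
      (chi_eq_zero_of_mem hc hyD) (chi_eq_zero_of_mem hc hzD) hky hkz 0 b
  have hg : ∀ c ∈ D.word, ∀ d ∈ D.word, D'.interα c d = D.interα c d := fun c hc d hd =>
    hold c hc _ (chi_mate_right d) (chi_eq_zero_of_mem hd hyD) (chi_eq_zero_of_mem hd hzD) 0
  have hn : ∀ c ∈ D.word, D'.index c = D.index c := fun c hc => hold c hc _ (by simp) rfl rfl 1
  have hbz : ∀ k : GaussLetter → ℤ, (∀ q, k q.mate = -k q) →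
      ∀ b, form D'.word 0 (chi z) b k = form D'.word 0 (chi y) b k := fun k hk b => by
    rw [e1]; exact (form_bigon hw1 (Or.inl rfl) hyz hk b).symm
  have hby : ∀ k : GaussLetter → ℤ, (∀ q, k q.mate = -k q) →
      ∀ b, form D'.word 0 (chi y) b k = form D'.word 0 (chi x) b k := fun k hk b => by
    rw [e2]; exact (form_bigon hw2 (Or.inl rfl) hxy hk b).symm
  -- the old crossing homologous to a given one
  let rep : GaussLetter → GaussLetter := fun t => if t = y ∨ t = z then x else t
  have hrep : ∀ t ∈ D.word, rep t = t := fun t ht =>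
    if_neg (by rintro (rfl | rfl) <;> contradiction)
  have hrepy : rep y = x := if_pos (Or.inl rfl)
  have hrepz : rep z = x := if_pos (Or.inr rfl)
  have hform : ∀ t, ∀ k : GaussLetter → ℤ, (∀ q, k q.mate = -k q) →
      ∀ b, form D'.word 0 (chi t) b k = form D'.word 0 (chi (rep t)) b k := fun t k hk b => by
    by_cases ht : t = y ∨ t = z
    · rw [show rep t = x from if_pos ht]
      rcases ht with rfl | rfl
      · exact hby k hk b
      · rw [hbz k hk b, hby k hk b]
    · rw [show rep t = t from if_neg ht]
  have hgl : ∀ s t, D'.interα s t = D'.interα (rep s) t := fun s t =>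
    hform s _ (chi_mate_right t) 0
  have hgr : ∀ s t, D'.interα s t = D'.interα s (rep t) := fun s t => by
    rw [interα_antisymm, hgl t s, ← interα_antisymm]
  have hnr : ∀ s, D'.index s = D'.index (rep s) := fun s => hform s _ (by simp) 1
  have hT' : ∀ t ∈ insert y (insert z T), rep t ∈ T := fun t ht => by
    simp only [Finset.mem_insert] at ht
    rcases ht with rfl | rfl | ht
    · rwa [hrepy]
    · rwa [hrepz]
    · rwa [hrep t (hTD t ht)]
  have hf := fun e t => firsts_two e0 e1 (Or.inl rfl) e t
  refine ⟨insert y (insert z T), fun t => lev (rep t), ⟨?_, ?_, ?_, ?_, ?_, ?_, ?_, ?_, ?_, ?_, ?_⟩,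
    ?_⟩
  · have h1 := h.torus
    have h2 : D'.word.length = D.word.length + 4 := by rw [hD, hD']; simp; omega
    rw [numFaces_twist hD hD' hy hz]
    omega
  · exact (hf a P).2 (Or.inr (Or.inr h.P_mem))
  · simp only [Finset.mem_insert, not_or]
    exact ⟨fun e => hyD (e ▸ hPD), fun e => hzD (e ▸ hPD), h.P_notMem⟩
  · have he : ∀ b : Bool, ∃ e : Fin 2, (b = true ↔ e = 0) := fun b => by
      cases b
      · exact ⟨1, by simp⟩
      · exact ⟨0, by simp⟩
    intro t ht
    simp only [Finset.mem_insert] at ht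
    rcases ht with rfl | rfl | ht
    · obtain ⟨e, he⟩ := he t.isOver
      exact ⟨e, (hf e t).2 (Or.inl ⟨rfl, he⟩)⟩
    · obtain ⟨e, he⟩ := he t.isOver
      exact ⟨e, (hf e t).2 (Or.inr (Or.inl ⟨rfl, he⟩))⟩
    · obtain ⟨e, he⟩ := h.first t ht
      exact ⟨e, (hf e t).2 (Or.inr (Or.inr he))⟩
  · intro t ht
    rcases (hf a t).1 ht with ⟨rfl, -⟩ | ⟨rfl, -⟩ | ht
    · simp
    · simp
    · have := h.subset ht
      simp only [Finset.mem_insert] at this ⊢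
      tauto
  · exact fun t ht => h.lev_mem _ (hT' t ht)
  · intro s hs t ht
    rw [hgl, hgr, hg _ (hTD _ (hT' s hs)) _ (hTD _ (hT' t ht))]
    exact h.interα_eq_zero _ (hT' s hs) _ (hT' t ht)
  · intro t ht
    rw [hgr, hg _ hPD _ (hTD _ (hT' t ht))]
    exact h.interα_P _ (hT' t ht)
  · intro t ht
    rw [hnr, hn _ (hTD _ (hT' t ht))]
    exact h.index_eq_zero _ (hT' t ht)
  · rw [hn _ hPD]; exact h.index_P
  · intro k hk
    obtain ⟨t, ht, rfl⟩ := h.lev_surj k hk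
    exact ⟨t, by simp [ht], by rw [hrep t (hTD t ht)]⟩
  · have hyP : y ≠ P := fun e => hyD (e ▸ hPD)
    have hzP : z ≠ P := fun e => hzD (e ▸ hPD)
    -- Since `y` and `z` are first passages of which one is over and the other under, exactly one of
    -- them has type `a`.
    obtain ⟨c, hc, hcrep, hcP, hcD, hceq⟩ : ∃ c, (if y.isOver = true ↔ a = 0 then y else z) = c ∧
        rep c = x ∧ c ≠ P ∧ c ∉ D.word ∧ D'.firsts a = insert c (D.firsts a) := by
      by_cases hya : y.isOver = true ↔ a = 0
      · refine ⟨y, if_pos hya, hrepy, hyP, hyD, ?_⟩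
        have hza : ¬(z.isOver = true ↔ a = 0) := by rw [ho, ← hya]; cases y.isOver <;> simp
        ext t
        rw [hf a t, Finset.mem_insert]
        tauto
      · refine ⟨z, if_neg hya, hrepz, hzP, hzD, ?_⟩
        have hza : z.isOver = true ↔ a = 0 := by
          rw [ho]; cases hyo : y.isOver <;> simp [hyo] at hya ⊢ <;> exact hya
        ext t
        rw [hf a t, Finset.mem_insert]
        tauto
    have hcf : c ∉ (D.firsts a).erase P := fun hm =>
      hcD (mem_word_of_mem_firsts (Finset.mem_of_mem_erase hm))
    rw [hc, levelSum, hceq, Finset.erase_insert_of_ne hcP, Finset.sum_insert hcf, hcrep, levelSum,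
      add_comm]
    congr 1
    refine Finset.sum_congr rfl fun t ht => ?_
    rw [hrep t (mem_word_of_mem_firsts (Finset.mem_of_mem_erase ht))]

theorem Realizable.add_single {a : Fin 2} {N : ℕ} {P : GaussLetter} {m : ℕ →₀ ℤ}
    (h : Realizable a N P m) {k : ℕ} (hk : k ∈ Finset.Icc 1 N) (s : ℤˣ) :
    Realizable a N P (m + Finsupp.single k (s : ℤ)) := by
  obtain ⟨D, T, lev, hT, rfl⟩ := h
  obtain ⟨x, hx, rfl⟩ := hT.lev_surj k hk
  obtain ⟨e, he⟩ := hT.first x hx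
  rw [mem_firsts] at he
  obtain ⟨u, v, w, hD⟩ := exists_word_eq he.1 he.2.2
  obtain ⟨n, hn⟩ := D.exists_fresh
  -- Both new crossings have the same sign, which is positive iff `oy = !x.isRight`. Choosing
  -- whether `y` passes over therefore realizes either sign.
  obtain ⟨oy, hoy⟩ : ∃ oy : Bool,
      (if oy = true ↔ a = 0 then ofRight n oy (!x.isRight) else
        ofRight (n + 1) (!oy) x.isRight).sign = s := by
    have hn : (1 : ℤˣ) ≠ -1 := by decide
    by_cases ha : a = 0 <;> rcases Int.units_eq_one_or s with rfl | rfl <;>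
    cases x.isRight
    · exact ⟨true, by simp [ha, ofRight_sign]⟩
    · exact ⟨false, by simp [ha, ofRight_sign]⟩
    · exact ⟨false, by simp [ha, ofRight_sign]⟩
    · exact ⟨true, by simp [ha, ofRight_sign]⟩
    · exact ⟨true, by simp [ha, ofRight_sign]⟩
    · exact ⟨false, by simp [ha, ofRight_sign]⟩
    · exact ⟨false, by simp [ha, ofRight_sign]⟩
    · exact ⟨true, by simp [ha, ofRight_sign]⟩
  have hy : ∀ t ∈ D.word, t.chord ≠ (ofRight n oy (!x.isRight)).chord := fun t ht => by
    have := hn t ht; simp; omega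
  have hz : ∀ t ∈ D.word, t.chord ≠ (ofRight (n + 1) (!oy) x.isRight).chord := fun t ht => by
    have := hn t ht; simp; omega
  obtain ⟨D', hD'⟩ := exists_twist hD hy hz (by simp)
  obtain ⟨T', lev', hT', hsum⟩ := hT.twist hx hD hD' (fun h => hy _ h rfl) (fun h => hz _ h rfl)
    (by simp) (by simp) (by simp)
  refine ⟨D', T', lev', hT', ?_⟩
  rw [hsum, ← hoy, ofRight_isOver]

theorem Realizable.add_single_int {a : Fin 2} {N : ℕ} {P : GaussLetter} {m : ℕ →₀ ℤ}
    (h : Realizable a N P m) {k : ℕ} (hk : k ∈ Finset.Icc 1 N) (c : ℤ) :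
    Realizable a N P (m + Finsupp.single k c) := by
  induction c with
  | zero => simpa using h
  | succ i ih => simpa [add_assoc, ← Finsupp.single_add] using ih.add_single hk 1
  | pred i ih =>
    have h1 := ih.add_single hk (-1)
    rw [add_assoc, ← Finsupp.single_add] at h1
    exact h1

theorem Realizable.of_zero {a : Fin 2} {N : ℕ} {P : GaussLetter} (h : Realizable a N P 0)
    {m : ℕ →₀ ℤ} (hm : m.support ⊆ Finset.Icc 1 N) : Realizable a N P m := by
  have : ∀ S ⊆ Finset.Icc 1 N, Realizable a N P (∑ k ∈ S, Finsupp.single k (m k)) := by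
    intro S
    induction S using Finset.induction_on with
    | empty => intro _; simpa using h
    | insert k S hk ih =>
      intro hS
      rw [Finset.sum_insert hk, add_comm]
      exact (ih fun i hi => hS (Finset.mem_insert_of_mem hi)).add_single_int
        (hS (Finset.mem_insert_self _ _)) _
  have h2 := this m.support hm
  rwa [show ∑ k ∈ m.support, Finsupp.single k (m k) = m from m.sum_single] at h2

end LongDiagram

/-! ### The model diagram: its word and its faces. -/

namespace TorusModel

/-- The involution on the indices `0, …, 2N + 3` of passages that pairs the passages through the
same crossing. -/
def partner (N i : ℕ) : ℕ :=
  if i < N ∨ (N + 2 ≤ i ∧ i ≤ 2 * N + 1) then 2 * N + 1 - i else 3 * N + 3 - i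

/-- Whether the passage at an index is the right one of the two through its crossing. -/
def right (N i : ℕ) : Bool := decide (i = N ∨ (N + 2 ≤ i ∧ i ≤ 2 * N + 2))

/-- The face of the surface next to a dart. -/
def face (N n : ℕ) (o : Bool) : ℕ :=
  if o = true then
    if n = 0 then 0 else if n ≤ N + 1 then n else if n = N + 2 then N
    else if n ≤ 2 * N + 1 then 2 * N + 2 - n else if n = 2 * N + 2 then 0
    else if n = 2 * N + 3 then N + 1 else 0
  else
    if n = 0 then 1 else if n ≤ N then n else if n = N + 1 then 1 else if n = N + 2 then 0
    else if n = N + 3 then 1 else if n ≤ 2 * N + 2 then 2 * N + 4 - n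
    else if n = 2 * N + 3 then 1 else N

theorem partner_right_cases {N i : ℕ} (hi : i < 2 * N + 4) :
    (i < N ∧ partner N i = 2 * N + 1 - i ∧ right N i = false) ∨
    (i = N ∧ partner N i = 2 * N + 3 ∧ right N i = true) ∨
    (i = N + 1 ∧ partner N i = 2 * N + 2 ∧ right N i = false) ∨
    ((N + 2 ≤ i ∧ i ≤ 2 * N + 1) ∧ partner N i = 2 * N + 1 - i ∧ right N i = true) ∨
    (i = 2 * N + 2 ∧ partner N i = N + 1 ∧ right N i = true) ∨
    (i = 2 * N + 3 ∧ partner N i = N ∧ right N i = false) := by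
  unfold partner right
  simp only [decide_eq_true_eq, decide_eq_false_iff_not]
  obtain h | h | h | h | h | h : i < N ∨ i = N ∨ i = N + 1 ∨ (N + 2 ≤ i ∧ i ≤ 2 * N + 1) ∨
    i = 2 * N + 2 ∨ i = 2 * N + 3 := by omega
  · exact Or.inl ⟨h, if_pos (Or.inl h), by omega⟩
  · exact Or.inr (Or.inl ⟨h, (if_neg (by omega)).trans (by omega), Or.inl h⟩)
  · exact Or.inr (Or.inr (Or.inl ⟨h, (if_neg (by omega)).trans (by omega), by omega⟩))
  · exact Or.inr (Or.inr (Or.inr (Or.inl ⟨h, if_pos (Or.inr h), by omega⟩)))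
  · exact Or.inr (Or.inr (Or.inr (Or.inr (Or.inl
      ⟨h, (if_neg (by omega)).trans (by omega), by omega⟩))))
  · exact Or.inr (Or.inr (Or.inr (Or.inr (Or.inr
      ⟨h, (if_neg (by omega)).trans (by omega), by omega⟩))))

theorem face_true_cases (N n : ℕ) :
    (n = 0 ∧ face N n true = 0) ∨ ((1 ≤ n ∧ n ≤ N + 1) ∧ face N n true = n) ∨
    (n = N + 2 ∧ face N n true = N) ∨
    ((N + 3 ≤ n ∧ n ≤ 2 * N + 1) ∧ face N n true = 2 * N + 2 - n) ∨
    (2 * N + 1 < n ∧ n ≠ 2 * N + 3 ∧ N + 2 < n ∧ face N n true = 0) ∨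
    (N + 2 < n ∧ n = 2 * N + 3 ∧ face N n true = N + 1) := by
  unfold face
  rw [if_pos rfl]
  split_ifs
  · exact Or.inl ⟨by omega, rfl⟩
  · exact Or.inr (Or.inl ⟨by omega, rfl⟩)
  · exact Or.inr (Or.inr (Or.inl ⟨by omega, rfl⟩))
  · exact Or.inr (Or.inr (Or.inr (Or.inl ⟨by omega, rfl⟩)))
  · exact Or.inr (Or.inr (Or.inr (Or.inr (Or.inl ⟨by omega, by omega, by omega, rfl⟩))))
  · exact Or.inr (Or.inr (Or.inr (Or.inr (Or.inr (⟨by omega, by omega, rfl⟩)))))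
  · exact Or.inr (Or.inr (Or.inr (Or.inr (Or.inl ⟨by omega, by omega, by omega, rfl⟩))))

theorem face_false_cases (N n : ℕ) :
    (n = 0 ∧ face N n false = 1) ∨ ((1 ≤ n ∧ n ≤ N) ∧ face N n false = n) ∨
    (n = N + 1 ∧ face N n false = 1) ∨ (n = N + 2 ∧ face N n false = 0) ∨
    (n = N + 3 ∧ face N n false = 1) ∨
    ((N + 4 ≤ n ∧ n ≤ 2 * N + 2) ∧ face N n false = 2 * N + 4 - n) ∨
    (N + 3 < n ∧ n = 2 * N + 3 ∧ face N n false = 1) ∨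
    (2 * N + 2 < n ∧ n ≠ 2 * N + 3 ∧ N + 3 < n ∧ face N n false = N) := by
  unfold face
  rw [if_neg Bool.false_ne_true]
  split_ifs
  · exact Or.inl ⟨by omega, rfl⟩
  · exact Or.inr (Or.inl ⟨by omega, rfl⟩)
  · exact Or.inr (Or.inr (Or.inl ⟨by omega, rfl⟩))
  · exact Or.inr (Or.inr (Or.inr (Or.inl ⟨by omega, rfl⟩)))
  · exact Or.inr (Or.inr (Or.inr (Or.inr (Or.inl ⟨by omega, rfl⟩))))
  · exact Or.inr (Or.inr (Or.inr (Or.inr (Or.inr (Or.inl ⟨by omega, rfl⟩)))))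
  · exact Or.inr (Or.inr (Or.inr (Or.inr (Or.inr (Or.inr (Or.inl ⟨by omega, by omega, rfl⟩))))))
  · exact Or.inr (Or.inr (Or.inr (Or.inr (Or.inr (Or.inr (Or.inr (⟨by omega, by omega, by omega, rfl⟩)))))))

/-- The label `face` is constant along faces. This is the case of outgoing darts other than the one
leading back to the basepoint. -/
theorem face_invariant_true {N i : ℕ} (hN : 2 ≤ N) (hi : i < 2 * N + 4) :
    face N (partner N i + 1) (!right N i) = face N i true := by
  have h1 := face_true_cases N i
  have h2 := face_true_cases N (partner N i + 1)
  have h3 := face_false_cases N (partner N i + 1)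
  obtain ⟨h, hp, hr⟩ | ⟨h, hp, hr⟩ | ⟨h, hp, hr⟩ | ⟨h, hp, hr⟩ | ⟨h, hp, hr⟩ | ⟨h, hp, hr⟩ :=
    partner_right_cases hi
  all_goals
    rw [hr]
    simp only [Bool.not_true, Bool.not_false]
    first | (clear h2; omega) | (clear h3; omega)

theorem face_invariant_false {N i : ℕ} (hN : 2 ≤ N) (hi : i < 2 * N + 4) :
    face N (partner N i + 1) (right N i) =
      face N (if i = 2 * N + 3 then 0 else i + 2) false := by
  have h1 := face_false_cases N (if i = 2 * N + 3 then 0 else i + 2)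
  have h2 := face_true_cases N (partner N i + 1)
  have h3 := face_false_cases N (partner N i + 1)
  obtain ⟨n, hn⟩ : ∃ n, n = if i = 2 * N + 3 then 0 else i + 2 := ⟨_, rfl⟩
  rw [← hn] at h1 ⊢
  obtain ⟨h, hp, hr⟩ | ⟨h, hp, hr⟩ | ⟨h, hp, hr⟩ | ⟨h, hp, hr⟩ | ⟨h, hp, hr⟩ | ⟨h, hp, hr⟩ :=
    partner_right_cases hi
  all_goals
    rw [hr]
    split_ifs at hn
    all_goals first | (clear h2; omega) | (clear h3; omega)

/-- The dart at the point with a given number. -/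
def dart (N n : ℕ) (o : Bool) : Fin (2 * N + 5) × Bool := (Fin.ofNat _ n, o)

theorem dart_val {N n : ℕ} (hn : n < 2 * N + 5) (o : Bool) : (dart N n o).1.val = n :=
  Nat.mod_eq_of_lt hn

theorem exists_eq_dart {N : ℕ} (x : Fin (2 * N + 5) × Bool) :
    ∃ n, n < 2 * N + 5 ∧ ∃ o, x = dart N n o :=
  ⟨_, x.1.2, x.2, Prod.ext (Fin.ext (dart_val x.1.2 x.2).symm) rfl⟩

/-- A permutation that acts on the darts like the face permutation of the model. -/
structure IsFacePerm (N : ℕ) (φ : Equiv.Perm (Fin (2 * N + 5) × Bool)) : Prop where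
  true_eq : ∀ i, i < 2 * N + 4 → φ (dart N i true) = dart N (partner N i + 1) (!right N i)
  true_last : φ (dart N (2 * N + 4) true) = dart N 0 true
  -- The edge leaving the passage at index `i` starts at point `i + 1` and enters point `i + 2`;
  -- after the last passage it enters the basepoint `0`.
  false_eq : ∀ i, i < 2 * N + 4 → φ (dart N (if i = 2 * N + 3 then 0 else i + 2) false) =
    dart N (partner N i + 1) (right N i)
  false_one : φ (dart N 1 false) = dart N 0 false

theorem isFacePerm {N : ℕ} (C : ClosedCurve (Fin (2 * N + 5)))
    (hs : ∀ p, (C.succ p).val = if p.val = 2 * N + 4 then 0 else p.val + 1)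
    (hm0 : C.mate 0 = 0) (hr0 : C.right 0 = false)
    (hm : ∀ p i, p.val = i + 1 → (C.mate p).val = partner N i + 1)
    (hr : ∀ p i, p.val = i + 1 → C.right p = right N i) :
    IsFacePerm N (C.rot * C.opp) := by
  have hv : ∀ n, n < 2 * N + 5 → (Fin.ofNat (2 * N + 5) n).val = n := fun n hn =>
    Nat.mod_eq_of_lt hn
  have hd : ∀ x : Fin (2 * N + 5) × Bool, ∀ n o, x.1.val = n → x.2 = o → x = dart N n o := by
    rintro ⟨x, o⟩ _ _ rfl rfl
    exact Prod.ext (Fin.ext (hv _ x.2).symm) rfl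
  refine ⟨fun i hi => ?_, ?_, fun i hi => ?_, ?_⟩
  · have h1 : (C.succ (Fin.ofNat _ i)).val = i + 1 := by
      rw [hs, hv i (by omega), if_neg (by omega)]
    rw [dart, C.face_true]
    refine hd _ _ _ (hm _ _ h1) ?_
    rw [ClosedCurve.next, hr _ _ h1]
    cases right N i <;> rfl
  · have h1 : C.succ (Fin.ofNat _ (2 * N + 4)) = 0 := Fin.ext (by
      rw [hs, hv _ (by omega), if_pos rfl]; rfl)
    rw [dart, C.face_true, h1]
    exact hd _ _ _ (by rw [ClosedCurve.next, hm0]; rfl) (by rw [ClosedCurve.next, hr0]; rfl)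
  · have h0 : (Fin.ofNat (2 * N + 5) (i + 1)).val = i + 1 := hv _ (by omega)
    have h1 : Fin.ofNat _ (if i = 2 * N + 3 then 0 else i + 2) =
        C.succ (Fin.ofNat _ (i + 1)) := Fin.ext (by
      rw [hs, h0, hv _ (by split_ifs <;> omega)]; split_ifs <;> omega)
    rw [dart, h1, C.face_succ_false]
    refine hd _ _ _ (hm _ _ h0) ?_
    rw [ClosedCurve.next, hr _ _ h0]
    cases right N i <;> rfl
  · have h1 : Fin.ofNat _ 1 = C.succ 0 := Fin.ext (by
      rw [hs, hv _ (by omega), if_neg (by simp)]; rfl)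
    rw [dart, h1, C.face_succ_false]
    exact hd _ _ _ (by rw [ClosedCurve.next, hm0]; rfl) (by rw [ClosedCurve.next, hr0]; rfl)

section
open Equiv.Perm
variable {N : ℕ} {φ : Equiv.Perm (Fin (2 * N + 5) × Bool)}

theorem IsFacePerm.face_apply (h : IsFacePerm N φ) (hN : 2 ≤ N) (x : Fin (2 * N + 5) × Bool) :
    face N (φ x).1.val (φ x).2 = face N x.1.val x.2 := by
  have hp : ∀ i, i < 2 * N + 4 → partner N i + 1 < 2 * N + 5 := fun i hi => by
    have := partner_right_cases hi; omega
  obtain ⟨n, hn, o, rfl⟩ := exists_eq_dart x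
  rw [dart_val hn, show (dart N n o).2 = o from rfl]
  cases o
  · by_cases h1 : n = 1
    · subst h1
      rw [h.false_one, dart_val (by omega), show (dart N 0 false).2 = false from rfl]
      have h2 := face_false_cases N 0
      have h3 := face_false_cases N 1
      omega
    · obtain ⟨i, hi, rfl⟩ : ∃ i, i < 2 * N + 4 ∧ n = if i = 2 * N + 3 then 0 else i + 2 :=
        ⟨if n = 0 then 2 * N + 3 else n - 2, by split_ifs <;> omega, by split_ifs <;> omega⟩
      rw [h.false_eq i hi, dart_val (hp i hi)]
      exact face_invariant_false hN hi
  · by_cases h1 : n = 2 * N + 4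
    · subst h1
      rw [h.true_last, dart_val (by omega), show (dart N 0 true).2 = true from rfl]
      have h2 := face_true_cases N 0
      have h3 := face_true_cases N (2 * N + 4)
      omega
    · rw [h.true_eq n (by omega), dart_val (hp n (by omega))]
      exact face_invariant_true hN (by omega)

theorem IsFacePerm.step_true (h : IsFacePerm N φ) (n n' : ℕ) (o : Bool) (hn : n < 2 * N + 4)
    (h1 : partner N n + 1 = n') (h2 : (!right N n) = o) :
    φ.SameCycle (dart N n true) (dart N n' o) := by
  subst h1 h2
  rw [← h.true_eq n hn]
  exact sameCycle_apply_right.2 (SameCycle.refl _ _)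

theorem IsFacePerm.step_false (h : IsFacePerm N φ) (n n' : ℕ) (o : Bool) (i : ℕ)
    (hi : i < 2 * N + 4) (hn : n = if i = 2 * N + 3 then 0 else i + 2)
    (h1 : partner N i + 1 = n') (h2 : right N i = o) :
    φ.SameCycle (dart N n false) (dart N n' o) := by
  subst hn h1 h2
  rw [← h.false_eq i hi]
  exact sameCycle_apply_right.2 (SameCycle.refl _ _)

theorem IsFacePerm.sameCycle_face (h : IsFacePerm N φ) (hN : 2 ≤ N) {n : ℕ}
    (hn : n < 2 * N + 5) (o : Bool) :
    φ.SameCycle (dart N n o) (dart N (face N n o) true) := by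
  -- The families `a1` to `a4` run along the strip between the nested crossings; `b1` to `b9` are
  -- the steps near the basepoint and the last two crossings. Together they join each dart to the
  -- outgoing dart whose number is its label.
  have a1 : ∀ k, 1 ≤ k → k < N →
      φ.SameCycle (dart N k true) (dart N (2 * N + 2 - k) true) := fun k h1 h2 => by
    obtain h3 | h3 | h3 | h3 | h3 | h3 := partner_right_cases (N := N) (i := k) (by omega) <;>
    first | omega | exact h.step_true _ _ _ (by omega) (by omega) (by rw [h3.2.2]; rfl)
  have a2 : ∀ k, 1 ≤ k → k < N →
      φ.SameCycle (dart N (2 * N + 2 - k) true) (dart N k false) := fun k h1 h2 => by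
    obtain h3 | h3 | h3 | h3 | h3 | h3 :=
      partner_right_cases (N := N) (i := 2 * N + 2 - k) (by omega) <;>
    first | omega | exact h.step_true _ _ _ (by omega) (by omega) (by rw [h3.2.2]; rfl)
  have a3 : ∀ k, 2 ≤ k → k ≤ N + 1 →
      φ.SameCycle (dart N k false) (dart N (2 * N + 4 - k) false) := fun k h1 h2 => by
    have h4 : k - 2 ≠ 2 * N + 3 := by omega
    obtain h3 | h3 | h3 | h3 | h3 | h3 :=
      partner_right_cases (N := N) (i := k - 2) (by omega)
    all_goals try omega
    exact h.step_false _ _ _ (k - 2) (by omega) (by rw [if_neg h4]; omega) (by omega) h3.2.2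
  have a4 : ∀ k, 1 ≤ k → k ≤ N →
      φ.SameCycle (dart N (2 * N + 4 - k) false) (dart N k true) := fun k h1 h2 => by
    have h4 : 2 * N + 2 - k ≠ 2 * N + 3 := by omega
    obtain h3 | h3 | h3 | h3 | h3 | h3 :=
      partner_right_cases (N := N) (i := 2 * N + 2 - k) (by omega)
    all_goals try omega
    exact h.step_false _ _ _ (2 * N + 2 - k) (by omega) (by rw [if_neg h4]; omega) (by omega) h3.2.2
  have p0 : partner N 0 = 2 * N + 1 ∧ right N 0 = false := by
    obtain h3 | h3 | h3 | h3 | h3 | h3 := partner_right_cases (N := N) (i := 0) (by omega) <;>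
    first | (exfalso; omega) | exact ⟨by omega, h3.2.2⟩
  have p1 : partner N N = 2 * N + 3 ∧ right N N = true := by
    obtain h3 | h3 | h3 | h3 | h3 | h3 := partner_right_cases (N := N) (i := N) (by omega) <;>
    first | (exfalso; omega) | exact ⟨by omega, h3.2.2⟩
  have p2 : partner N (N + 1) = 2 * N + 2 ∧ right N (N + 1) = false := by
    obtain h3 | h3 | h3 | h3 | h3 | h3 := partner_right_cases (N := N) (i := N + 1) (by omega) <;>
    first | (exfalso; omega) | exact ⟨by omega, h3.2.2⟩
  have p3 : partner N (N + 2) = N - 1 ∧ right N (N + 2) = true := by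
    obtain h3 | h3 | h3 | h3 | h3 | h3 := partner_right_cases (N := N) (i := N + 2) (by omega) <;>
    first | (exfalso; omega) | exact ⟨by omega, h3.2.2⟩
  have p4 : partner N (2 * N + 2) = N + 1 ∧ right N (2 * N + 2) = true := by
    obtain h3 | h3 | h3 | h3 | h3 | h3 := partner_right_cases (N := N) (i := 2 * N + 2) (by omega) <;>
    first | (exfalso; omega) | exact ⟨by omega, h3.2.2⟩
  have p5 : partner N (2 * N + 3) = N ∧ right N (2 * N + 3) = false := by
    obtain h3 | h3 | h3 | h3 | h3 | h3 := partner_right_cases (N := N) (i := 2 * N + 3) (by omega) <;>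
    first | (exfalso; omega) | exact ⟨by omega, h3.2.2⟩
  have b1 := h.step_true 0 (2 * N + 2) true (by omega) (by omega) (by rw [p0.2]; rfl)
  have b2 := h.step_true (2 * N + 2) (N + 2) false (by omega) (by omega) (by rw [p4.2]; rfl)
  have b3 : φ.SameCycle (dart N (2 * N + 4) true) (dart N 0 true) := by
    rw [← h.true_last]; exact sameCycle_apply_right.2 (SameCycle.refl _ _)
  have b4 := h.step_false 0 (N + 1) false (2 * N + 3) (by omega) (by rw [if_pos rfl])
    (by omega) p5.2
  have b5 : φ.SameCycle (dart N 1 false) (dart N 0 false) := by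
    rw [← h.false_one]; exact sameCycle_apply_right.2 (SameCycle.refl _ _)
  have b6 := h.step_false (N + 3) (2 * N + 3) false (N + 1) (by omega)
    (by rw [if_neg (by omega)]) (by omega) p2.2
  have b7 := h.step_true N (2 * N + 4) false (by omega) (by omega) (by rw [p1.2]; rfl)
  have b8 := h.step_false (2 * N + 4) (N + 2) true (2 * N + 2) (by omega)
    (by rw [if_neg (by omega)]) (by omega) p4.2
  have b9 := h.step_true (2 * N + 3) (N + 1) true (by omega) (by omega) (by rw [p5.2]; rfl)
  have b10 := a4 1 le_rfl (by omega)
  have b11 := a3 (N + 1) (by omega) le_rfl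
  rw [show 2 * N + 4 - 1 = 2 * N + 3 by omega] at b10
  rw [show 2 * N + 4 - (N + 1) = N + 3 by omega] at b11
  have c0 := b11.trans (b6.trans b10)
  have c1 := b5.trans (b4.trans c0)
  cases o
  · obtain ⟨rfl, h1⟩ | ⟨h0, h1⟩ | ⟨rfl, h1⟩ | ⟨rfl, h1⟩ | ⟨rfl, h1⟩ | ⟨h0, h1⟩ | ⟨-, rfl, h1⟩ |
        ⟨h0, h2, -, h1⟩ := face_false_cases N n
    all_goals rw [h1]
    · exact b4.trans c0
    · by_cases h2 : n = 1
      · subst h2; exact c1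
      · exact (a3 n (by omega) (by omega)).trans (a4 n (by omega) (by omega))
    · exact c0
    · exact b2.symm.trans b1.symm
    · exact b6.trans b10
    · have := a4 (2 * N + 4 - n) (by omega) (by omega)
      rwa [show 2 * N + 4 - (2 * N + 4 - n) = n by omega] at this
    · exact b10
    · obtain rfl : n = 2 * N + 4 := by omega
      exact b7.symm
  · obtain ⟨rfl, h1⟩ | ⟨h0, h1⟩ | ⟨rfl, h1⟩ | ⟨h0, h1⟩ | ⟨h0, h2, -, h1⟩ | ⟨-, rfl, h1⟩ :=
      face_true_cases N n
    all_goals rw [h1]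
    · exact b8.symm.trans b7.symm
    · have := a1 (2 * N + 2 - n) (by omega) (by omega)
      rw [show 2 * N + 2 - (2 * N + 2 - n) = n by omega] at this
      exact this.symm
    · obtain rfl | rfl : n = 2 * N + 2 ∨ n = 2 * N + 4 := by omega
      · exact b1.symm
      · exact b3
    · exact b9

theorem IsFacePerm.numCycles_eq (h : IsFacePerm N φ) (hN : 2 ≤ N) : φ.numCycles = N + 2 := by
  have hlt : ∀ x : Fin (2 * N + 5) × Bool, face N x.1.val x.2 < N + 2 := by
    rintro ⟨⟨n, hn⟩, _ | _⟩
    · have := face_false_cases N n; simp only; omega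
    · have := face_true_cases N n; simp only; omega
  have hcard : Nat.card (Fin (N + 2)) = N + 2 := by simp
  rw [← hcard]
  refine Equiv.Perm.numCycles_eq (fun x => ⟨face N x.1.val x.2, hlt x⟩)
    (fun b => dart N b.val true) (fun x => Fin.ext (h.face_apply hN x)) (fun x => ?_) ?_
  · obtain ⟨n, hn, o, rfl⟩ := exists_eq_dart x
    change φ.SameCycle (dart N n o) (dart N (face N (dart N n o).1.val o) true)
    rw [dart_val hn]
    exact h.sameCycle_face hN hn o
  · rintro ⟨b, hb⟩
    refine Fin.ext ?_
    have h1 := face_true_cases N b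
    simp only [dart_val (show b < 2 * N + 5 by omega)]
    change face N b true = b
    omega

end

theorem numFaces_eq {N : ℕ} (hN : 2 ≤ N) (C : ClosedCurve (Fin (2 * N + 5)))
    (hs : ∀ p, (C.succ p).val = if p.val = 2 * N + 4 then 0 else p.val + 1)
    (hm0 : C.mate 0 = 0) (hr0 : C.right 0 = false)
    (hm : ∀ p i, p.val = i + 1 → (C.mate p).val = partner N i + 1)
    (hr : ∀ p i, p.val = i + 1 → C.right p = right N i) :
    C.numFaces = N + 2 :=
  (isFacePerm C hs hm0 hr0 hm hr).numCycles_eq hN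

end TorusModel

/-! ### The model diagram: its crossings and intersection numbers. -/

namespace TorusModel
open GaussLetter

theorem partner_lt {N i : ℕ} (hi : i < 2 * N + 4) : partner N i < 2 * N + 4 := by
  have := partner_right_cases hi
  omega

theorem partner_partner {N i : ℕ} (hi : i < 2 * N + 4) : partner N (partner N i) = i := by
  obtain h | h | h | h | h | h := partner_right_cases hi <;> rw [h.2.1] <;> unfold partner <;>
    split_ifs <;> omega

theorem right_partner {N i : ℕ} (hi : i < 2 * N + 4) : right N (partner N i) = !right N i := by
  obtain h | h | h | h | h | h := partner_right_cases hi <;> rw [h.2.2, h.2.1] <;>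
    simp [right] <;> omega

/-- Whether the passage at an index is an over-passage, if that at index `N` is one iff `o`. -/
def passOver (N : ℕ) (o : Bool) (i : ℕ) : Bool :=
  if (i ≤ N + 1 ∧ i ≠ N) ∨ i = 2 * N + 3 then !o else o

theorem passOver_partner {N i : ℕ} (o : Bool) (hi : i < 2 * N + 4) :
    passOver N o (partner N i) = !passOver N o i := by
  unfold passOver
  obtain h | h | h | h | h | h := partner_right_cases hi <;> rw [h.2.1] <;>
    first
      | rw [if_pos (by omega), if_neg (by omega)]
      | rw [if_neg (by omega), if_pos (by omega), Bool.not_not]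

/-- The passage at an index. -/
def letter (N : ℕ) (o : Bool) (i : ℕ) : GaussLetter :=
  ofRight (min i (partner N i)) (passOver N o i) (right N i)

theorem letter_mate {N i : ℕ} (o : Bool) (hi : i < 2 * N + 4) :
    (letter N o i).mate = letter N o (partner N i) := by
  rw [letter, ofRight_mate, letter, partner_partner hi, passOver_partner o hi, right_partner hi,
    min_comm]

theorem letter_inj {N i j : ℕ} {o : Bool} (hi : i < 2 * N + 4) (hj : j < 2 * N + 4)
    (hc : (letter N o i).chord = (letter N o j).chord)
    (ho : (letter N o i).isOver = (letter N o j).isOver) : i = j := by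
  have h1 := partner_partner hi
  have h2 := partner_partner hj
  have h : i = j ∨ i = partner N j := by
    simp only [letter, ofRight_chord] at hc
    rcases le_total i (partner N i) with h3 | h3 <;> rcases le_total j (partner N j) with h4 | h4
    · rw [min_eq_left h3, min_eq_left h4] at hc; exact Or.inl hc
    · rw [min_eq_left h3, min_eq_right h4] at hc; exact Or.inr hc
    · rw [min_eq_right h3, min_eq_left h4] at hc; exact Or.inr (by rw [← hc, h1])
    · rw [min_eq_right h3, min_eq_right h4] at hc; exact Or.inl (by rw [← h1, hc, h2])
  refine h.resolve_right fun h => ?_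
  subst h
  simp only [letter, ofRight_isOver, passOver_partner o hj] at ho
  cases h : passOver N o j <;> simp [h] at ho

/-- A diagram on the torus whose crossing at the index `N` meets `N` disjoint crossings. -/
def diagram (N : ℕ) (o : Bool) : LongDiagram where
  word := (List.range (2 * N + 4)).map (letter N o)
  nodup := by
    rw [List.map_map, List.nodup_map_iff_inj_on List.nodup_range]
    intro i hi j hj h
    rw [Function.comp_apply, Function.comp_apply, Prod.mk.injEq] at h
    exact letter_inj (List.mem_range.1 hi) (List.mem_range.1 hj) h.1 h.2
  paired x hx := by
    obtain ⟨i, hi, rfl⟩ := List.mem_map.1 hx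
    rw [List.mem_range] at hi
    rw [letter_mate o hi]
    exact List.mem_map.2 ⟨_, List.mem_range.2 (partner_lt hi), rfl⟩

variable {N : ℕ} {o : Bool}

theorem length_word : (diagram N o).word.length = 2 * N + 4 := by simp [diagram]

theorem getElem?_word {i : ℕ} (hi : i < 2 * N + 4) :
    (diagram N o).word[i]? = some (letter N o i) := by
  simp [diagram, hi]

theorem mem_word {x : GaussLetter} :
    x ∈ (diagram N o).word ↔ ∃ i, i < 2 * N + 4 ∧ letter N o i = x := by
  simp [diagram]

theorem pos_letter {i : ℕ} (hi : i < 2 * N + 4) : (diagram N o).pos (letter N o i) = i := by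
  have h := (diagram N o).pos_getElem i (by rw [length_word]; exact hi)
  have h1 : (diagram N o).word[i]'(by rw [length_word]; exact hi) = letter N o i := by
    simp [diagram]
  rwa [h1] at h

theorem numFaces_curve (hN : 2 ≤ N) : (diagram N o).curve.numFaces = N + 2 := by
  have hl : (diagram N o).word.length + 1 = 2 * N + 5 := by rw [length_word]
  have h0 : finCongr hl.symm 0 = 0 := Fin.ext rfl
  rw [← ((diagram N o).curve).numFaces_pullback (finCongr hl.symm)]
  refine numFaces_eq hN _ ?_ ?_ ?_ ?_ ?_
  · intro p
    have := (diagram N o).curve_succ_val (finCongr hl.symm p)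
    refine this.trans ?_
    rw [show (finCongr hl.symm p).val = p.val from rfl, length_word]
  · change (finCongr hl.symm).symm ((diagram N o).curve.mate (finCongr hl.symm 0)) = 0
    rw [h0, (diagram N o).curve_mate_zero, ← h0, Equiv.symm_apply_apply]
  · change (diagram N o).curve.right (finCongr hl.symm 0) = false
    rw [h0, (diagram N o).curve_right_zero]
  · intro p i hp
    have hi : i < 2 * N + 4 := by omega
    have hq : partner N i + 1 < (diagram N o).word.length + 1 := by
      have := partner_lt hi; omega
    exact congrArg Fin.val ((diagram N o).curve_mate (p := finCongr hl.symm p)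
      (q := ⟨partner N i + 1, hq⟩) hp rfl (getElem?_word hi)
      (by rw [letter_mate o hi]; exact getElem?_word (partner_lt hi)))
  · intro p i hp
    exact ((diagram N o).curve_right (p := finCongr hl.symm p) hp
      (getElem?_word (by omega))).trans (ofRight_isRight _ _ _)

/-- `partner` maps the indices below `N + 2` to those from `N + 2` on, so the former are the first
passages. -/
theorem mem_firsts {e : Fin 2} {x : GaussLetter} :
    x ∈ (diagram N o).firsts e ↔
      ∃ i, i < N + 2 ∧ (passOver N o i = true ↔ e = 0) ∧ letter N o i = x := by
  rw [LongDiagram.mem_firsts, mem_word]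
  constructor
  · rintro ⟨⟨i, hi, rfl⟩, he, hp⟩
    rw [letter_mate o hi, pos_letter hi, pos_letter (partner_lt hi)] at hp
    refine ⟨i, ?_, he, rfl⟩
    have := partner_right_cases hi
    omega
  · rintro ⟨i, hi, he, rfl⟩
    have hi' : i < 2 * N + 4 := by omega
    refine ⟨⟨i, hi', rfl⟩, he, ?_⟩
    rw [letter_mate o hi', pos_letter hi', pos_letter (partner_lt hi')]
    have := partner_right_cases hi'
    omega

theorem mem_firsts_letter {i : ℕ} (hi : i < N + 2) :
    letter N o i ∈ (diagram N o).firsts (if passOver N o i = true then 0 else 1) := by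
  refine mem_firsts.2 ⟨i, hi, ?_, rfl⟩
  cases passOver N o i <;> simp

theorem partner_of_lt {k : ℕ} (hk : k < N) : partner N k = 2 * N + 1 - k := if_pos (Or.inl hk)

theorem partner_self : partner N N = 2 * N + 3 := by
  rw [partner, if_neg (by omega)]
  omega

theorem cycleα_letter {i : ℕ} (hi : i < N + 2) (e : ℕ) :
    (diagram N o).cycleα (letter N o i) e = if i < e ∧ e ≤ partner N i then 1 else 0 := by
  have hi' : i < 2 * N + 4 := by omega
  have h : i ≤ partner N i := by
    have := partner_right_cases hi'
    omega
  rw [LongDiagram.cycleα, letter_mate o hi', pos_letter hi', pos_letter (partner_lt hi'),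
    min_eq_left h, max_eq_right h]

theorem rightPos_letter {i : ℕ} (hi : i < 2 * N + 4) (ho : passOver N o i = true) :
    (diagram N o).rightPos (letter N o i) = if right N i = true then i else partner N i := by
  rw [LongDiagram.rightPos, letter_mate o hi, pos_letter hi, pos_letter (partner_lt hi), letter,
    ofRight_sign, ho]
  cases right N i <;> rfl

theorem leftPos_letter {i : ℕ} (hi : i < 2 * N + 4) (ho : passOver N o i = true) :
    (diagram N o).leftPos (letter N o i) = if right N i = true then partner N i else i := by
  rw [LongDiagram.leftPos, letter_mate o hi, pos_letter hi, pos_letter (partner_lt hi), letter,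
    ofRight_sign, ho]
  cases right N i <;> rfl

theorem inter_eq (x y : ℕ → ℤ) :
    (diagram N o).inter x y =
      (∑ i ∈ Finset.range N, (x (2 * N + 1 - i) * y i - x (i + 1) * y (2 * N + 2 - i))) +
        (x (2 * N + 2) * y (N + 1) - x (N + 2) * y (2 * N + 3)) +
        (x N * y (2 * N + 3) - x (2 * N + 4) * y (N + 1)) := by
  let c : ℕ → GaussLetter := fun i =>
    if passOver N o i = true then letter N o i else letter N o (partner N i)
  let r : ℕ → ℕ := fun i => if right N i = true then i else partner N i
  let l : ℕ → ℕ := fun i => if right N i = true then partner N i else i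
  have hc : ∀ i, i < 2 * N + 4 → ∃ j, j < 2 * N + 4 ∧ passOver N o j = true ∧ c i = letter N o j ∧
      (j = i ∨ j = partner N i) := fun i hi => by
    by_cases h : passOver N o i = true
    · exact ⟨i, hi, h, if_pos h, Or.inl rfl⟩
    · exact ⟨_, partner_lt hi, by simp [passOver_partner o hi, h], if_neg h, Or.inr rfl⟩
  have hrl : ∀ i, i < 2 * N + 4 → (diagram N o).rightPos (c i) = r i ∧
      (diagram N o).leftPos (c i) = l i := fun i hi => by
    obtain ⟨j, hj, ho, hcj, rfl | rfl⟩ := hc i hi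
    · rw [hcj]; exact ⟨rightPos_letter hj ho, leftPos_letter hj ho⟩
    · rw [hcj, rightPos_letter hj ho, leftPos_letter hj ho, partner_partner hi, right_partner hi]
      simp only [r, l]
      cases right N i <;> simp
  have hle : ∀ i, i < N + 2 → N + 2 ≤ partner N i := fun i hi => by
    have := partner_right_cases (N := N) (i := i) (by omega)
    omega
  have hsum : (diagram N o).inter x y =
      ∑ i ∈ Finset.range (N + 2), (x (r i) * y (l i) - x (l i + 1) * y (r i + 1)) := by
    refine (Finset.sum_nbij c ?_ ?_ ?_ ?_).symm
    · intro i hi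
      rw [Finset.mem_range] at hi
      obtain ⟨j, hj, ho, hcj, -⟩ := hc i (by omega)
      rw [hcj, LongDiagram.crossings, Finset.mem_filter, List.mem_toFinset]
      exact ⟨mem_word.2 ⟨j, hj, rfl⟩, ho⟩
    · intro i hi i' hi' h
      simp only [Finset.coe_range, Set.mem_Iio] at hi hi'
      obtain ⟨j, hj, ho, hcj, hij⟩ := hc i (by omega)
      obtain ⟨j', hj', ho', hcj', hij'⟩ := hc i' (by omega)
      rw [hcj, hcj'] at h
      have hjj := letter_inj hj hj' (congrArg chord h) (congrArg isOver h)
      have h1 := hle i hi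
      have h2 := hle i' hi'
      have h3 := partner_partner (N := N) (i := i) (by omega)
      have h4 := partner_partner (N := N) (i := i') (by omega)
      subst hjj
      rcases hij with h5 | h5 <;> rcases hij' with h6 | h6
      · omega
      · omega
      · omega
      · rw [← h3, ← h5, h6, h4]
    · intro t ht
      rw [Finset.mem_coe, LongDiagram.crossings, Finset.mem_filter, List.mem_toFinset] at ht
      obtain ⟨h1, h2⟩ := ht
      obtain ⟨j, hj, rfl⟩ := mem_word.1 h1
      have h2 : passOver N o j = true := h2
      by_cases h : j < N + 2
      · exact ⟨j, by simpa using h, if_pos h2⟩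
      · refine ⟨partner N j, ?_, ?_⟩
        · have := partner_right_cases hj
          simp only [Finset.coe_range, Set.mem_Iio]
          omega
        · simp only [c, passOver_partner o hj, h2, partner_partner hj]; rfl
    · intro i hi
      rw [Finset.mem_range] at hi
      rw [(hrl i (by omega)).1, (hrl i (by omega)).2]
  have p1 := partner_right_cases (N := N) (i := N) (by omega)
  have p2 := partner_right_cases (N := N) (i := N + 1) (by omega)
  have q1 : r N = N ∧ l N = 2 * N + 3 := by
    obtain h | h | h | h | h | h := p1 <;> first | (exfalso; omega) | simp [r, l, h.2]
  have q2 : r (N + 1) = 2 * N + 2 ∧ l (N + 1) = N + 1 := by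
    obtain h | h | h | h | h | h := p2 <;> first | (exfalso; omega) | simp [r, l, h.2]
  have q3 : ∀ i, i < N → r i = 2 * N + 1 - i ∧ l i = i := fun i hi => by
    obtain h | h | h | h | h | h := partner_right_cases (N := N) (i := i) (by omega) <;>
      first | (exfalso; omega) | simp [r, l, h.2]
  rw [hsum, Finset.sum_range_succ, Finset.sum_range_succ, q1.1, q1.2, q2.1, q2.2, add_right_comm]
  congr 2
  refine Finset.sum_congr rfl fun i hi => ?_
  have hi := Finset.mem_range.1 hi
  rw [(q3 i hi).1, (q3 i hi).2, show 2 * N + 1 - i + 1 = 2 * N + 2 - i by omega]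

/-- The intervals from `k` to `2 * N + 1 - k` are nested. At each nested crossing the two terms
coincide, and the remaining two crossings contribute nothing. -/
theorem interα_eq_zero {k l : ℕ} (hk : k < N) (hl : l < N) :
    (diagram N o).interα (letter N o k) (letter N o l) = 0 := by
  rw [← LongDiagram.inter_α_α _ (mem_firsts_letter (by omega)) (mem_firsts_letter (by omega)),
    inter_eq]
  simp only [cycleα_letter (show k < N + 2 by omega), cycleα_letter (show l < N + 2 by omega),
    partner_of_lt hk, partner_of_lt hl]
  rw [Finset.sum_eq_zero]
  · rw [if_neg (show ¬(l < 2 * N + 3 ∧ 2 * N + 3 ≤ 2 * N + 1 - l) by omega),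
      if_neg (show ¬(k < 2 * N + 2 ∧ 2 * N + 2 ≤ 2 * N + 1 - k) by omega),
      if_neg (show ¬(k < 2 * N + 4 ∧ 2 * N + 4 ≤ 2 * N + 1 - k) by omega)]
    simp
  · intro i hi
    rw [Finset.mem_range] at hi
    by_cases h1 : k ≤ i <;> by_cases h2 : l < i
    all_goals
      split_ifs
      all_goals first | (exfalso; omega) | rfl

/-- Each nested crossing `i` with `k < i < N` contributes one, and so does the crossing at index `N
+ 1`. -/
theorem interα_letter_self {k : ℕ} (hk : k < N) :
    (diagram N o).interα (letter N o N) (letter N o k) = (N - k : ℕ) := by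
  rw [← LongDiagram.inter_α_α _ (mem_firsts_letter (by omega)) (mem_firsts_letter (by omega)),
    inter_eq]
  simp only [cycleα_letter (show k < N + 2 by omega), cycleα_letter (show N < N + 2 by omega),
    partner_of_lt hk, partner_self]
  have h : ∀ i ∈ Finset.range N,
      ((if N < 2 * N + 1 - i ∧ 2 * N + 1 - i ≤ 2 * N + 3 then 1 else 0) *
          (if k < i ∧ i ≤ 2 * N + 1 - k then 1 else 0) -
        (if N < i + 1 ∧ i + 1 ≤ 2 * N + 3 then 1 else 0) *
          (if k < 2 * N + 2 - i ∧ 2 * N + 2 - i ≤ 2 * N + 1 - k then 1 else 0) : ℤ) =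
      if k < i then 1 else 0 := fun i hi => by
    rw [Finset.mem_range] at hi
    rw [if_pos (by omega), if_neg (show ¬(N < i + 1 ∧ i + 1 ≤ 2 * N + 3) by omega)]
    by_cases h1 : k < i
    · rw [if_pos (by omega), if_pos h1]; simp
    · rw [if_neg (by omega), if_neg h1]; simp
  have hcard : (Finset.range N).filter (k < ·) = Finset.Ico (k + 1) N := by
    ext i; simp only [Finset.mem_filter, Finset.mem_range, Finset.mem_Ico]; omega
  rw [Finset.sum_congr rfl h, Finset.sum_boole, hcard, Nat.card_Ico, if_pos (by omega),
    if_pos (by omega), if_neg (show ¬(k < 2 * N + 3 ∧ 2 * N + 3 ≤ 2 * N + 1 - k) by omega),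
    if_neg (show ¬(N < 2 * N + 4 ∧ 2 * N + 4 ≤ 2 * N + 3) by omega)]
  push_cast [show k + 1 ≤ N from hk, hk.le]
  ring

/-- The crossings at indices `N` and `N + 1` contribute `1` and `-1`. The second of them is there to
produce this cancellation. -/
theorem index_eq_zero {k : ℕ} (hk : k < N) : (diagram N o).index (letter N o k) = 0 := by
  rw [← LongDiagram.inter_α_one _ (mem_firsts_letter (by omega)), inter_eq]
  simp only [cycleα_letter (show k < N + 2 by omega), partner_of_lt hk]
  rw [Finset.sum_eq_zero]
  · rw [if_neg (by omega), if_pos (by omega), if_pos (by omega), if_neg (by omega)]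
    simp
  · intro i hi
    rw [Finset.mem_range] at hi
    by_cases h1 : k ≤ i
    · rw [if_pos (by omega), if_pos (by omega)]; rfl
    · rw [if_neg (by omega), if_neg (by omega)]; rfl

theorem index_letter_self : (diagram N o).index (letter N o N) = N := by
  rw [← LongDiagram.inter_α_one _ (mem_firsts_letter (by omega)), inter_eq]
  simp only [cycleα_letter (show N < N + 2 by omega), partner_self]
  have h : ∀ i ∈ Finset.range N,
      ((if N < 2 * N + 1 - i ∧ 2 * N + 1 - i ≤ 2 * N + 3 then 1 else 0) * 1 -
        (if N < i + 1 ∧ i + 1 ≤ 2 * N + 3 then 1 else 0) * 1 : ℤ) = 1 := fun i hi => by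
    rw [Finset.mem_range] at hi
    rw [if_pos (by omega), if_neg (by omega)]; rfl
  rw [Finset.sum_congr rfl h, if_pos (by omega), if_pos (by omega), if_neg (by omega),
    if_neg (by omega)]
  simp

/-- With `o` true iff `a = 0`, only the crossing at index `N` has type `a`, so all level sums
vanish. The nested crossings, of the other type, provide a site for twisting at each level `N - k`.
-/
theorem realizable_zero (a : Fin 2) (hN : 2 ≤ N) :
    LongDiagram.Realizable a N (letter N (decide (a = 0)) N) 0 := by
  set o := decide (a = 0) with ho
  have hP : ∀ i, i < N + 2 → (passOver N o i = true ↔ a = 0) → i = N := fun i hi h => by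
    by_contra hne
    rw [passOver, if_pos (by omega), ho] at h
    simp at h
  have hPa : letter N o N ∈ (diagram N o).firsts a :=
    mem_firsts.2 ⟨N, by omega, by rw [passOver, if_neg (by omega), ho]; simp, rfl⟩
  have hsub : (diagram N o).firsts a ⊆ {letter N o N} := fun t ht => by
    obtain ⟨i, hi, h, rfl⟩ := mem_firsts.1 ht
    rw [hP i hi h]
    exact Finset.mem_singleton_self _
  have hT : ∀ t ∈ (Finset.range N).image (letter N o), ∃ k, k < N ∧ t = letter N o k := by
    intro t ht
    obtain ⟨k, hk, rfl⟩ := Finset.mem_image.1 ht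
    exact ⟨k, Finset.mem_range.1 hk, rfl⟩
  have hlev : ∀ k, k < N → N - (letter N o k).chord = N - k := fun k hk => by
    rw [letter, ofRight_chord, partner_of_lt hk, min_eq_left (by omega)]
  refine ⟨diagram N o, (Finset.range N).image (letter N o), fun t => N - t.chord,
    ⟨?_, hPa, ?_, ?_, ?_, ?_, ?_, ?_, ?_, index_letter_self, ?_⟩, ?_⟩
  · rw [numFaces_curve hN, length_word]; ring
  · intro h
    obtain ⟨k, hk, h⟩ := hT _ h
    have := congrArg chord h
    rw [letter, letter, ofRight_chord, ofRight_chord, partner_of_lt hk, partner_self] at this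
    omega
  · intro t ht
    obtain ⟨k, hk, rfl⟩ := hT t ht
    exact ⟨_, mem_firsts_letter (by omega)⟩
  · exact hsub.trans (Finset.singleton_subset_iff.2 (Finset.mem_insert_self _ _))
  · intro t ht
    obtain ⟨k, hk, rfl⟩ := hT t ht
    rw [hlev k hk, Finset.mem_Icc]
    omega
  · intro s hs t ht
    obtain ⟨k, hk, rfl⟩ := hT s hs
    obtain ⟨l, hl, rfl⟩ := hT t ht
    exact interα_eq_zero hk hl
  · intro t ht
    obtain ⟨k, hk, rfl⟩ := hT t ht
    rw [hlev k hk]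
    exact interα_letter_self hk
  · intro t ht
    obtain ⟨k, hk, rfl⟩ := hT t ht
    exact index_eq_zero hk
  · intro k hk
    rw [Finset.mem_Icc] at hk
    refine ⟨letter N o (N - k), Finset.mem_image_of_mem _ (Finset.mem_range.2 (by omega)), ?_⟩
    rw [hlev _ (by omega)]
    omega
  · rw [LongDiagram.levelSum, Finset.sum_eq_zero]
    intro t ht
    exact absurd (Finset.mem_singleton.1 (hsub (Finset.mem_of_mem_erase ht)))
      (Finset.ne_of_mem_erase ht)

end TorusModel

/-! ### Symmetric Laurent polynomials vanishing at one. -/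

namespace LaurentPolynomial

/-- The symmetric Laurent polynomial `t ^ k + t ^ (-k) - 2`. -/
noncomputable def symmT (k : ℤ) : LaurentPolynomial ℤ := T k + T (-k) - 2

theorem symmT_zero : symmT 0 = 0 := by
  rw [symmT, neg_zero, T_zero]
  norm_num

theorem eval_one_symmT (k : ℤ) : eval₂ (RingHom.id ℤ) 1 (symmT k) = 0 := by
  rw [symmT, map_sub, map_add, map_ofNat]
  simp

theorem symmT_coeff {n : ℤ} (hn : n ≠ 0) (k : ℕ) :
    (symmT k).coeff n = if k = n.natAbs then 1 else 0 := by
  have h2 : (2 : LaurentPolynomial ℤ) = C 2 := by simp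
  rw [symmT, h2, AddMonoidAlgebra.coeff_sub, AddMonoidAlgebra.coeff_add, Finsupp.sub_apply,
    Finsupp.add_apply, T_apply, T_apply, C_apply, if_neg hn]
  split_ifs <;> first | rfl | omega

/-- The coefficients of positive degree determine the combination, and by symmetry it agrees with
`f` in every nonzero degree. The difference is a constant that vanishes at `1`. -/
theorem exists_eq_linearCombination_symmT {f : LaurentPolynomial ℤ}
    (h1 : eval₂ (RingHom.id ℤ) 1 f = 0) (h2 : f = invert f) :
    ∃ m : ℕ →₀ ℤ, m 0 = 0 ∧ Finsupp.linearCombination ℤ (fun k : ℕ => symmT k) m = f := by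
  let m : ℕ →₀ ℤ := (f.coeff.comapDomain Nat.cast Nat.cast_injective.injOn).erase 0
  have hm : ∀ k, k ≠ 0 → m k = f.coeff k := fun k hk => Finsupp.erase_ne hk
  refine ⟨m, Finsupp.erase_same, ?_⟩
  set g := Finsupp.linearCombination ℤ (fun k : ℕ => symmT k) m with hg
  have hgn : ∀ n : ℤ, n ≠ 0 → g.coeff n = f.coeff n := fun n hn => by
    have h3 : g.coeff n = m n.natAbs := by
      rw [hg, Finsupp.linearCombination_apply, Finsupp.sum, AddMonoidAlgebra.coeff_sum,
        Finset.sum_apply', Finset.sum_eq_single n.natAbs]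
      · rw [AddMonoidAlgebra.coeff_smul, Finsupp.smul_apply, symmT_coeff hn, if_pos rfl]; simp
      · intro k _ hk
        rw [AddMonoidAlgebra.coeff_smul, Finsupp.smul_apply, symmT_coeff hn, if_neg hk]; simp
      · intro h
        rw [Finsupp.notMem_support_iff.1 h, zero_smul]; rfl
    rw [h3, hm _ (Int.natAbs_ne_zero.2 hn)]
    rcases Int.natAbs_eq n with h | h
    · rw [← h]
    · conv_rhs => rw [h2, invert_apply]
      rw [show (n.natAbs : ℤ) = -n by omega]
  have hge : eval₂ (RingHom.id ℤ) 1 g = 0 := by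
    rw [hg, Finsupp.linearCombination_apply, Finsupp.sum, map_sum]
    exact Finset.sum_eq_zero fun k _ => by rw [map_zsmul, eval_one_symmT, smul_zero]
  have hd : f - g = C ((f - g).coeff 0) := by
    ext n
    rw [C_apply]
    split_ifs with h
    · rw [h]
    · rw [AddMonoidAlgebra.coeff_sub, Finsupp.sub_apply, hgn n h, sub_self]
  have h0 : eval₂ (RingHom.id ℤ) 1 (f - g) = 0 := by rw [map_sub, h1, hge, sub_zero]
  rw [hd, eval₂_C, RingHom.id_apply] at h0
  rw [h0, map_zero] at hd
  exact (sub_eq_zero.1 hd).symm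

end LaurentPolynomial

/-! ### Sufficiency: realization on the torus. -/

namespace LongDiagram
open GaussLetter ClassFamily LaurentPolynomial

theorem units_mul_self_cast (u : ℤˣ) : (u : ℤ) * u = 1 := by
  rw [← Units.val_mul, Int.units_mul_self, Units.val_one]

section
variable {D : LongDiagram} {a : Fin 2} {N : ℕ} {P : GaussLetter} {T' : Finset GaussLetter}
  {lev : GaussLetter → ℕ}

theorem Tame.mem_of_mem_erase (h : D.Tame a N P T' lev) {t : GaussLetter}
    (ht : t ∈ (D.firsts a).erase P) : t ∈ T' :=
  (Finset.mem_insert.1 (h.subset (Finset.mem_of_mem_erase ht))).resolve_left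
    (Finset.ne_of_mem_erase ht)

theorem linearCombination_levelSum {M : Type*} [AddCommGroup M] (φ : ℕ → M) :
    Finsupp.linearCombination ℤ φ (D.levelSum a P lev) =
      ∑ t ∈ (D.firsts a).erase P, (t.sign : ℤ) • φ (lev t) := by
  rw [levelSum, map_sum]
  exact Finset.sum_congr rfl fun t _ => Finsupp.linearCombination_single _ _ _

/-- A family of signed classes of which one meets the other ones, these being disjoint. -/
theorem polyF_of_star {ι : Type*} [DecidableEq ι] {S : Finset ι} {p : ι} (hp : p ∈ S) (ε : ι → ℤ)
    (g : ι → ι → ℤ) (ν : ι → ℤ) (hpp : g p p = 0) (h : ∀ s ∈ S.erase p, ∀ t ∈ S.erase p, g s t = 0)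
    (h1 : ∀ t ∈ S.erase p, g p t = ν t) (h2 : ∀ t ∈ S.erase p, g t p = -ν t) :
    polyF S ε g = ε p • ∑ t ∈ S.erase p, ε t • symmT (ν t) := by
  have e : ∀ f : ι → LaurentPolynomial ℤ, ∑ c ∈ S, f c = f p + ∑ c ∈ S.erase p, f c := fun f =>
    (Finset.add_sum_erase S f hp).symm
  have h3 : ∀ c ∈ S.erase p, (∑ d ∈ S, (ε c * ε d) • (T (g c d) - 1 : LaurentPolynomial ℤ)) =
      (ε p * ε c) • (T (-ν c) - 1) := fun c hc => by
    rw [e, h2 c hc, Finset.sum_eq_zero, add_zero, mul_comm]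
    intro d hd
    rw [h c hc d hd, T_zero, sub_self, smul_zero]
  rw [polyF, e, Finset.sum_congr rfl h3, e, hpp, T_zero, sub_self, smul_zero, zero_add,
    ← Finset.sum_add_distrib, Finset.smul_sum]
  refine Finset.sum_congr rfl fun t ht => ?_
  rw [h1 t ht, ← smul_add, smul_smul, symmT]
  congr 1
  ring

/-- The crossings of type `a` form a star: apart from pairs that contain `P`, all of them are
disjoint. -/
theorem Tame.F_eq (h : D.Tame a N P T' lev) :
    D.F a a = (P.sign : ℤ) •
      Finsupp.linearCombination ℤ (fun k : ℕ => symmT k) (D.levelSum a P lev) := by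
  have hm := fun t (ht : t ∈ (D.firsts a).erase P) => h.mem_of_mem_erase ht
  rw [LongDiagram.F_eq, linearCombination_levelSum, polyF_of_star h.P_mem _ _ (fun t => lev t)]
  · have := D.interα_antisymm P P
    omega
  · exact fun s hs t ht => h.interα_eq_zero s (hm s hs) t (hm t ht)
  · exact fun t ht => h.interα_P t (hm t ht)
  · intro t ht
    rw [D.interα_antisymm, h.interα_P t (hm t ht)]

/-- The hypothesis makes the `a`-writhe zero, so no correction terms remain. As `P` has index `N`
and the others have index zero, complementary cycles again form a star, with levels shifted by `-N`.
-/
theorem Tame.H_eq (h : D.Tame a N P T' lev)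
    (hω : Finsupp.linearCombination ℤ (fun _ => (1 : ℤ)) (D.levelSum a P lev) = -P.sign) :
    D.H a a = (P.sign : ℤ) • Finsupp.linearCombination ℤ (fun k : ℕ => symmT (k - N))
      (D.levelSum a P lev) := by
  have hm := fun t (ht : t ∈ (D.firsts a).erase P) => h.mem_of_mem_erase ht
  have h0 : ∑ c ∈ D.firsts a, (c.sign : ℤ) = 0 := by
    rw [linearCombination_levelSum] at hω
    rw [← Finset.add_sum_erase _ _ h.P_mem]
    simp only [smul_eq_mul, mul_one] at hω
    rw [hω, add_neg_cancel]
  rw [LongDiagram.H_eq, linearCombination_levelSum, polyH, h0, zero_smul, zero_smul, sub_zero,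
    sub_zero, polyF_of_star h.P_mem _ _ (fun t => (lev t : ℤ) - N)]
  · have := D.interα_antisymm P P
    omega
  · intro s hs t ht
    rw [h.interα_eq_zero s (hm s hs) t (hm t ht), h.index_eq_zero s (hm s hs),
      h.index_eq_zero t (hm t ht)]
    rfl
  · intro t ht
    rw [h.interα_P t (hm t ht), h.index_eq_zero t (hm t ht), h.index_P]
    ring
  · intro t ht
    rw [D.interα_antisymm, h.interα_P t (hm t ht), h.index_eq_zero t (hm t ht), h.index_P]
    ring

end

/-- The upper bound is strict so that the reflected level `N - k` is positive as well. -/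
theorem exists_support_subset (m : ℕ →₀ ℤ) (h0 : m 0 = 0) :
    ∃ N, 2 ≤ N ∧ ∀ k ∈ m.support, 1 ≤ k ∧ k < N := by
  refine ⟨m.support.sup id + 2, by omega, fun k hk => ⟨?_, ?_⟩⟩
  · have : k ≠ 0 := fun h => Finsupp.mem_support_iff.1 hk (h ▸ h0)
    omega
  · have : k ≤ m.support.sup id := Finset.le_sup (f := id) hk
    omega

theorem exists_F_eq (a : Fin 2) {f : LaurentPolynomial ℤ}
    (h1 : eval₂ (RingHom.id ℤ) 1 f = 0) (h2 : f = invert f) :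
    ∃ D : LongDiagram, D.F a a = f ∧ 2 * D.curve.numFaces = D.word.length := by
  obtain ⟨m, hm0, hm⟩ := exists_eq_linearCombination_symmT h1 h2
  obtain ⟨N, hN, hmN⟩ := exists_support_subset m hm0
  obtain ⟨P, hP⟩ : ∃ P, Realizable a N P 0 := ⟨_, TorusModel.realizable_zero a hN⟩
  -- The factor `P.sign` cancels the sign of `P` in `Tame.F_eq`.
  obtain ⟨D, T', lev, hD, hsum⟩ := hP.of_zero (m := (P.sign : ℤ) • m) fun k hk => by
    have := hmN k (Finsupp.support_smul hk)
    exact Finset.mem_Icc.2 ⟨this.1, this.2.le⟩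
  exact ⟨D, by rw [hD.F_eq, hsum, map_smul, smul_smul, units_mul_self_cast, one_smul, hm],
    hD.torus⟩

theorem exists_H_eq (a : Fin 2) {f : LaurentPolynomial ℤ}
    (h1 : eval₂ (RingHom.id ℤ) 1 f = 0) (h2 : f = invert f) :
    ∃ D : LongDiagram, D.H a a = f ∧ 2 * D.curve.numFaces = D.word.length := by
  obtain ⟨m, hm0, hm⟩ := exists_eq_linearCombination_symmT h1 h2
  obtain ⟨N, hN, hmN⟩ := exists_support_subset m hm0
  obtain ⟨P, hP⟩ : ∃ P, Realizable a N P 0 := ⟨_, TorusModel.realizable_zero a hN⟩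
  -- Level `N - k` yields `symmT (-k) = symmT k` in `Tame.H_eq`, hence the reflection. The number
  -- `c` of additional crossings at level `N` makes the writhe zero, at no cost because `symmT 0 =
  -- 0`.
  set l := Finsupp.mapDomain (fun k => N - k) ((P.sign : ℤ) • m) with hl
  set c := -(P.sign : ℤ) - Finsupp.linearCombination ℤ (fun _ => (1 : ℤ)) l with hc
  obtain ⟨D, T', lev, hD, hsum⟩ := hP.of_zero (m := l + Finsupp.single N c) fun k hk => by
    rw [Finset.mem_Icc]
    rcases Finset.mem_union.1 (Finsupp.support_add hk) with h | h
    · obtain ⟨i, hi, rfl⟩ := Finset.mem_image.1 (Finsupp.mapDomain_support h)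
      have := hmN i (Finsupp.support_smul hi)
      omega
    · have := Finset.mem_singleton.1 (Finsupp.support_single_subset h)
      omega
  refine ⟨D, ?_, hD.torus⟩
  rw [hD.H_eq, hsum, map_add, Finsupp.linearCombination_single, sub_self, symmT_zero, smul_zero,
    add_zero, hl, Finsupp.linearCombination_mapDomain, map_smul, smul_smul, units_mul_self_cast,
    one_smul, ← hm, Finsupp.linearCombination_apply, Finsupp.linearCombination_apply]
  · refine Finsupp.sum_congr fun k hk => ?_
    have := (hmN k hk).2.le
    congr 1
    rw [Function.comp_apply, symmT, symmT, Nat.cast_sub this, show (N : ℤ) - k - N = -k by ring,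
      neg_neg, add_comm (T k)]
  · rw [hsum, map_add, Finsupp.linearCombination_single, hc]
    simp

end LongDiagram

/-! ### From diagrams to long virtual knots: the equivalences. -/

namespace LongVirtualKnot
open LaurentPolynomial

theorem exists_presents (K : LongVirtualKnot) : ∃ D : LongDiagram, D.Presents K :=
  Quot.exists_rep K

theorem tfae_of_symmetric_of_realizable (p : LongDiagram → LaurentPolynomial ℤ)
    (hp : ∀ (D D' : LongDiagram) (K : LongVirtualKnot), D.Presents K → D'.Presents K → p D = p D')
    (hs : ∀ D, eval₂ (RingHom.id ℤ) 1 (p D) = 0 ∧ p D = invert (p D))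
    (f : LaurentPolynomial ℤ)
    (hr : eval₂ (RingHom.id ℤ) 1 f = 0 → f = invert f →
      ∃ D : LongDiagram, p D = f ∧ 2 * D.curve.numFaces = D.word.length) :
    List.TFAE
      [∃ K : LongVirtualKnot, ∀ D : LongDiagram, D.Presents K → p D = f,
        ∃ K : LongVirtualKnot, (∀ D : LongDiagram, D.Presents K → p D = f) ∧ K.sg₁ ≤ 1,
        eval₂ (RingHom.id ℤ) 1 f = 0 ∧ f = invert f] := by
  tfae_have 2 → 1 := fun ⟨K, h, _⟩ => ⟨K, h⟩
  tfae_have 1 → 3 := fun ⟨K, h⟩ => by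
    obtain ⟨D, hD⟩ := K.exists_presents
    rw [← h D hD]
    exact hs D
  tfae_have 3 → 2 := fun ⟨h1, h2⟩ => by
    obtain ⟨D, hf, hD⟩ := hr h1 h2
    exact ⟨Quot.mk _ D, fun D' hD' => (hp D' D _ hD' rfl).trans hf,
      LongDiagram.sg₁_le_one rfl hD⟩
  tfae_finish

end LongVirtualKnot

theorem theorem7p1 (f : LaurentPolynomial ℤ) :
    List.TFAE
      [∃ K : LongVirtualKnot, K.HasF 0 0 f,
        ∃ K : LongVirtualKnot, K.HasF 0 0 f ∧ K.sg₁ ≤ 1,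
        LaurentPolynomial.eval₂ (RingHom.id ℤ) 1 f = 0 ∧ f = LaurentPolynomial.invert f] ∧
    List.TFAE
      [∃ K : LongVirtualKnot, K.HasF 1 1 f,
        ∃ K : LongVirtualKnot, K.HasF 1 1 f ∧ K.sg₁ ≤ 1,
        LaurentPolynomial.eval₂ (RingHom.id ℤ) 1 f = 0 ∧ f = LaurentPolynomial.invert f] ∧
    List.TFAE
      [∃ K : LongVirtualKnot, K.HasH 0 0 f,
        ∃ K : LongVirtualKnot, K.HasH 0 0 f ∧ K.sg₁ ≤ 1,
        LaurentPolynomial.eval₂ (RingHom.id ℤ) 1 f = 0 ∧ f = LaurentPolynomial.invert f] ∧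
    List.TFAE
      [∃ K : LongVirtualKnot, K.HasH 1 1 f,
        ∃ K : LongVirtualKnot, K.HasH 1 1 f ∧ K.sg₁ ≤ 1,
        LaurentPolynomial.eval₂ (RingHom.id ℤ) 1 f = 0 ∧ f = LaurentPolynomial.invert f] := by
  have hF : ∀ (a : Fin 2) (D D' : LongDiagram) (K : LongVirtualKnot),
      D.Presents K → D'.Presents K → D.F a a = D'.F a a := fun a _ _ _ h h' =>
    (LongDiagram.samePolynomials_of_presents h h' a).1
  have hH : ∀ (a : Fin 2) (D D' : LongDiagram) (K : LongVirtualKnot),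
      D.Presents K → D'.Presents K → D.H a a = D'.H a a := fun a _ _ _ h h' =>
    (LongDiagram.samePolynomials_of_presents h h' a).2
  exact ⟨LongVirtualKnot.tfae_of_symmetric_of_realizable _ (hF 0) (fun D => D.F_symmetric 0) f
      (LongDiagram.exists_F_eq 0),
    LongVirtualKnot.tfae_of_symmetric_of_realizable _ (hF 1) (fun D => D.F_symmetric 1) f
      (LongDiagram.exists_F_eq 1),
    LongVirtualKnot.tfae_of_symmetric_of_realizable _ (hH 0) (fun D => D.H_symmetric 0) f
      (LongDiagram.exists_H_eq 0),
    LongVirtualKnot.tfae_of_symmetric_of_realizable _ (hH 1) (fun D => D.H_symmetric 1) f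
      (LongDiagram.exists_H_eq 1)⟩
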